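/- Let $n$ and $k$ be integers with $1\le k\le n$. Place $n$ labelled vertices at the vertices of a regular $n$-gon inscribed in a circle. A graph on these vertices is non-crossing if its edges, drawn as straight line segments, do not cross (i.e. any two edges without a common endpoint are disjoint segments). Let $F_{n,k}$ be the set of non-crossing forests (acyclic non-crossing graphs) on these $n$ vertices having exactly $k$ connected components, and let the cyclic group $\langle\rho\rangle$ of order $n$, generated by the rotation $\rho$ through the angle $2\pi/n$, act on $F_{n,k}$ by rotating forests. Put $$[m]_q=1+q+\cdots+q^{m-1},\qquad [m]_q!=[m]_q[m-1]_q\cdots[1]_q,\qquad \binom{a}{b}_q=\frac{[a]_q!}{[b]_q!\,[a-b]_q!},$$ and $$f_{n,k}(q)=\frac{1}{[2n-k]_q}\binom{n}{k-1}_q\binom{3n-2k-1}{n-k}_q .$$ Then $f_{n,k}(q)$ is a polynomial in $q$ with nonnegative integer coefficients, and the triple $(F_{n,k},\langle\rho\rangle,f_{n,k}(q))$ exhibits the cyclic sieving phenomenon: for every $c\in\langle\rho\rangle$, if $o(c)$ is the order of $c$ and $\omega\in\mathbb{C}$ is a primitive $o(c)$-th root of unity, then $$f_{n,k}(\omega)=\#\{\varphi\in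 F_{n,k}: c(\varphi)=\varphi\}.$$ -/

import Mathlib

noncomputable section

/-! ### `q`-analogues, as elements of the field `ℚ(q)` -/

/-- The `q`-integer `[m]_q = 1 + q + ⋯ + q^(m-1)`. -/
def qInt (m : ℕ) : RatFunc ℚ := ∑ i ∈ Finset.range m, RatFunc.X ^ i

/-- The `q`-factorial `[m]_q! = [m]_q [m-1]_q ⋯ [1]_q`. -/
def qFactorial (m : ℕ) : RatFunc ℚ := ∏ i ∈ Finset.range m, qInt (i + 1)

/-- The `q`-binomial coefficient `[a choose b]_q = [a]_q! / ([b]_q! [a-b]_q!)` for `b ≤ a`,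
and `0` for `b > a`. -/
def qBinom (a b : ℕ) : RatFunc ℚ :=
  if b ≤ a then qFactorial a / (qFactorial b * qFactorial (a - b)) else 0

/-- The rational function
`f_{n,k}(q) = (1 / [2n-k]_q) [n choose k-1]_q [3n-2k-1 choose n-k]_q`.
For `1 ≤ k ≤ n` none of the subtractions truncates. -/
def forestRatFunc (n k : ℕ) : RatFunc ℚ :=
  1 / qInt (2 * n - k) * qBinom n (k - 1) * qBinom (3 * n - 2 * k - 1) (n - k)

/-- `P`, a polynomial with coefficients in `ℕ`, viewed as an element of `ℚ(q)`. -/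
def toRatFunc (P : Polynomial ℕ) : RatFunc ℚ :=
  algebraMap (Polynomial ℚ) (RatFunc ℚ) (P.map (Nat.castRingHom ℚ))

/-! ### The cyclic sieving phenomenon -/

/-- The triple `(X, C, P)`, with `C` a finite cyclic group acting on the finite set `X` and
`P ∈ ℕ[q]`, exhibits the cyclic sieving phenomenon: for every `c ∈ C`, the value of `P` at a
primitive root of unity of order `o(c)` is the number of points of `X` fixed by `c`. -/
def ExhibitsCSP (X C : Type*) [Group C] [Finite C] [IsCyclic C] [Finite X] [MulAction C X]
    (P : Polynomial ℕ) : Prop :=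
  ∀ (c : C) (ω : ℂ), IsPrimitiveRoot ω (orderOf c) →
    P.eval₂ (Nat.castRingHom ℂ) ω = (Nat.card {x : X // c • x = x} : ℂ)

/-! ### Non-crossing forests -/

section Forests

variable {n : ℕ}

variable (n) in
/-- The rotation of the `n` vertices by the angle `2 π / n`. -/
def vertexRotation : Equiv.Perm (ZMod n) := Equiv.addRight 1

variable (n) in
/-- The cyclic group `⟨ρ⟩` of order `n` generated by the rotation. -/
abbrev RotationGroup : Type := Subgroup.zpowers (vertexRotation n)

theorem vertexRotation_zpow_apply (m : ℤ) (x : ZMod n) : (vertexRotation n ^ m) x = x + m := by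
  simp [vertexRotation]

theorem card_rotationGroup : Nat.card (RotationGroup n) = n := by
  rw [Nat.card_zpowers]
  refine Nat.dvd_antisymm (orderOf_dvd_of_pow_eq_one ?_) ?_
  · ext x
    have h := vertexRotation_zpow_apply (n := n) (n : ℤ) x
    rw [zpow_natCast] at h
    rw [h]
    simp
  · have h := vertexRotation_zpow_apply (n := n) (orderOf (vertexRotation n) : ℤ) 0
    rw [zpow_natCast, pow_orderOf_eq_one] at h
    rw [← ZMod.natCast_eq_zero_iff]
    simpa using h.symm

variable [NeZero n]

/-- The position of the vertex `j` on the unit circle: the point `exp (2 π i j / n)`. -/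
def vertexPos (j : ZMod n) : ℂ := ZMod.stdAddChar j

/-- The straight line segment between the vertices `a` and `b`. -/
def chord (a b : ZMod n) : Set ℂ := segment ℝ (vertexPos a) (vertexPos b)

/-- A graph on `n` vertices arranged on a circle is non-crossing if its edges, drawn as straight
line segments, do not cross. Two chords of a circle with a common endpoint never cross; two
chords without a common endpoint cross if and only if they meet. -/
def IsNoncrossing (G : SimpleGraph (ZMod n)) : Prop :=
  ∀ a b c d : ZMod n, G.Adj a b → G.Adj c d → a ≠ c → a ≠ d → b ≠ c → b ≠ d →
    Disjoint (chord a b) (chord c d)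

variable (n) in
/-- The set of non-crossing forests on `n` vertices with `k` components. -/
def NoncrossingForest (k : ℕ) : Type :=
  {G : SimpleGraph (ZMod n) //
    IsNoncrossing G ∧ G.IsAcyclic ∧ Nat.card G.ConnectedComponent = k}

instance (k : ℕ) : Finite (NoncrossingForest n k) := by
  unfold NoncrossingForest; infer_instance

/-- A rotation of the vertices is realised by a rotation of the plane. -/
theorem RotationGroup.chord_eq (g : RotationGroup n) :
    ∃ z : ℂ, z ≠ 0 ∧ ∀ a b : ZMod n, chord (g.1 a) (g.1 b) = (fun w => z * w) '' chord a b := by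
  obtain ⟨g, m, rfl⟩ := g
  refine ⟨vertexPos (m : ZMod n), by simp [vertexPos, ZMod.stdAddChar_apply], fun a b => ?_⟩
  have h : ∀ x : ZMod n, vertexPos ((vertexRotation n ^ m) x)
      = LinearMap.mulLeft ℝ (vertexPos (m : ZMod n)) (vertexPos x) := by
    intro x
    rw [vertexRotation_zpow_apply, vertexPos, AddChar.map_add_eq_mul, mul_comm]
    rfl
  change segment ℝ (vertexPos ((vertexRotation n ^ m) a)) (vertexPos ((vertexRotation n ^ m) b)) = _
  rw [h, h]
  exact (image_segment ℝ (LinearMap.mulLeft ℝ (vertexPos (m : ZMod n))).toAffineMap _ _).symm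

theorem IsNoncrossing.map {G : SimpleGraph (ZMod n)} (hG : IsNoncrossing G)
    (g : RotationGroup n) : IsNoncrossing (G.map g.1) := by
  intro a b c d hab hcd h1 h2 h3 h4
  have key : ∀ u v, (G.map g.1).Adj u v → ∃ u' v', G.Adj u' v' ∧ g.1 u' = u ∧ g.1 v' = v := by
    intro u v h
    refine ⟨g.1.symm u, g.1.symm v, ?_, by simp, by simp⟩
    have := (SimpleGraph.Iso.map g.1 G).map_adj_iff (v := g.1.symm u) (w := g.1.symm v)
    exact this.1 (by simpa using h)
  obtain ⟨a, b, hab', rfl, rfl⟩ := key _ _ hab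
  obtain ⟨c, d, hcd', rfl, rfl⟩ := key _ _ hcd
  obtain ⟨z, hz, hchord⟩ := g.chord_eq
  rw [hchord, hchord]
  exact (Set.disjoint_image_iff (mul_right_injective₀ hz)).2
    (hG a b c d hab' hcd' (by rintro rfl; exact h1 rfl) (by rintro rfl; exact h2 rfl)
      (by rintro rfl; exact h3 rfl) (by rintro rfl; exact h4 rfl))

/-- The action of `⟨ρ⟩` on non-crossing forests by rotation: every edge `{a, b}` is sent to
`{g a, g b}`. -/
instance (k : ℕ) : MulAction (RotationGroup n) (NoncrossingForest n k) where
  smul g F := ⟨F.1.map g.1, F.2.1.map g,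
    (SimpleGraph.Iso.map g.1 F.1).isAcyclic_iff.1 F.2.2.1,
    (Nat.card_congr (SimpleGraph.Iso.map g.1 F.1).connectedComponentEquiv).symm.trans F.2.2.2⟩
  one_smul F := Subtype.ext (SimpleGraph.map_id F.1)
  mul_smul g h F := Subtype.ext (SimpleGraph.map_map (G := F.1) h.1 g.1).symm

end Forests

end

/-!
A rotation of order `d` with `n = d m` fixes a forest exactly when the forest is invariant under the
rotation by `m` steps (`smul_eq_iff_shiftInvariant`). So both sides of the sieving identity can be
computed: the invariant forests are counted, and the polynomial is evaluated at a primitive `d`-th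
root of unity. Throughout, `e = n - k` is the number of edges.

*Counting.* Cutting the circle open between two vertices identifies non-crossing forests with *line
forests*, finite sets of pairs `a < b` of natural numbers in which every pair is the smallest one
over some unit interval (`forest_iff_isLineForest`). Cutting a line forest at the far end of its
longest edge at `0` gives functional equations for the generating functions, which determine all
the numbers needed in closed form (`coeff_forestPoly`, `succ_mul_coeff_archedPoly`,
`coeff_prefixPoly`). For `d ≥ 2` an invariant forest has no edge longer than `m`, since it would
cross one of its images. If no edge is as long as `m`, the forest consists of `d` rotated copies of
a line forest on `m` vertices, and the choice of its base vertex amounts to marking a stretch of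
covered unit intervals at its start (`card_invariant_central`). If some edge has length `m`, then
`d = 2`, the edge is a diameter, and the forest consists of two copies of a line forest containing
the longest possible edge (`card_invariant_diameter`).

*Evaluating.* The polynomial has a form free of division, `forestQPoly`, in terms of Gaussian
binomial coefficients defined by the `q`-Pascal recursion (`intRatFunc_forestQPoly`). Its values at
roots of unity follow from the `q`-Lucas theorem (`aeval_gaussBinom_lucas`).

*Nonnegativity.* The product `G` of the two Gaussian binomial coefficients in the definition of the
sieving polynomial `f` is palindromic and its coefficients increase up to the middle: it counts
configurations of particles on two chains by the sum of their positions, and the suitably weighted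
operator moving one particle up by one is the raising operator of a representation of `sl₂`, so it
is injective below the middle (`coeff_gaussBinom_mul_le_succ`). With `M = 2 n - k`, the relation
`f [M] = G` reads `(1 - q ^ M) f = (1 - q) G`, that is `f_r = f_{r - M} + (G_r - G_{r - 1})`, which
gives nonnegative coefficients in the lower half, and `f` is palindromic as well.
-/

/-! ### Non-crossing forests on a line -/

/-- The finset `E` of pairs `a < b` encodes a non-crossing forest on the vertices `0, …, N` of a
line. Acyclicity is encoded by `gap`: every edge is the smallest edge over some unit
interval `[i, i + 1]`. -/
structure IsLineForest (N : ℕ) (E : Finset (ℕ × ℕ)) : Prop where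
  lt : ∀ p ∈ E, p.1 < p.2
  le : ∀ p ∈ E, p.2 ≤ N
  nc : ∀ p ∈ E, ∀ q ∈ E, p.1 < q.1 → q.1 < p.2 → q.2 ≤ p.2
  gap : ∀ p ∈ E, ∃ i, p.1 ≤ i ∧ i < p.2 ∧ ∀ q ∈ E, q.1 ≤ i → i < q.2 → q.1 ≤ p.1 ∧ p.2 ≤ q.2

/-- The unit interval `[i, i + 1]` lies under an edge of `E`. -/
def Covered (E : Finset (ℕ × ℕ)) (i : ℕ) : Prop := ∃ q ∈ E, q.1 ≤ i ∧ i < q.2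

open Classical in
/-- The set of all non-crossing forests on the vertices `0, …, N` of a line. -/
noncomputable def lineForests (N : ℕ) : Finset (Finset (ℕ × ℕ)) :=
  {E ∈ (Finset.range (N + 1) ×ˢ Finset.range (N + 1)).powerset | IsLineForest N E}

/-- The forests on the vertices `0, …, N` that contain the longest possible edge `(0, N)`. -/
noncomputable def archedForests (N : ℕ) : Finset (Finset (ℕ × ℕ)) :=
  {E ∈ lineForests N | (0, N) ∈ E}

/-- Translation of a set of edges by `s`. -/
def shiftEdges (s : ℕ) (E : Finset (ℕ × ℕ)) : Finset (ℕ × ℕ) :=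
  E.image fun p => (p.1 + s, p.2 + s)

/-- Translation of a set of edges by `-s`. -/
def unshiftEdges (s : ℕ) (E : Finset (ℕ × ℕ)) : Finset (ℕ × ℕ) :=
  E.image fun p => (p.1 - s, p.2 - s)

theorem mem_lineForests {N : ℕ} {E : Finset (ℕ × ℕ)} :
    E ∈ lineForests N ↔ IsLineForest N E := by
  classical
  simp only [lineForests, Finset.mem_filter, Finset.mem_powerset, and_iff_right_iff_imp]
  intro h p hp
  have := h.lt p hp
  have := h.le p hp
  simp only [Finset.mem_product, Finset.mem_range]
  omega

theorem mem_archedForests {N : ℕ} {E : Finset (ℕ × ℕ)} :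
    E ∈ archedForests N ↔ IsLineForest N E ∧ (0, N) ∈ E := by
  simp [archedForests, mem_lineForests]

theorem mem_shiftEdges {s : ℕ} {E : Finset (ℕ × ℕ)} {a b : ℕ} :
    (a, b) ∈ shiftEdges s E ↔ ∃ c d, (c, d) ∈ E ∧ c + s = a ∧ d + s = b := by
  simp [shiftEdges]

theorem add_mem_shiftEdges {s : ℕ} {E : Finset (ℕ × ℕ)} {a b : ℕ} :
    (a + s, b + s) ∈ shiftEdges s E ↔ (a, b) ∈ E := by
  simp [mem_shiftEdges]

theorem mem_unshiftEdges {s : ℕ} {E : Finset (ℕ × ℕ)} {a b : ℕ} :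
    (a, b) ∈ unshiftEdges s E ↔ ∃ c d, (c, d) ∈ E ∧ c - s = a ∧ d - s = b := by
  simp [unshiftEdges]

theorem card_shiftEdges (s : ℕ) (E : Finset (ℕ × ℕ)) : (shiftEdges s E).card = E.card := by
  refine Finset.card_image_of_injective _ fun p q h => ?_
  simp only [Prod.mk.injEq, add_left_inj] at h
  exact Prod.ext h.1 h.2

theorem unshiftEdges_shiftEdges (s : ℕ) (E : Finset (ℕ × ℕ)) :
    unshiftEdges s (shiftEdges s E) = E := by
  ext ⟨a, b⟩
  simp only [mem_unshiftEdges, mem_shiftEdges]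
  constructor
  · rintro ⟨_, _, ⟨c, d, h, rfl, rfl⟩, h1, h2⟩
    simp only [Nat.add_sub_cancel] at h1 h2
    rwa [← h1, ← h2]
  · intro h
    exact ⟨_, _, ⟨a, b, h, rfl, rfl⟩, by simp, by simp⟩

theorem shiftEdges_unshiftEdges {s : ℕ} {E : Finset (ℕ × ℕ)} (h : ∀ p ∈ E, s ≤ p.1 ∧ s ≤ p.2) :
    shiftEdges s (unshiftEdges s E) = E := by
  ext ⟨a, b⟩
  simp only [mem_unshiftEdges, mem_shiftEdges]
  constructor
  · rintro ⟨_, _, ⟨c, d, hcd, rfl, rfl⟩, rfl, rfl⟩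
    have := h _ hcd
    simp only at this
    rwa [Nat.sub_add_cancel this.1, Nat.sub_add_cancel this.2]
  · intro hab
    have := h _ hab
    simp only at this
    exact ⟨_, _, ⟨a, b, hab, rfl, rfl⟩, Nat.sub_add_cancel this.1, Nat.sub_add_cancel this.2⟩

theorem IsLineForest.empty (N : ℕ) : IsLineForest N ∅ := by
  constructor <;> simp

/-- Removing edges keeps a line forest a line forest, provided all remaining ones fit. -/
theorem IsLineForest.subset {N M : ℕ} {E E' : Finset (ℕ × ℕ)} (h : IsLineForest N E)
    (hE : E' ⊆ E) (hM : ∀ p ∈ E', p.2 ≤ M) : IsLineForest M E' where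
  lt p hp := h.lt p (hE hp)
  le := hM
  nc p hp q hq := h.nc p (hE hp) q (hE hq)
  gap p hp := by
    obtain ⟨i, h1, h2, h3⟩ := h.gap p (hE hp)
    exact ⟨i, h1, h2, fun q hq => h3 q (hE hq)⟩

theorem IsLineForest.shift {N : ℕ} {E : Finset (ℕ × ℕ)} (h : IsLineForest N E) (s : ℕ) :
    IsLineForest (N + s) (shiftEdges s E) where
  lt := by
    rintro ⟨a, b⟩ hp
    obtain ⟨c, d, hcd, rfl, rfl⟩ := mem_shiftEdges.1 hp
    have := h.lt _ hcd
    simpa using this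
  le := by
    rintro ⟨a, b⟩ hp
    obtain ⟨c, d, hcd, rfl, rfl⟩ := mem_shiftEdges.1 hp
    have := h.le _ hcd
    simpa using this
  nc := by
    rintro ⟨a, b⟩ hp ⟨a', b'⟩ hq
    obtain ⟨c, d, hcd, rfl, rfl⟩ := mem_shiftEdges.1 hp
    obtain ⟨c', d', hcd', rfl, rfl⟩ := mem_shiftEdges.1 hq
    have := h.nc _ hcd _ hcd'
    simpa using this
  gap := by
    rintro ⟨a, b⟩ hp
    obtain ⟨c, d, hcd, rfl, rfl⟩ := mem_shiftEdges.1 hp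
    obtain ⟨i, h1, h2, h3⟩ := h.gap _ hcd
    refine ⟨i + s, by simpa using h1, by simpa using h2, ?_⟩
    rintro ⟨a', b'⟩ hq
    obtain ⟨c', d', hcd', rfl, rfl⟩ := mem_shiftEdges.1 hq
    simpa using h3 _ hcd'

theorem IsLineForest.unshift {N s : ℕ} {E : Finset (ℕ × ℕ)} (h : IsLineForest (N + s) E)
    (hs : ∀ p ∈ E, s ≤ p.1) : IsLineForest N (unshiftEdges s E) where
  lt := by
    rintro ⟨a, b⟩ hp
    obtain ⟨c, d, hcd, rfl, rfl⟩ := mem_unshiftEdges.1 hp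
    have := h.lt _ hcd
    have := hs _ hcd
    simp only at *
    omega
  le := by
    rintro ⟨a, b⟩ hp
    obtain ⟨c, d, hcd, rfl, rfl⟩ := mem_unshiftEdges.1 hp
    have := h.le _ hcd
    simp only at *
    omega
  nc := by
    rintro ⟨a, b⟩ hp ⟨a', b'⟩ hq
    obtain ⟨c, d, hcd, rfl, rfl⟩ := mem_unshiftEdges.1 hp
    obtain ⟨c', d', hcd', rfl, rfl⟩ := mem_unshiftEdges.1 hq
    have := h.nc _ hcd _ hcd'
    have := hs _ hcd
    have := hs _ hcd'
    have := h.lt _ hcd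
    simp only at *
    omega
  gap := by
    rintro ⟨a, b⟩ hp
    obtain ⟨c, d, hcd, rfl, rfl⟩ := mem_unshiftEdges.1 hp
    obtain ⟨i, h1, h2, h3⟩ := h.gap _ hcd
    have := hs _ hcd
    simp only at *
    refine ⟨i - s, by omega, by omega, ?_⟩
    rintro ⟨a', b'⟩ hq
    obtain ⟨c', d', hcd', rfl, rfl⟩ := mem_unshiftEdges.1 hq
    have := h3 _ hcd'
    have := hs _ hcd'
    simp only at *
    omega

/-- Two line forests on consecutive stretches of vertices form a line forest together. -/
theorem IsLineForest.union {N s : ℕ} {E E' : Finset (ℕ × ℕ)} (h : IsLineForest s E)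
    (h' : IsLineForest N E') (hs : ∀ p ∈ E', s ≤ p.1) (hN : s ≤ N) : IsLineForest N (E ∪ E') where
  lt p hp := by
    rcases Finset.mem_union.1 hp with hp | hp
    exacts [h.lt p hp, h'.lt p hp]
  le p hp := by
    rcases Finset.mem_union.1 hp with hp | hp
    exacts [(h.le p hp).trans hN, h'.le p hp]
  nc p hp q hq := by
    rcases Finset.mem_union.1 hp with hp | hp <;> rcases Finset.mem_union.1 hq with hq | hq
    · exact h.nc p hp q hq
    · have := hs q hq
      have := h.le p hp
      omega
    · have := hs p hp
      have := h.le q hq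
      have := h.lt q hq
      omega
    · exact h'.nc p hp q hq
  gap p hp := by
    rcases Finset.mem_union.1 hp with hp | hp
    · obtain ⟨i, h1, h2, h3⟩ := h.gap p hp
      refine ⟨i, h1, h2, fun q hq => ?_⟩
      rcases Finset.mem_union.1 hq with hq | hq
      · exact h3 q hq
      · have := hs q hq
        have := h.le p hp
        omega
    · obtain ⟨i, h1, h2, h3⟩ := h'.gap p hp
      refine ⟨i, h1, h2, fun q hq => ?_⟩
      rcases Finset.mem_union.1 hq with hq | hq
      · have := hs p hp
        have := h.le q hq
        omega
      · exact h3 q hq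

/-- The far end of the longest edge at the vertex `0`, or `0` if there is no such edge. -/
def firstStep (E : Finset (ℕ × ℕ)) : ℕ := (E.filter fun p => p.1 = 0).sup Prod.snd

theorem le_firstStep {E : Finset (ℕ × ℕ)} {b : ℕ} (h : (0, b) ∈ E) : b ≤ firstStep E :=
  Finset.le_sup (f := Prod.snd) (b := (0, b)) (by simp [h])

theorem firstStep_mem {E : Finset (ℕ × ℕ)} (h : firstStep E ≠ 0) : (0, firstStep E) ∈ E := by
  have hne : (E.filter fun p => p.1 = 0).Nonempty := by
    rw [Finset.nonempty_iff_ne_empty]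
    intro h0
    exact h (by simp [firstStep, h0])
  obtain ⟨⟨a, b⟩, hp, hpe⟩ := Finset.exists_mem_eq_sup _ hne Prod.snd
  simp only [Finset.mem_filter] at hp
  obtain ⟨hp, rfl⟩ := hp
  rw [firstStep, hpe]
  exact hp

theorem firstStep_eq_zero_iff {E : Finset (ℕ × ℕ)} (h : ∀ p ∈ E, p.1 < p.2) :
    firstStep E = 0 ↔ ∀ p ∈ E, 1 ≤ p.1 := by
  constructor
  · rintro h0 ⟨a, b⟩ hp
    by_contra hlt
    have ha : a = 0 := by simpa using hlt
    subst ha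
    have h1 := le_firstStep hp
    have h2 := h _ hp
    simp only at h2
    omega
  · intro h1
    by_contra h0
    have := h1 _ (firstStep_mem h0)
    simp at this

/-- Cutting a forest at the far end of the longest edge at `0`. -/
theorem IsLineForest.le_or_le_firstStep {N : ℕ} {E : Finset (ℕ × ℕ)} (h : IsLineForest N E)
    {p : ℕ × ℕ} (hp : p ∈ E) : p.2 ≤ firstStep E ∨ firstStep E ≤ p.1 := by
  obtain ⟨a, b⟩ := p
  by_cases h0 : firstStep E = 0
  · exact Or.inr (by omega)
  have h1 := firstStep_mem h0
  rcases Nat.eq_zero_or_pos a with rfl | ha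
  · exact Or.inl (le_firstStep hp)
  · have := h.nc _ h1 _ hp
    simp only at *
    omega

theorem firstStep_union_shift {s : ℕ} {E E' : Finset (ℕ × ℕ)} (h : IsLineForest s E)
    (hs : (0, s) ∈ E) : firstStep (E ∪ shiftEdges s E') = s := by
  apply le_antisymm
  · refine Finset.sup_le ?_
    rintro ⟨a, b⟩ hp
    simp only [Finset.mem_filter, Finset.mem_union] at hp
    obtain ⟨hp | hp, rfl⟩ := hp
    · exact h.le _ hp
    · obtain ⟨c, d, hcd, h1, h2⟩ := mem_shiftEdges.1 hp
      have := h.lt _ hs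
      simp only at this
      omega
  · exact le_firstStep (Finset.mem_union_left _ hs)

/-- The decomposition of line forests at their first step: either no edge starts at the
vertex `0`, or the longest such edge `(0, s)` splits the forest in two. -/
theorem sum_lineForests_succ {M : Type*} [AddCommMonoid M] (N : ℕ)
    (f : Finset (ℕ × ℕ) → M) :
    ∑ E ∈ lineForests (N + 1), f E = ∑ E ∈ lineForests N, f (shiftEdges 1 E) +
      ∑ s ∈ Finset.range (N + 1), ∑ E ∈ archedForests (s + 1), ∑ E' ∈ lineForests (N - s),
        f (E ∪ shiftEdges (s + 1) E') := by
  classical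
  have hmaps : ∀ E ∈ lineForests (N + 1), firstStep E ∈ Finset.range (N + 2) := by
    intro E hE
    have hE := mem_lineForests.1 hE
    rw [Finset.mem_range]
    by_cases h0 : firstStep E = 0
    · omega
    · have := hE.le _ (firstStep_mem h0)
      simp only at this
      omega
  rw [← Finset.sum_fiberwise_of_maps_to hmaps, Finset.sum_range_succ', add_comm]
  congr 1
  · refine Finset.sum_bij' (fun E _ => unshiftEdges 1 E) (fun E _ => shiftEdges 1 E) ?_ ?_ ?_ ?_ ?_
    · intro E hE
      simp only [Finset.mem_filter, mem_lineForests] at hE ⊢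
      exact hE.1.unshift ((firstStep_eq_zero_iff hE.1.lt).1 hE.2)
    · intro E hE
      simp only [Finset.mem_filter, mem_lineForests] at hE ⊢
      have h1 := hE.shift 1
      refine ⟨h1, (firstStep_eq_zero_iff h1.lt).2 ?_⟩
      rintro ⟨a, b⟩ hp
      obtain ⟨c, d, hcd, rfl, rfl⟩ := mem_shiftEdges.1 hp
      simp
    · intro E hE
      simp only [Finset.mem_filter, mem_lineForests] at hE
      refine shiftEdges_unshiftEdges fun p hp => ?_
      have h1 := (firstStep_eq_zero_iff hE.1.lt).1 hE.2 p hp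
      have h2 := hE.1.lt p hp
      omega
    · intro E hE
      exact unshiftEdges_shiftEdges 1 E
    · intro E hE
      simp only [Finset.mem_filter, mem_lineForests] at hE
      rw [shiftEdges_unshiftEdges fun p hp => ?_]
      have h1 := (firstStep_eq_zero_iff hE.1.lt).1 hE.2 p hp
      have h2 := hE.1.lt p hp
      omega
  · refine Finset.sum_congr rfl fun s hs => ?_
    rw [Finset.mem_range] at hs
    rw [← Finset.sum_product']
    have hcut : ∀ E ∈ (lineForests (N + 1)).filter (fun E => firstStep E = s + 1),
        (E.filter fun p => p.2 ≤ s + 1) ∪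
          shiftEdges (s + 1) (unshiftEdges (s + 1) (E.filter fun p => s + 1 ≤ p.1)) = E := by
      intro E hE
      simp only [Finset.mem_filter, mem_lineForests] at hE
      rw [shiftEdges_unshiftEdges]
      · rw [← Finset.filter_or, Finset.filter_eq_self]
        intro p hp
        rw [← hE.2]
        exact hE.1.le_or_le_firstStep hp
      · intro p hp
        rw [Finset.mem_filter] at hp
        have := hE.1.lt p hp.1
        omega
    refine Finset.sum_bij' (fun E _ => (E.filter fun p => p.2 ≤ s + 1,
      unshiftEdges (s + 1) (E.filter fun p => s + 1 ≤ p.1)))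
      (fun E _ => E.1 ∪ shiftEdges (s + 1) E.2) ?_ ?_ ?_ ?_ ?_
    · intro E hE
      simp only [Finset.mem_filter, mem_lineForests] at hE
      rw [Finset.mem_product, mem_archedForests, mem_lineForests]
      refine ⟨⟨hE.1.subset (Finset.filter_subset _ _) (by simp), ?_⟩, ?_⟩
      · rw [Finset.mem_filter, ← hE.2]
        exact ⟨firstStep_mem (by omega), le_rfl⟩
      · refine IsLineForest.unshift (s := s + 1) ?_ (by simp)
        refine hE.1.subset (Finset.filter_subset _ _) fun p hp => ?_
        have := hE.1.le p (Finset.mem_filter.1 hp).1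
        omega
    · rintro ⟨E, E'⟩ hE
      rw [Finset.mem_product, mem_archedForests, mem_lineForests] at hE
      rw [Finset.mem_filter, mem_lineForests]
      have h1 := hE.2.shift (s + 1)
      rw [show N - s + (s + 1) = N + 1 by omega] at h1
      refine ⟨hE.1.1.union h1 ?_ (by omega), firstStep_union_shift hE.1.1 hE.1.2⟩
      rintro ⟨a, b⟩ hp
      obtain ⟨c, d, hcd, rfl, rfl⟩ := mem_shiftEdges.1 hp
      simp
    · exact hcut
    · rintro ⟨E, E'⟩ hE
      rw [Finset.mem_product, mem_archedForests, mem_lineForests] at hE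
      have hl : ∀ p ∈ E, p.2 ≤ s + 1 := hE.1.1.le
      have hl' : ∀ p ∈ E, p.1 < p.2 := hE.1.1.lt
      have hr : ∀ p ∈ shiftEdges (s + 1) E', s + 1 ≤ p.1 ∧ p.1 < p.2 := by
        rintro ⟨a, b⟩ hp
        obtain ⟨c, d, hcd, rfl, rfl⟩ := mem_shiftEdges.1 hp
        have := hE.2.lt _ hcd
        simp only at *
        omega
      refine Prod.ext ?_ ?_
      · simp only [Finset.filter_union]
        rw [Finset.filter_eq_self.2 hl, Finset.filter_eq_empty_iff.2, Finset.union_empty]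
        intro p hp
        have := hr p hp
        omega
      · simp only [Finset.filter_union]
        rw [Finset.filter_eq_self.2 fun p hp => (hr p hp).1, Finset.filter_eq_empty_iff.2,
          Finset.empty_union, unshiftEdges_shiftEdges]
        intro p hp
        have := hl p hp
        have := hl' p hp
        omega
    · intro E hE
      rw [hcut E hE]

theorem lineForests_zero : lineForests 0 = {∅} := by
  ext E
  rw [mem_lineForests, Finset.mem_singleton]
  constructor
  · intro h
    rw [Finset.eq_empty_iff_forall_notMem]
    intro p hp
    have := h.lt p hp
    have := h.le p hp
    omega
  · rintro rfl
    exact IsLineForest.empty 0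

/-- Every unit interval `[i, i + 1]` with `i < N` lies under an edge of `E`; for a line forest
this means that `0` and `N` are connected. -/
def FullyCovered (N : ℕ) (E : Finset (ℕ × ℕ)) : Prop := ∀ i < N, Covered E i

open Classical in
/-- Removing the edge `(0, N)` of an arched forest leaves a forest with an uncovered interval, and
conversely. -/
theorem sum_archedForests {M : Type*} [AddCommMonoid M] {N : ℕ} (hN : 0 < N)
    (f : Finset (ℕ × ℕ) → M) :
    ∑ E ∈ archedForests N, f E =
      ∑ E ∈ lineForests N with ¬ FullyCovered N E, f (insert (0, N) E) := by
  refine Finset.sum_bij' (fun E _ => E.erase (0, N)) (fun E _ => insert (0, N) E) ?_ ?_ ?_ ?_ ?_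
  · intro E hE
    rw [mem_archedForests] at hE
    rw [Finset.mem_filter, mem_lineForests]
    refine ⟨hE.1.subset (Finset.erase_subset _ _)
      fun p hp => hE.1.le p (Finset.mem_of_mem_erase hp), fun hc => ?_⟩
    obtain ⟨i, h1, h2, h3⟩ := hE.1.gap _ hE.2
    obtain ⟨⟨a, b⟩, hq, h4, h5⟩ := hc i h2
    rw [Finset.mem_erase] at hq
    have h6 := h3 _ hq.2 h4 h5
    have h7 := hE.1.le _ hq.2
    simp only at *
    exact hq.1 (Prod.ext (by omega) (by simp only; omega))
  · intro E hE
    rw [Finset.mem_filter, mem_lineForests] at hE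
    rw [mem_archedForests]
    refine ⟨⟨?_, ?_, ?_, ?_⟩, Finset.mem_insert_self _ _⟩
    · intro p hp
      rcases Finset.mem_insert.1 hp with rfl | hp
      exacts [hN, hE.1.lt p hp]
    · intro p hp
      rcases Finset.mem_insert.1 hp with rfl | hp
      exacts [le_rfl, hE.1.le p hp]
    · intro p hp q hq h1 h2
      rcases Finset.mem_insert.1 hp with rfl | hp <;> rcases Finset.mem_insert.1 hq with rfl | hq
      · exact le_rfl
      · exact hE.1.le q hq
      · simp at h1
      · exact hE.1.nc p hp q hq h1 h2
    · intro p hp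
      rcases Finset.mem_insert.1 hp with rfl | hp
      · have h1 := hE.2
        simp only [FullyCovered, not_forall, exists_prop] at h1
        obtain ⟨i, hi, h2⟩ := h1
        refine ⟨i, Nat.zero_le _, hi, fun q hq h3 h4 => ?_⟩
        rcases Finset.mem_insert.1 hq with rfl | hq
        · exact ⟨le_rfl, le_rfl⟩
        · exact absurd ⟨q, hq, h3, h4⟩ h2
      · obtain ⟨i, h1, h2, h3⟩ := hE.1.gap p hp
        refine ⟨i, h1, h2, fun q hq => ?_⟩
        rcases Finset.mem_insert.1 hq with rfl | hq
        · exact fun _ _ => ⟨Nat.zero_le _, hE.1.le p hp⟩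
        · exact h3 q hq
  · intro E hE
    rw [mem_archedForests] at hE
    exact Finset.insert_erase hE.2
  · intro E hE
    rw [Finset.mem_filter, mem_lineForests] at hE
    refine Finset.erase_insert fun h0 => hE.2 fun i hi => ⟨_, h0, Nat.zero_le _, hi⟩
  · intro E hE
    rw [mem_archedForests] at hE
    rw [Finset.insert_erase hE.2]

theorem disjoint_shiftEdges {s N : ℕ} {E E' : Finset (ℕ × ℕ)} (h : IsLineForest s E)
    (h' : IsLineForest N E') : Disjoint E (shiftEdges s E') := by
  rw [Finset.disjoint_left]
  rintro ⟨a, b⟩ hp hq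
  obtain ⟨c, d, hcd, rfl, rfl⟩ := mem_shiftEdges.1 hq
  have := h.le _ hp
  have := h'.lt _ hcd
  simp only at *
  omega

theorem not_covered_shiftEdges {s i : ℕ} {E : Finset (ℕ × ℕ)} (hi : i < s) :
    ¬ Covered (shiftEdges s E) i := by
  rintro ⟨⟨a, b⟩, hq, h1, h2⟩
  obtain ⟨c, d, hcd, rfl, rfl⟩ := mem_shiftEdges.1 hq
  simp only at *
  omega

theorem covered_shiftEdges {s i : ℕ} {E : Finset (ℕ × ℕ)} :
    Covered (shiftEdges s E) (i + s) ↔ Covered E i := by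
  constructor
  · rintro ⟨⟨a, b⟩, hq, h1, h2⟩
    obtain ⟨c, d, hcd, rfl, rfl⟩ := mem_shiftEdges.1 hq
    simp only at *
    exact ⟨_, hcd, by simp only; omega, by simp only; omega⟩
  · rintro ⟨⟨a, b⟩, hq, h1, h2⟩
    simp only at *
    exact ⟨_, add_mem_shiftEdges.2 hq, by simp only; omega, by simp only; omega⟩

theorem covered_union_shiftEdges_lt {s i : ℕ} {E E' : Finset (ℕ × ℕ)} (hs : (0, s) ∈ E)
    (hi : i < s) : Covered (E ∪ shiftEdges s E') i :=
  ⟨_, Finset.mem_union_left _ hs, Nat.zero_le _, hi⟩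

theorem covered_union_shiftEdges_add {s i : ℕ} {E E' : Finset (ℕ × ℕ)} (h : IsLineForest s E) :
    Covered (E ∪ shiftEdges s E') (i + s) ↔ Covered E' i := by
  rw [← covered_shiftEdges (s := s) (E := E')]
  constructor
  · rintro ⟨q, hq, h1, h2⟩
    rcases Finset.mem_union.1 hq with hq | hq
    · have := h.le q hq
      omega
    · exact ⟨q, hq, h1, h2⟩
  · rintro ⟨q, hq, h1, h2⟩
    exact ⟨q, Finset.mem_union_right _ hq, h1, h2⟩

theorem fullyCovered_shiftEdges {N : ℕ} {E : Finset (ℕ × ℕ)} :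
    ¬ FullyCovered (N + 1) (shiftEdges 1 E) :=
  fun h => not_covered_shiftEdges Nat.zero_lt_one (h 0 (Nat.succ_pos N))

theorem fullyCovered_union_shiftEdges {N s : ℕ} {E E' : Finset (ℕ × ℕ)} (h : IsLineForest s E)
    (hs : (0, s) ∈ E) : FullyCovered (N + s) (E ∪ shiftEdges s E') ↔ FullyCovered N E' := by
  constructor
  · intro hc i hi
    exact (covered_union_shiftEdges_add h).1 (hc (i + s) (by omega))
  · intro hc i hi
    by_cases his : i < s
    · exact covered_union_shiftEdges_lt hs his
    · obtain ⟨j, rfl⟩ := Nat.exists_eq_add_of_le' (not_lt.1 his)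
      exact (covered_union_shiftEdges_add h).2 (hc j (by omega))

open Classical in
/-- The number of initial stretches `[0, h]`, `0 ≤ h ≤ N`, all of whose unit intervals are
covered: one more than the number of consecutive covered intervals at the start. -/
noncomputable def coveredPrefixes (N : ℕ) (E : Finset (ℕ × ℕ)) : ℕ :=
  ((Finset.range (N + 1)).filter fun h => FullyCovered h E).card

theorem coveredPrefixes_zero (E : Finset (ℕ × ℕ)) : coveredPrefixes 0 E = 1 := by
  classical
  rw [coveredPrefixes, Finset.filter_eq_self.2]
  · simp
  · intro h hh i hi
    simp only [zero_add, Finset.range_one, Finset.mem_singleton] at hh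
    omega

theorem coveredPrefixes_shiftEdges {N : ℕ} {E : Finset (ℕ × ℕ)} :
    coveredPrefixes (N + 1) (shiftEdges 1 E) = 1 := by
  classical
  rw [coveredPrefixes, Finset.card_eq_one]
  refine ⟨0, ?_⟩
  ext h
  simp only [Finset.mem_filter, Finset.mem_range, Finset.mem_singleton]
  constructor
  · rintro ⟨-, h1⟩
    by_contra h0
    obtain ⟨j, rfl⟩ := Nat.exists_eq_succ_of_ne_zero h0
    exact fullyCovered_shiftEdges h1
  · rintro rfl
    exact ⟨by omega, fun i hi => absurd hi (Nat.not_lt_zero i)⟩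

theorem coveredPrefixes_union_shiftEdges {N s : ℕ} {E E' : Finset (ℕ × ℕ)} (h : IsLineForest s E)
    (hs : (0, s) ∈ E) :
    coveredPrefixes (N + s) (E ∪ shiftEdges s E') = s + coveredPrefixes N E' := by
  classical
  rw [coveredPrefixes, coveredPrefixes, show N + s + 1 = s + (N + 1) by omega,
    Finset.range_eq_Ico, ← Finset.Ico_union_Ico_eq_Ico (b := s) (Nat.zero_le _) (by omega),
    Finset.filter_union, Finset.card_union_of_disjoint]
  · congr 1
    · rw [Finset.filter_eq_self.2]
      · simp
      · intro j hj i hi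
        rw [Finset.mem_Ico] at hj
        exact covered_union_shiftEdges_lt hs (by omega)
    · symm
      refine Finset.card_bij (fun j _ => j + s) ?_ ?_ ?_
      · intro j hj
        simp only [Finset.mem_filter, Finset.mem_range, Finset.mem_Ico] at hj ⊢
        exact ⟨by omega, (fullyCovered_union_shiftEdges h hs).2 hj.2⟩
      · intro j _ j' _ hjj
        exact Nat.add_right_cancel hjj
      · intro j hj
        simp only [Finset.mem_filter, Finset.mem_Ico] at hj
        obtain ⟨j, rfl⟩ := Nat.exists_eq_add_of_le' hj.1.1
        refine ⟨j, ?_, rfl⟩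
        simp only [Finset.mem_filter, Finset.mem_range]
        exact ⟨by omega, (fullyCovered_union_shiftEdges h hs).1 hj.2⟩
  · exact Finset.disjoint_filter_filter (Finset.Ico_disjoint_Ico_consecutive 0 s _)

/-! ### Generating functions of line forests -/

open Polynomial in
/-- The number of line forests on `0, …, N`, refined by the number of edges. -/
noncomputable def forestPoly (N : ℕ) : ℤ[X] := ∑ E ∈ lineForests N, X ^ E.card

open Polynomial in
/-- The number of arched line forests on `0, …, N`, refined by the number of edges. -/
noncomputable def archedPoly (N : ℕ) : ℤ[X] := ∑ E ∈ archedForests N, X ^ E.card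

open Classical Polynomial in
/-- The number of line forests connecting `0` and `N`, refined by the number of edges. -/
noncomputable def coveredPoly (N : ℕ) : ℤ[X] :=
  ∑ E ∈ lineForests N with FullyCovered N E, X ^ E.card

open Polynomial in
/-- The number of line forests on `0, …, N`, weighted by `coveredPrefixes` and refined by the
number of edges. -/
noncomputable def prefixPoly (N : ℕ) : ℤ[X] :=
  ∑ E ∈ lineForests N, (coveredPrefixes N E : ℤ[X]) * X ^ E.card

theorem card_union_shiftEdges {s N : ℕ} {E E' : Finset (ℕ × ℕ)} (h : IsLineForest s E)
    (h' : IsLineForest N E') : (E ∪ shiftEdges s E').card = E.card + E'.card := by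
  rw [Finset.card_union_of_disjoint (disjoint_shiftEdges h h'), card_shiftEdges]

theorem forestPoly_zero : forestPoly 0 = 1 := by simp [forestPoly, lineForests_zero]

theorem coveredPoly_zero : coveredPoly 0 = 1 := by
  simp [coveredPoly, lineForests_zero, Finset.filter_singleton, FullyCovered]

theorem prefixPoly_zero : prefixPoly 0 = 1 := by
  simp [prefixPoly, lineForests_zero, coveredPrefixes_zero]

theorem archedPoly_zero : archedPoly 0 = 0 := by
  simp [archedPoly, archedForests, lineForests_zero, Finset.filter_singleton]

theorem forestPoly_succ (N : ℕ) : forestPoly (N + 1) = forestPoly N +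
    ∑ s ∈ Finset.range (N + 1), archedPoly (s + 1) * forestPoly (N - s) := by
  rw [forestPoly, sum_lineForests_succ]
  simp only [card_shiftEdges]
  congr 1
  refine Finset.sum_congr rfl fun s _ => ?_
  rw [archedPoly, forestPoly, Finset.sum_mul_sum]
  refine Finset.sum_congr rfl fun E hE => Finset.sum_congr rfl fun E' hE' => ?_
  rw [card_union_shiftEdges (mem_archedForests.1 hE).1 (mem_lineForests.1 hE'), pow_add]

theorem coveredPoly_succ (N : ℕ) : coveredPoly (N + 1) =
    ∑ s ∈ Finset.range (N + 1), archedPoly (s + 1) * coveredPoly (N - s) := by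
  classical
  rw [coveredPoly, Finset.sum_filter, sum_lineForests_succ]
  simp only [fullyCovered_shiftEdges, if_false, Finset.sum_const_zero, zero_add]
  refine Finset.sum_congr rfl fun s hs => ?_
  rw [archedPoly, coveredPoly, Finset.sum_filter, Finset.sum_mul_sum]
  refine Finset.sum_congr rfl fun E hE => Finset.sum_congr rfl fun E' hE' => ?_
  rw [Finset.mem_range] at hs
  rw [mem_archedForests] at hE
  rw [card_union_shiftEdges hE.1 (mem_lineForests.1 hE'), pow_add]
  have := fullyCovered_union_shiftEdges (N := N - s) (E' := E') hE.1 hE.2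
  rw [show N - s + (s + 1) = N + 1 by omega] at this
  rw [if_congr this rfl rfl, mul_ite, mul_zero]

theorem prefixPoly_succ (N : ℕ) : prefixPoly (N + 1) = forestPoly N +
    ∑ s ∈ Finset.range (N + 1), (archedPoly (s + 1) * prefixPoly (N - s) +
      ((s + 1 : ℕ) : Polynomial ℤ) * archedPoly (s + 1) * forestPoly (N - s)) := by
  rw [prefixPoly, sum_lineForests_succ]
  simp only [card_shiftEdges, coveredPrefixes_shiftEdges, Nat.cast_one, one_mul]
  congr 1
  refine Finset.sum_congr rfl fun s hs => ?_
  rw [archedPoly, prefixPoly, forestPoly, mul_assoc, Finset.sum_mul_sum, Finset.sum_mul_sum,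
    Finset.mul_sum, ← Finset.sum_add_distrib]
  refine Finset.sum_congr rfl fun E hE => ?_
  rw [Finset.mul_sum, ← Finset.sum_add_distrib]
  refine Finset.sum_congr rfl fun E' hE' => ?_
  rw [Finset.mem_range] at hs
  rw [mem_archedForests] at hE
  have := coveredPrefixes_union_shiftEdges (N := N - s) (E' := E') hE.1 hE.2
  rw [show N - s + (s + 1) = N + 1 by omega] at this
  rw [card_union_shiftEdges hE.1 (mem_lineForests.1 hE'), pow_add, this]
  push_cast
  ring

theorem archedPoly_eq (N : ℕ) :
    archedPoly N = Polynomial.X * (forestPoly N - coveredPoly N) := by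
  classical
  rcases Nat.eq_zero_or_pos N with rfl | hN
  · simp [archedPoly_zero, forestPoly_zero, coveredPoly_zero]
  have hsplit := Finset.sum_filter_add_sum_filter_not (lineForests N) (fun E => FullyCovered N E)
    (fun E => (Polynomial.X : Polynomial ℤ) ^ E.card)
  rw [archedPoly, sum_archedForests hN, forestPoly, coveredPoly, ← hsplit, add_sub_cancel_left,
    Finset.mul_sum]
  refine Finset.sum_congr rfl fun E hE => ?_
  rw [Finset.mem_filter] at hE
  rw [Finset.card_insert_of_notMem fun h0 => hE.2 fun i hi => ⟨_, h0, Nat.zero_le _, hi⟩,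
    pow_succ']

section PowerSeries

open PowerSeries

/-- Generating function of all line forests. -/
noncomputable def forestSeries : (Polynomial ℤ)⟦X⟧ := PowerSeries.mk forestPoly
/-- Generating function of the arched line forests. -/
noncomputable def archedSeries : (Polynomial ℤ)⟦X⟧ := PowerSeries.mk archedPoly
/-- Generating function of the line forests connecting the two ends. -/
noncomputable def coveredSeries : (Polynomial ℤ)⟦X⟧ := PowerSeries.mk coveredPoly
/-- Generating function of the line forests weighted by `coveredPrefixes`. -/
noncomputable def prefixSeries : (Polynomial ℤ)⟦X⟧ := PowerSeries.mk prefixPoly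

theorem coeff_succ_archedSeries_mul (F : (Polynomial ℤ)⟦X⟧) (N : ℕ) :
    coeff (N + 1) (archedSeries * F) =
      ∑ s ∈ Finset.range (N + 1), archedPoly (s + 1) * coeff (N - s) F := by
  rw [coeff_mul, Finset.Nat.sum_antidiagonal_eq_sum_range_succ_mk, Finset.sum_range_succ']
  simp [archedSeries, archedPoly_zero]

theorem coeff_zero_archedSeries_mul (F : (Polynomial ℤ)⟦X⟧) : coeff 0 (archedSeries * F) = 0 := by
  rw [coeff_mul]
  simp [archedSeries, archedPoly_zero]

theorem forestSeries_eq :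
    forestSeries = 1 + X * forestSeries + archedSeries * forestSeries := by
  ext1 N
  rcases N with _ | N
  · simp only [map_add, coeff_zero_archedSeries_mul, coeff_zero_X_mul]
    simp [forestSeries, forestPoly_zero]
  · simp only [map_add, coeff_succ_archedSeries_mul, coeff_succ_X_mul]
    simp [forestSeries, forestPoly_succ, coeff_one]

theorem coveredSeries_eq : coveredSeries = 1 + archedSeries * coveredSeries := by
  ext1 N
  rcases N with _ | N
  · simp only [map_add, coeff_zero_archedSeries_mul]
    simp [coveredSeries, coveredPoly_zero]
  · simp only [map_add, coeff_succ_archedSeries_mul]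
    simp [coveredSeries, coveredPoly_succ, coeff_one]

theorem coeff_X_mul_derivative {A : Type*} [CommRing A] (F : A⟦X⟧) (n : ℕ) :
    coeff n (X * derivative A F) = n * coeff n F := by
  rcases n with _ | n
  · simp
  · rw [coeff_succ_X_mul, coeff_derivative, mul_comm, Nat.cast_succ]

theorem derivative_sq {A : Type*} [CommRing A] (F : A⟦X⟧) :
    derivative A (F ^ 2) = 2 * F * derivative A F := by
  rw [Derivation.leibniz_pow]
  simp [mul_assoc]

/-- The first-step decomposition for the weighted forests: if the longest edge at `0` ends at `s`,
it contributes `s` covered prefixes in addition to those of the remaining forest, whence the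
derivative. -/
theorem prefixSeries_eq : prefixSeries = 1 + X * forestSeries + archedSeries * prefixSeries +
    X * derivative (Polynomial ℤ) archedSeries * forestSeries := by
  ext1 N
  rw [map_add, map_add, map_add, coeff_mul N (X * derivative (Polynomial ℤ) archedSeries),
    Finset.Nat.sum_antidiagonal_eq_sum_range_succ_mk]
  simp only [coeff_X_mul_derivative]
  rcases N with _ | N
  · rw [coeff_zero_archedSeries_mul, coeff_zero_X_mul]
    simp [prefixSeries, prefixPoly_zero]
  · rw [coeff_succ_archedSeries_mul, coeff_succ_X_mul, Finset.sum_range_succ' _ (N + 1)]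
    simp only [prefixSeries, forestSeries, coeff_mk, prefixPoly_succ, Finset.sum_add_distrib,
      coeff_one, archedSeries]
    simp [add_assoc]

theorem archedSeries_eq_sub :
    archedSeries = C (Polynomial.X : Polynomial ℤ) * (forestSeries - coveredSeries) := by
  ext1 N
  simp [archedSeries, forestSeries, coveredSeries, archedPoly_eq, coeff_C_mul]

theorem forestSeries_sub_coveredSeries :
    forestSeries - coveredSeries = X * forestSeries * coveredSeries := by
  linear_combination coveredSeries * forestSeries_eq - forestSeries * coveredSeries_eq

theorem archedSeries_eq :
    archedSeries = C (Polynomial.X : Polynomial ℤ) * (X * (forestSeries * coveredSeries)) := by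
  rw [archedSeries_eq_sub, forestSeries_sub_coveredSeries, mul_assoc X]

/-- The number of forests with `e` edges counted by the coefficient of `X ^ N` in
`forestSeries ^ p * coveredSeries ^ q`. -/
noncomputable def powerCoeff (p q N e : ℕ) : ℤ :=
  (coeff N (forestSeries ^ p * coveredSeries ^ q)).coeff e

theorem powerCoeff_succ_left (p q N e : ℕ) :
    powerCoeff (p + 1) q (N + 1) e = powerCoeff p (q + 1) (N + 1) e +
      powerCoeff (p + 1) (q + 1) N e := by
  have h : forestSeries ^ (p + 1) * coveredSeries ^ q = forestSeries ^ p * coveredSeries ^ (q + 1) +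
      X * (forestSeries ^ (p + 1) * coveredSeries ^ (q + 1)) := by
    linear_combination forestSeries ^ p * coveredSeries ^ q * forestSeries_sub_coveredSeries
  rw [powerCoeff, h, map_add, coeff_succ_X_mul, Polynomial.coeff_add]
  rfl

theorem pow_mul_coveredSeries_pow_succ (p q : ℕ) :
    forestSeries ^ p * coveredSeries ^ (q + 1) = forestSeries ^ p * coveredSeries ^ q +
      C (Polynomial.X : Polynomial ℤ) *
        (X * (forestSeries ^ (p + 1) * coveredSeries ^ (q + 2))) := by
  linear_combination forestSeries ^ p * coveredSeries ^ q * coveredSeries_eq +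
    forestSeries ^ p * coveredSeries ^ (q + 1) * archedSeries_eq

theorem powerCoeff_succ_right_zero (p q N : ℕ) :
    powerCoeff p (q + 1) N 0 = powerCoeff p q N 0 := by
  rw [powerCoeff, pow_mul_coveredSeries_pow_succ, map_add, coeff_C_mul, Polynomial.coeff_add,
    Polynomial.coeff_X_mul_zero, add_zero]
  rfl

theorem powerCoeff_succ_right (p q N e : ℕ) :
    powerCoeff p (q + 1) (N + 1) (e + 1) = powerCoeff p q (N + 1) (e + 1) +
      powerCoeff (p + 1) (q + 2) N e := by
  rw [powerCoeff, pow_mul_coveredSeries_pow_succ, map_add, coeff_C_mul, coeff_succ_X_mul,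
    Polynomial.coeff_add, Polynomial.coeff_X_mul]
  rfl

theorem powerCoeff_zero (p q e : ℕ) : powerCoeff p q 0 e = if e = 0 then 1 else 0 := by
  have h1 : constantCoeff forestSeries = 1 := by
    rw [← coeff_zero_eq_constantCoeff_apply]; simp [forestSeries, forestPoly_zero]
  have h2 : constantCoeff coveredSeries = 1 := by
    rw [← coeff_zero_eq_constantCoeff_apply]; simp [coveredSeries, coveredPoly_zero]
  rw [powerCoeff, coeff_zero_eq_constantCoeff_apply, map_mul, map_pow, map_pow, h1, h2]
  simp [Polynomial.coeff_one]

end PowerSeries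

/-- The binomial coefficient with an integer lower index, zero if that index is negative. -/
def intChoose (n : ℕ) (k : ℤ) : ℤ := if 0 ≤ k then (n.choose k.toNat : ℤ) else 0

theorem intChoose_natCast (n k : ℕ) : intChoose n (k : ℤ) = n.choose k := by
  simp [intChoose]

theorem intChoose_zero (n : ℕ) : intChoose n 0 = 1 := by simp [intChoose]

theorem intChoose_of_neg (n : ℕ) {k : ℤ} (hk : k < 0) : intChoose n k = 0 := by
  simp [intChoose, not_le.2 hk]

theorem intChoose_succ (n : ℕ) (k : ℤ) :
    intChoose (n + 1) k = intChoose n k + intChoose n (k - 1) := by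
  rcases lt_trichotomy k 0 with h | rfl | h
  · rw [intChoose_of_neg _ h, intChoose_of_neg _ h, intChoose_of_neg _ (by omega), add_zero]
  · rw [intChoose_zero, intChoose_zero, intChoose_of_neg _ (by omega), add_zero]
  · obtain ⟨j, rfl⟩ : ∃ j : ℕ, k = (j + 1 : ℕ) := ⟨(k - 1).toNat, by omega⟩
    rw [show ((j + 1 : ℕ) : ℤ) - 1 = (j : ℕ) by omega, intChoose_natCast, intChoose_natCast,
      intChoose_natCast, Nat.choose_succ_succ', Nat.cast_add, add_comm]

theorem intChoose_sub (n k : ℕ) : intChoose n ((n : ℤ) - k) = n.choose k := by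
  rcases le_or_gt k n with h | h
  · rw [← Nat.cast_sub h, intChoose_natCast, Nat.choose_symm h]
  · rw [intChoose_of_neg _ (by omega), Nat.choose_eq_zero_of_lt h, Nat.cast_zero]

theorem succ_mul_intChoose (n k : ℕ) :
    ((k : ℤ) + 1) * intChoose n ((k : ℤ) + 1) = ((n : ℤ) - k) * intChoose n k := by
  have h := Nat.choose_succ_right_eq n k
  rw [show ((k : ℤ) + 1) = ((k + 1 : ℕ) : ℤ) by push_cast; rfl, intChoose_natCast,
    intChoose_natCast]
  rcases le_or_gt k n with h1 | h1
  · rw [← Nat.cast_sub h1]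
    push_cast
    zify at h
    linear_combination h
  · rw [Nat.choose_eq_zero_of_lt h1, Nat.choose_eq_zero_of_lt (by omega)]
    simp

/-- The closed form of `powerCoeff`, with `P = p + N - 1` and `x = p + q + N + 2 * e - 1`. -/
def powerFormula (P N x e : ℕ) : ℤ :=
  intChoose P ((N : ℤ) - e) * (intChoose x e - 2 * intChoose x ((e : ℤ) - 1)) -
    intChoose P ((N : ℤ) - e - 1) * intChoose x ((e : ℤ) - 1)

theorem powerFormula_zero_right (P N x : ℕ) : powerFormula P N x 0 = P.choose N := by
  simp [powerFormula, intChoose_zero, intChoose_of_neg, intChoose_natCast]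

theorem powerFormula_succ_self (N e : ℕ) : powerFormula N (N + 1) (N + 2 * e) e = 0 := by
  rcases e with _ | e
  · simp [powerFormula_zero_right]
  · have h1 := succ_mul_intChoose (N + 2 * (e + 1)) e
    have h2 := succ_mul_intChoose N e
    rw [powerFormula]
    push_cast at *
    rw [show (N : ℤ) + 1 - (e + 1) = (N : ℤ) - e by ring, show (e : ℤ) + 1 - 1 = e by ring,
      show (N : ℤ) - e - 1 = (N : ℤ) - (e + 1 : ℕ) by push_cast; ring, intChoose_sub,
      intChoose_sub]
    rw [intChoose_natCast N e,
      show ((e : ℤ) + 1) = ((e + 1 : ℕ) : ℤ) by push_cast; rfl, intChoose_natCast] at h2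
    rw [← mul_right_inj' (show ((e : ℤ) + 1) ≠ 0 by positivity)]
    push_cast at *
    linear_combination (N.choose e : ℤ) * h1 - intChoose (N + 2 * (e + 1)) e * h2

/-- By induction on `N`, and for fixed `N` on `p` and then on `q`: raising `q` or `p` by one is a
relation between the coefficients at `N` and `N - 1`, which the closed form satisfies by the Pascal
recursion. -/
theorem powerCoeff_eq (p q N e : ℕ) (h : 1 ≤ p + N) :
    powerCoeff p q N e = powerFormula (p + N - 1) N (p + q + N + 2 * e - 1) e := by
  induction N generalizing p q e with
  | zero =>
    rw [powerCoeff_zero]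
    split_ifs with he
    · subst he
      simp [powerFormula_zero_right]
    · rw [powerFormula, intChoose_of_neg _ (k := ((0 : ℕ) : ℤ) - e) (by push_cast; omega),
        intChoose_of_neg _ (k := ((0 : ℕ) : ℤ) - e - 1) (by push_cast; omega)]
      simp
  | succ N ih =>
    have right : ∀ p q e, powerCoeff p q (N + 1) e =
          powerFormula (p + N) (N + 1) (p + q + N + 2 * e) e →
        powerCoeff p (q + 1) (N + 1) e =
          powerFormula (p + N) (N + 1) (p + (q + 1) + N + 2 * e) e := by
      intro p q e hq
      rcases e with _ | e
      · rw [powerCoeff_succ_right_zero, hq, powerFormula_zero_right, powerFormula_zero_right]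
      · rw [powerCoeff_succ_right, hq, ih _ _ _ (by omega)]
        simp only [powerFormula]
        rw [show p + 1 + N - 1 = p + N by omega,
          show p + 1 + (q + 2) + N + 2 * e - 1 = p + q + N + 2 * (e + 1) by omega,
          show p + (q + 1) + N + 2 * (e + 1) = p + q + N + 2 * (e + 1) + 1 by omega,
          intChoose_succ, intChoose_succ]
        push_cast
        rw [show (N : ℤ) + 1 - (e + 1) = N - e by ring, show (e : ℤ) + 1 - 1 = e by ring]
        ring
    have left : ∀ p q e, powerCoeff p q (N + 1) e =
          powerFormula (p + N) (N + 1) (p + q + N + 2 * e) e := by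
      intro p
      induction p with
      | zero =>
        intro q
        induction q with
        | zero =>
          intro e
          rw [show 0 + 0 + N + 2 * e = N + 2 * e by omega, Nat.zero_add, powerFormula_succ_self]
          simp [powerCoeff, PowerSeries.coeff_one]
        | succ q ihq => exact fun e => right 0 q e (ihq e)
      | succ p ihp =>
        intro q e
        rw [powerCoeff_succ_left, ihp, ih _ _ _ (by omega)]
        simp only [powerFormula]
        rw [show p + 1 + N - 1 = p + N by omega,
          show p + 1 + (q + 1) + N + 2 * e - 1 = p + (q + 1) + N + 2 * e by omega,
          show p + 1 + q + N + 2 * e = p + (q + 1) + N + 2 * e by omega,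
          show p + 1 + N = p + N + 1 by omega, intChoose_succ, intChoose_succ]
        push_cast
        rw [show (N : ℤ) + 1 - e - 1 = N - e by ring]
        ring
    rw [left p q e, show p + (N + 1) - 1 = p + N by omega,
      show p + q + (N + 1) + 2 * e - 1 = p + q + N + 2 * e by omega]

/-- The number of non-crossing forests with `e` edges on `N + 1` vertices. -/
theorem coeff_forestPoly (N e : ℕ) :
    (forestPoly N).coeff e = N.choose e * (intChoose (N + 2 * e) e -
      2 * intChoose (N + 2 * e) ((e : ℤ) - 1)) -
      N.choose (e + 1) * intChoose (N + 2 * e) ((e : ℤ) - 1) := by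
  have h := powerCoeff_eq 1 0 N e (by omega)
  rw [powerFormula, show 1 + N - 1 = N by omega, show 1 + 0 + N + 2 * e - 1 = N + 2 * e by omega,
    show (N : ℤ) - e - 1 = N - (e + 1 : ℕ) by push_cast; ring, intChoose_sub, intChoose_sub] at h
  rw [← h, powerCoeff, pow_one, pow_zero, mul_one, forestSeries, PowerSeries.coeff_mk]

theorem powerCoeff_one_one (N e : ℕ) :
    powerCoeff 1 1 N e = N.choose e * (intChoose (N + 1 + 2 * e) e -
      2 * intChoose (N + 1 + 2 * e) ((e : ℤ) - 1)) -
      N.choose (e + 1) * intChoose (N + 1 + 2 * e) ((e : ℤ) - 1) := by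
  rw [powerCoeff_eq 1 1 N e (by omega), powerFormula, show 1 + N - 1 = N by omega,
    show 1 + 1 + N + 2 * e - 1 = N + 1 + 2 * e by omega,
    show (N : ℤ) - e - 1 = N - (e + 1 : ℕ) by push_cast; ring, intChoose_sub, intChoose_sub]

theorem coeff_archedPoly (N e : ℕ) :
    (archedPoly (N + 1)).coeff (e + 1) = powerCoeff 1 1 N e := by
  have h := congrArg (PowerSeries.coeff (N + 1)) archedSeries_eq
  rw [PowerSeries.coeff_C_mul, PowerSeries.coeff_succ_X_mul, archedSeries,
    PowerSeries.coeff_mk] at h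
  rw [h, Polynomial.coeff_X_mul, powerCoeff, pow_one, pow_one]

/-- The number of pairs of an arched forest with `e + 1` edges and one of `N + 1` marks, which is
the number of forests on `2 (N + 1)` vertices on a circle invariant under a half turn and with an
edge through the centre. -/
theorem succ_mul_coeff_archedPoly (N e : ℕ) :
    ((N : ℤ) + 1) * (archedPoly (N + 1)).coeff (e + 1) =
      (N + 1).choose (e + 1) * (N + 1 + 2 * e).choose e := by
  rw [coeff_archedPoly, powerCoeff_one_one]
  have h3 := Nat.add_one_mul_choose_eq N e
  zify at h3
  rcases e with _ | e
  · have h2 := Nat.choose_succ_right_eq N 0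
    rw [intChoose_of_neg _ (k := ((0 : ℕ) : ℤ) - 1) (by simp)]
    simp [intChoose_zero]
  · have h1 := succ_mul_intChoose (N + 1 + 2 * (e + 1)) e
    have h2 := succ_mul_intChoose N (e + 1)
    rw [show (((e + 1 : ℕ) : ℤ) + 1) = ((e + 2 : ℕ) : ℤ) by push_cast; ring, intChoose_natCast,
      intChoose_natCast] at h2
    rw [← intChoose_natCast (N + 1 + 2 * (e + 1)) (e + 1)]
    push_cast at *
    rw [show (e : ℤ) + 1 - 1 = e by ring]
    rw [show e + 1 + 1 = e + 2 by ring] at *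
    rw [← mul_right_inj' (show ((e : ℤ) + 2) ≠ 0 by positivity)]
    set x := intChoose (N + 1 + 2 * (e + 1)) ((e : ℤ) + 1)
    set x1 := intChoose (N + 1 + 2 * (e + 1)) (e : ℤ)
    set α : ℤ := (N.choose (e + 1) : ℤ)
    set β : ℤ := (N.choose (e + 2) : ℤ)
    set γ : ℤ := ((N + 1).choose (e + 2) : ℤ)
    linear_combination -(N + 1 : ℤ) * x1 * h2 + x * h3 + (N + 1) * α * h1

/-- The functional equations make the prefix-weighted series differ from the series of all forests
by `½ (A²)′ / y`, where `A` is the series of arched forests and `y` marks the edges. -/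
theorem two_mul_prefixPoly (N : ℕ) : 2 * prefixPoly N = 2 * forestPoly N +
    (N + 1) * (PowerSeries.coeff N (forestSeries * coveredSeries) - forestPoly N) := by
  have h : PowerSeries.C (Polynomial.X : Polynomial ℤ) * (2 * (PowerSeries.X * prefixSeries)) =
      PowerSeries.C (Polynomial.X : Polynomial ℤ) * (2 * (PowerSeries.X * forestSeries)) +
      PowerSeries.X * PowerSeries.derivative (Polynomial ℤ) (archedSeries ^ 2) := by
    have hT : prefixSeries = forestSeries +
        PowerSeries.X * PowerSeries.derivative (Polynomial ℤ) archedSeries *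
          (forestSeries * coveredSeries) := by
      linear_combination coveredSeries * prefixSeries_eq - prefixSeries * coveredSeries_eq
        - coveredSeries * forestSeries_eq + forestSeries * coveredSeries_eq
    rw [derivative_sq, hT]
    linear_combination -2 * PowerSeries.X * PowerSeries.derivative (Polynomial ℤ) archedSeries *
      archedSeries_eq
  have hD : archedSeries ^ 2 = PowerSeries.C (Polynomial.X : Polynomial ℤ) *
      (PowerSeries.X * (forestSeries * coveredSeries - forestSeries)) := by
    linear_combination archedSeries * archedSeries_eq -
      PowerSeries.C (Polynomial.X : Polynomial ℤ) * PowerSeries.X * forestSeries * coveredSeries_eq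
  have h2 := congrArg (PowerSeries.coeff (N + 1)) h
  have two (F : PowerSeries (Polynomial ℤ)) (k : ℕ) :
      PowerSeries.coeff k (2 * F) = 2 * PowerSeries.coeff k F := by
    rw [two_mul, map_add, two_mul]
  rw [map_add, PowerSeries.coeff_C_mul, PowerSeries.coeff_C_mul, two, two,
    PowerSeries.coeff_succ_X_mul,
    PowerSeries.coeff_succ_X_mul, PowerSeries.coeff_succ_X_mul, PowerSeries.coeff_derivative, hD,
    PowerSeries.coeff_C_mul, PowerSeries.coeff_succ_X_mul, map_sub] at h2
  simp only [prefixSeries, PowerSeries.coeff_mk] at h2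
  have hX : (Polynomial.X : Polynomial ℤ) ≠ 0 := Polynomial.X_ne_zero
  apply mul_left_cancel₀ hX
  rw [h2]
  simp only [forestSeries, PowerSeries.coeff_mk]
  ring

/-- The number of pairs of a forest with `e` edges on `N + 1` vertices and a covered prefix of
it. -/
theorem coeff_prefixPoly (N e : ℕ) : (prefixPoly N).coeff e =
    N.choose e * ((N + 2 * e).choose e - intChoose (N + 2 * e) ((e : ℤ) - 1)) := by
  have h := congrArg (fun f => Polynomial.coeff f e) (two_mul_prefixPoly N)
  have h2 : (PowerSeries.coeff N (forestSeries * coveredSeries)).coeff e = powerCoeff 1 1 N e := by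
    rw [powerCoeff, pow_one, pow_one]
  have c1 (f : Polynomial ℤ) : (2 * f).coeff e = 2 * f.coeff e := by
    rw [two_mul, Polynomial.coeff_add, two_mul]
  have c2 (f : Polynomial ℤ) : (((N : Polynomial ℤ) + 1) * f).coeff e = (N + 1) * f.coeff e := by
    rw [← Nat.cast_succ, ← Polynomial.C_eq_natCast, Polynomial.coeff_C_mul, Nat.cast_succ]
  simp only [Polynomial.coeff_add, c1, c2, Polynomial.coeff_sub, h2] at h
  rw [powerCoeff_one_one, coeff_forestPoly, show N + 1 + 2 * e = N + 2 * e + 1 by ring,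
    intChoose_succ, intChoose_succ, ← intChoose_natCast (N + 2 * e) e] at *
  apply mul_left_cancel₀ (two_ne_zero (α := ℤ))
  rw [h]
  rcases e with _ | e
  · rw [intChoose_of_neg _ (k := ((0 : ℕ) : ℤ) - 1) (by simp),
      intChoose_of_neg _ (k := ((0 : ℕ) : ℤ) - 1 - 1) (by simp)]
    ring
  · have h5 := succ_mul_intChoose N (e + 1)
    rw [show (((e + 1 : ℕ) : ℤ) + 1) = ((e + 2 : ℕ) : ℤ) by push_cast; ring, intChoose_natCast,
      intChoose_natCast] at h5
    have h4 : (e : ℤ) * intChoose (N + 2 * (e + 1)) e =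
        (N + 2 * (e + 1) - e + 1) * intChoose (N + 2 * (e + 1)) ((e : ℤ) - 1) := by
      rcases e with _ | e
      · rw [intChoose_of_neg _ (k := ((0 : ℕ) : ℤ) - 1) (by simp)]
        simp
      · have h6 := succ_mul_intChoose (N + 2 * (e + 1 + 1)) e
        push_cast at *
        rw [show (e : ℤ) + 1 - 1 = e by ring]
        linear_combination h6
    push_cast at *
    rw [show (e : ℤ) + 1 - 1 = e by ring, show e + 1 + 1 = e + 2 by ring]
    set x := intChoose (N + 2 * (e + 1)) ((e : ℤ) + 1)
    set x1 := intChoose (N + 2 * (e + 1)) (e : ℤ)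
    set x2 := intChoose (N + 2 * (e + 1)) ((e : ℤ) - 1)
    set α : ℤ := (N.choose (e + 1) : ℤ)
    set β : ℤ := (N.choose (e + 2) : ℤ)
    rw [← mul_right_inj' (show ((e : ℤ) + 2) ≠ 0 by positivity)]
    linear_combination (-2 * x1 - (N + 1) * x2) * h5 + α * (N + 1) * h4

/-! ### Crossing chords of a circle -/

open Complex in
/-- The point of the unit circle at the angle `t`. -/
noncomputable def circlePoint (t : ℝ) : ℂ := Complex.exp (t * Complex.I)

theorem circlePoint_mul (s t : ℝ) : circlePoint s * circlePoint t = circlePoint (s + t) := by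
  rw [circlePoint, circlePoint, circlePoint, ← Complex.exp_add]
  push_cast
  ring_nf

theorem circlePoint_re (t : ℝ) : (circlePoint t).re = Real.cos t := Complex.exp_ofReal_mul_I_re t

theorem circlePoint_im (t : ℝ) : (circlePoint t).im = Real.sin t := Complex.exp_ofReal_mul_I_im t

theorem norm_circlePoint (t : ℝ) : ‖circlePoint t‖ = 1 := Complex.norm_exp_ofReal_mul_I t

/-- The coordinate in the direction of the angle `μ`, along which the chord between the angles
`μ - θ` and `μ + θ` is constant. -/
theorem re_circlePoint_mul (t μ : ℝ) :
    (circlePoint t * circlePoint (-μ)).re = Real.cos (t - μ) := by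
  rw [circlePoint_mul, circlePoint_re, sub_eq_add_neg]

theorem cos_lt_cos_of_outside {x θ : ℝ} (h0 : 0 ≤ θ) (h1 : θ < x) (h2 : x < 2 * Real.pi - θ) :
    Real.cos x < Real.cos θ := by
  rcases le_or_gt x Real.pi with h | h
  · exact Real.cos_lt_cos_of_nonneg_of_le_pi h0 h h1
  · rw [← Real.cos_two_pi_sub x]
    exact Real.cos_lt_cos_of_nonneg_of_le_pi h0 (by linarith) (by linarith)

theorem cos_lt_cos_of_inside {x θ : ℝ} (h0 : θ ≤ Real.pi) (h1 : |x| < θ) :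
    Real.cos θ < Real.cos x := by
  rw [← Real.cos_abs x]
  exact Real.cos_lt_cos_of_nonneg_of_le_pi (abs_nonneg x) h0 h1

/-- In the direction of the midpoint of the arc from `α` to `β`, the first chord is constant and
lies strictly above the second one. -/
theorem disjoint_segment_circlePoint {α β γ δ : ℝ} (h1 : α < β) (h2 : β < γ) (h3 : γ < δ)
    (h4 : δ < α + 2 * Real.pi) :
    Disjoint (segment ℝ (circlePoint α) (circlePoint β))
      (segment ℝ (circlePoint γ) (circlePoint δ)) := by
  rw [Set.disjoint_left]
  rintro z ⟨a, b, ha, hb, hab, rfl⟩ ⟨c, d, hc, hd, hcd, h⟩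
  have key := congrArg (fun w : ℂ => (w * circlePoint (-((α + β) / 2))).re) h
  simp only [add_mul, Complex.add_re, smul_mul_assoc, Complex.smul_re, re_circlePoint_mul,
    smul_eq_mul] at key
  have e1 : Real.cos (α - (α + β) / 2) = Real.cos ((β - α) / 2) := by
    rw [← Real.cos_neg]; congr 1; ring
  have e2 : Real.cos (β - (α + β) / 2) = Real.cos ((β - α) / 2) := by
    congr 1; ring
  have e3 : Real.cos (γ - (α + β) / 2) < Real.cos ((β - α) / 2) :=
    cos_lt_cos_of_outside (by linarith) (by linarith) (by linarith)
  have e4 : Real.cos (δ - (α + β) / 2) < Real.cos ((β - α) / 2) :=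
    cos_lt_cos_of_outside (by linarith) (by linarith) (by linarith)
  rw [e1, e2, ← add_mul, hab, one_mul] at key
  rcases hc.eq_or_lt with rfl | hc
  · have : d = 1 := by linarith
    subst this
    linarith
  · have := mul_lt_mul_of_pos_left e3 hc
    have := mul_le_mul_of_nonneg_left e4.le hd
    have : c * Real.cos ((β - α) / 2) + d * Real.cos ((β - α) / 2) = Real.cos ((β - α) / 2) := by
      rw [← add_mul, hcd, one_mul]
    linarith

/-- The endpoints of the second chord lie strictly on different sides of the line through the first
one, so the second chord meets this line. The common point lies in the closed disc, hence on the
first chord. -/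
theorem not_disjoint_segment_circlePoint {α β γ δ : ℝ} (h1 : α < γ) (h2 : γ < β) (h3 : β < δ)
    (h4 : δ < α + 2 * Real.pi) :
    ¬ Disjoint (segment ℝ (circlePoint α) (circlePoint β))
      (segment ℝ (circlePoint γ) (circlePoint δ)) := by
  set μ := (α + β) / 2 with hμ
  set θ := (β - α) / 2 with hθ
  have hθ0 : 0 < θ := by rw [hθ]; linarith
  have hθπ : θ < Real.pi := by rw [hθ]; linarith
  have e3 : Real.cos θ < Real.cos (γ - μ) :=
    cos_lt_cos_of_inside hθπ.le (abs_lt.2 ⟨by rw [hμ, hθ]; linarith, by rw [hμ, hθ]; linarith⟩)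
  have e4 : Real.cos (δ - μ) < Real.cos θ :=
    cos_lt_cos_of_outside hθ0.le (by rw [hμ, hθ]; linarith) (by rw [hμ, hθ]; linarith)
  have hsin : 0 < Real.sin θ := Real.sin_pos_of_pos_of_lt_pi hθ0 hθπ
  have hden : 0 < Real.cos (γ - μ) - Real.cos (δ - μ) := by linarith
  set s := (Real.cos (γ - μ) - Real.cos θ) / (Real.cos (γ - μ) - Real.cos (δ - μ)) with hs
  have hs0 : 0 ≤ s := div_nonneg (by linarith) hden.le
  have hs1 : s ≤ 1 := by rw [hs, div_le_one hden]; linarith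
  set p : ℂ := (1 - s) • circlePoint γ + s • circlePoint δ with hp
  have hpseg : p ∈ segment ℝ (circlePoint γ) (circlePoint δ) :=
    ⟨1 - s, s, by linarith, hs0, by ring, rfl⟩
  have hpnorm : ‖p‖ ≤ 1 := by
    refine (norm_add_le _ _).trans ?_
    rw [norm_smul, norm_smul, norm_circlePoint, norm_circlePoint, Real.norm_of_nonneg hs0,
      Real.norm_of_nonneg (by linarith)]
    linarith
  set w := p * circlePoint (-μ) with hw
  have hwre : w.re = Real.cos θ := by
    rw [hw, hp, add_mul, Complex.add_re, smul_mul_assoc, smul_mul_assoc, Complex.smul_re,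
      Complex.smul_re, re_circlePoint_mul, re_circlePoint_mul, smul_eq_mul, smul_eq_mul, hs]
    field_simp
    ring
  have hwim : w.im ^ 2 ≤ Real.sin θ ^ 2 := by
    have h5 : ‖w‖ ≤ 1 := by rw [hw, norm_mul, norm_circlePoint, mul_one]; exact hpnorm
    have h6 : w.re * w.re + w.im * w.im ≤ 1 := by
      rw [← Complex.normSq_apply, Complex.normSq_eq_norm_sq]
      nlinarith [norm_nonneg w]
    rw [hwre] at h6
    nlinarith [Real.sin_sq_add_cos_sq θ]
  obtain ⟨him1, him2⟩ := abs_le.1 (abs_le_of_sq_le_sq hwim hsin.le)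
  rw [Set.not_disjoint_iff]
  refine ⟨p, ⟨(Real.sin θ - w.im) / (2 * Real.sin θ), (Real.sin θ + w.im) / (2 * Real.sin θ),
    div_nonneg (by linarith) (by linarith), div_nonneg (by linarith) (by linarith), ?_, ?_⟩, hpseg⟩
  · field_simp
    ring
  · have hpw : p = w * circlePoint μ := by
      rw [hw, mul_assoc, circlePoint_mul]
      simp [circlePoint]
    have hα : circlePoint α = circlePoint (-θ) * circlePoint μ := by
      rw [circlePoint_mul]; congr 1; rw [hμ, hθ]; ring
    have hβ : circlePoint β = circlePoint θ * circlePoint μ := by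
      rw [circlePoint_mul]; congr 1; rw [hμ, hθ]; ring
    rw [hpw, hα, hβ, ← smul_mul_assoc, ← smul_mul_assoc, ← add_mul]
    congr 1
    apply Complex.ext
    · rw [Complex.add_re, Complex.smul_re, Complex.smul_re, circlePoint_re, circlePoint_re,
        Real.cos_neg, hwre, smul_eq_mul, smul_eq_mul]
      field_simp
      ring
    · rw [Complex.add_im, Complex.smul_im, Complex.smul_im, circlePoint_im, circlePoint_im,
        Real.sin_neg, smul_eq_mul, smul_eq_mul]
      field_simp
      ring

section Vertices

variable {n : ℕ} [NeZero n]

theorem vertexPos_intCast (j : ℤ) :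
    vertexPos (j : ZMod n) = circlePoint (2 * Real.pi * j / n) := by
  rw [vertexPos, ZMod.stdAddChar_coe, circlePoint]
  congr 1
  push_cast
  ring

theorem angle_lt_angle {i j : ℤ} (h : i < j) :
    2 * Real.pi * (i : ℝ) / n < 2 * Real.pi * (j : ℝ) / n := by
  have hn : (0 : ℝ) < n := Nat.cast_pos.2 (NeZero.pos n)
  have : (i : ℝ) < j := Int.cast_lt.2 h
  have := Real.pi_pos
  gcongr

theorem angle_lt_angle_add {i j : ℤ} (h : j < i + n) :
    2 * Real.pi * (j : ℝ) / n < 2 * Real.pi * (i : ℝ) / n + 2 * Real.pi := by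
  have hn : (0 : ℝ) < n := Nat.cast_pos.2 (NeZero.pos n)
  have := angle_lt_angle (n := n) h
  push_cast at this
  rw [mul_add, add_div, mul_div_assoc (2 * Real.pi) (n : ℝ), div_self hn.ne', mul_one] at this
  exact this

/-- Two chords whose endpoints do not interleave are disjoint. -/
theorem disjoint_chord {i j k l : ℤ} (h1 : i < j) (h2 : j < k) (h3 : k < l) (h4 : l < i + n) :
    Disjoint (chord (i : ZMod n) j) (chord (k : ZMod n) l) := by
  simp only [chord, vertexPos_intCast]
  exact disjoint_segment_circlePoint (angle_lt_angle h1) (angle_lt_angle h2) (angle_lt_angle h3)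
    (angle_lt_angle_add h4)

/-- Two chords whose endpoints interleave meet. -/
theorem not_disjoint_chord {i j k l : ℤ} (h1 : i < k) (h2 : k < j) (h3 : j < l)
    (h4 : l < i + n) : ¬ Disjoint (chord (i : ZMod n) j) (chord (k : ZMod n) l) := by
  simp only [chord, vertexPos_intCast]
  exact not_disjoint_segment_circlePoint (angle_lt_angle h1) (angle_lt_angle h2)
    (angle_lt_angle h3) (angle_lt_angle_add h4)

end Vertices

/-! ### Reachability and components after deleting an edge -/

theorem SimpleGraph.Reachable.apply_eq {V β : Type*} {G : SimpleGraph V} {f : V → β} {u v : V}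
    (h : G.Reachable u v) (hf : ∀ x y, G.Adj x y → f x = f y) : f u = f v := by
  obtain ⟨p⟩ := h
  induction p with
  | nil => rfl
  | cons h _ ih => exact (hf _ _ h).trans ih

/-- Deleting a bridge increases the number of connected components by one. -/
theorem SimpleGraph.card_connectedComponent_deleteEdges {V : Type*} [Finite V]
    {G : SimpleGraph V} {u v : V} (hadj : G.Adj u v)
    (h : ¬ (G.deleteEdges {s(u, v)}).Reachable u v) :
    Nat.card (G.deleteEdges {s(u, v)}).ConnectedComponent =
      Nat.card G.ConnectedComponent + 1 := by
  classical
  set G' := G.deleteEdges {s(u, v)} with hG'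
  have hle : G' ≤ G := SimpleGraph.deleteEdges_le _
  have huv : G'.connectedComponentMk u ≠ G'.connectedComponentMk v :=
    fun h' => h (SimpleGraph.ConnectedComponent.exact h')
  -- Every component of `G` contains a unique component of `G'` other than that of `v`.
  let f : V → {c : G'.ConnectedComponent // c ≠ G'.connectedComponentMk v} := fun x =>
    if hx : G'.connectedComponentMk x = G'.connectedComponentMk v then
      ⟨G'.connectedComponentMk u, huv⟩ else ⟨G'.connectedComponentMk x, hx⟩
  have hf : ∀ x y, G.Adj x y → f x = f y := by
    intro x y hxy
    by_cases he : s(x, y) = s(u, v)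
    · rcases Sym2.eq_iff.1 he with ⟨rfl, rfl⟩ | ⟨rfl, rfl⟩
      · simp [f]
      · simp [f]
    · have : G'.Adj x y := by
        rw [hG', SimpleGraph.deleteEdges_adj]
        exact ⟨hxy, by simpa using he⟩
      have := SimpleGraph.ConnectedComponent.connectedComponentMk_eq_of_adj this
      simp only [f, this]
  let e : G.ConnectedComponent ≃ {c : G'.ConnectedComponent // c ≠ G'.connectedComponentMk v} :=
    { toFun := SimpleGraph.ConnectedComponent.lift f fun x y p _ => p.reachable.apply_eq hf
      invFun := fun c => c.1.map (SimpleGraph.Hom.ofLE hle)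
      left_inv := by
        intro c
        induction c using SimpleGraph.ConnectedComponent.ind with | _ x =>
        rw [SimpleGraph.ConnectedComponent.lift_mk]
        by_cases hx : G'.connectedComponentMk x = G'.connectedComponentMk v
        · simp only [f, hx, dif_pos]
          rw [SimpleGraph.ConnectedComponent.map_mk]
          apply SimpleGraph.ConnectedComponent.sound
          exact hadj.reachable.trans
            ((SimpleGraph.ConnectedComponent.exact hx).mono hle).symm
        · simp only [f, hx, dif_neg, not_false_iff]
          rfl
      right_inv := by
        rintro ⟨c, hc⟩
        induction c using SimpleGraph.ConnectedComponent.ind with | _ x =>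
        change f x = _
        simp only [f, hc, dif_neg, not_false_iff] }
  rw [Nat.card_congr e, ← Finite.card_option,
    Nat.card_congr (Equiv.optionSubtypeNe (G'.connectedComponentMk v))]

/-! ### Cutting the circle open -/

section Cut

variable {n : ℕ}

open Classical in
/-- The edges of a graph on the vertices of the `n`-gon, read off on the line
`b, b + 1, …, b + n - 1`. -/
noncomputable def lineEdges (G : SimpleGraph (ZMod n)) (b : ZMod n) : Finset (ℕ × ℕ) :=
  {p ∈ Finset.range n ×ˢ Finset.range n | p.1 < p.2 ∧ G.Adj (b + p.1) (b + p.2)}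

theorem mem_lineEdges {G : SimpleGraph (ZMod n)} {b : ZMod n} {i j : ℕ} :
    (i, j) ∈ lineEdges G b ↔ i < j ∧ j < n ∧ G.Adj (b + i) (b + j) := by
  simp only [lineEdges, Finset.mem_filter, Finset.mem_product, Finset.mem_range]
  constructor
  · rintro ⟨⟨-, h⟩, h', h''⟩
    exact ⟨h', h, h''⟩
  · rintro ⟨h', h, h''⟩
    exact ⟨⟨h'.trans h, h⟩, h', h''⟩

theorem offset_injective {b : ZMod n} {i j : ℕ} (hi : i < n) (hj : j < n)
    (h : b + (i : ZMod n) = b + j) : i = j := by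
  have := congrArg ZMod.val (add_left_cancel h)
  rwa [ZMod.val_natCast_of_lt hi, ZMod.val_natCast_of_lt hj] at this

theorem adj_offset_iff {G : SimpleGraph (ZMod n)} {b : ZMod n} {i j : ℕ} (hi : i < n)
    (hj : j < n) : G.Adj (b + i) (b + j) ↔ (i, j) ∈ lineEdges G b ∨ (j, i) ∈ lineEdges G b := by
  rw [mem_lineEdges, mem_lineEdges]
  constructor
  · intro h
    rcases lt_trichotomy i j with hij | rfl | hij
    · exact Or.inl ⟨hij, hj, h⟩
    · exact absurd h (G.irrefl)
    · exact Or.inr ⟨hij, hi, h.symm⟩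
  · rintro (h | h)
    exacts [h.2.2, h.2.2.symm]

theorem lineEdges_deleteEdges {G : SimpleGraph (ZMod n)} {b : ZMod n} {i j : ℕ} (hij : i < j)
    (hj : j < n) :
    lineEdges (G.deleteEdges {s(b + (i : ZMod n), b + (j : ZMod n))}) b =
      (lineEdges G b).erase (i, j) := by
  ext ⟨k, l⟩
  rw [Finset.mem_erase, mem_lineEdges, mem_lineEdges, SimpleGraph.deleteEdges_adj,
    Set.mem_singleton_iff, Sym2.eq_iff, Ne, Prod.mk.injEq]
  constructor
  · rintro ⟨h1, h2, h3, h4⟩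
    refine ⟨?_, h1, h2, h3⟩
    rintro ⟨rfl, rfl⟩
    exact h4 (Or.inl ⟨rfl, rfl⟩)
  · rintro ⟨h1, h2, h3, h4⟩
    refine ⟨h2, h3, h4, ?_⟩
    rintro (⟨h5, h6⟩ | ⟨h5, h6⟩)
    · exact h1 ⟨offset_injective (by omega) (by omega) h5, offset_injective (by omega) hj h6⟩
    · have := offset_injective (by omega) hj h5
      have := offset_injective (by omega) (by omega) h6
      omega

/-- The graph on the vertices of the `n`-gon whose edges, read off from the vertex `b` on, are
given by `E`. -/
def circleGraph (b : ZMod n) (E : Finset (ℕ × ℕ)) : SimpleGraph (ZMod n) where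
  Adj x y := ((x - b).val, (y - b).val) ∈ E ∧ (x - b).val < (y - b).val ∨
    ((y - b).val, (x - b).val) ∈ E ∧ (y - b).val < (x - b).val
  symm := ⟨fun _ _ h => h.symm⟩
  loopless := ⟨fun _ h => by simp at h⟩

theorem lineEdges_circleGraph (b : ZMod n) {E : Finset (ℕ × ℕ)} (h : ∀ p ∈ E, p.1 < p.2)
    (h' : ∀ p ∈ E, p.2 < n) : lineEdges (circleGraph b E) b = E := by
  ext ⟨i, j⟩
  rw [mem_lineEdges]
  constructor
  · rintro ⟨h1, h2, h3⟩
    simp only [circleGraph, add_sub_cancel_left] at h3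
    rw [ZMod.val_natCast_of_lt h2, ZMod.val_natCast_of_lt (h1.trans h2)] at h3
    rcases h3 with h3 | h3
    · exact h3.1
    · omega
  · intro hp
    have h1 := h _ hp
    have h2 := h' _ hp
    simp only at h1 h2
    refine ⟨h1, h2, ?_⟩
    simp only [circleGraph, add_sub_cancel_left]
    rw [ZMod.val_natCast_of_lt h2, ZMod.val_natCast_of_lt (h1.trans h2)]
    exact Or.inl ⟨hp, h1⟩

variable [NeZero n]

theorem exists_offset (b x : ZMod n) : ∃ i : ℕ, i < n ∧ b + i = x :=
  ⟨(x - b).val, ZMod.val_lt _, by rw [ZMod.natCast_zmod_val]; ring⟩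

/-- A graph is determined by its edges on the line. -/
theorem lineEdges_injective (b : ZMod n) :
    Function.Injective fun G : SimpleGraph (ZMod n) => lineEdges G b := by
  intro G G' h
  ext x y
  obtain ⟨i, hi, rfl⟩ := exists_offset b x
  obtain ⟨j, hj, rfl⟩ := exists_offset b y
  simp only at h
  rw [adj_offset_iff hi hj, adj_offset_iff hi hj, h]

theorem offset_eq_intCast (b : ZMod n) (i : ℕ) : b + (i : ZMod n) = ((b.val + i : ℤ) : ZMod n) := by
  push_cast
  rw [ZMod.natCast_zmod_val]

theorem chord_symm (a b : ZMod n) : chord a b = chord b a := segment_symm _ _ _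

theorem IsNoncrossing.lineEdges_nc {G : SimpleGraph (ZMod n)} (hG : IsNoncrossing G) (b : ZMod n) :
    ∀ p ∈ lineEdges G b, ∀ q ∈ lineEdges G b, p.1 < q.1 → q.1 < p.2 → q.2 ≤ p.2 := by
  rintro ⟨i, j⟩ hp ⟨k, l⟩ hq h1 h2
  rw [mem_lineEdges] at hp hq
  simp only at *
  by_contra h3
  have ne {x y : ℕ} (hx : x < n) (hy : y < n) (hxy : x ≠ y) : b + (x : ZMod n) ≠ b + y :=
    fun h => hxy (offset_injective hx hy h)
  have h := hG _ _ _ _ hp.2.2 hq.2.2 (ne (by omega) (by omega) (by omega))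
    (ne (by omega) (by omega) (by omega)) (ne (by omega) (by omega) (by omega))
    (ne (by omega) (by omega) (by omega))
  simp only [offset_eq_intCast] at h
  exact not_disjoint_chord (by omega) (by omega) (by omega) (by omega) h

theorem isNoncrossing_of_lineEdges_nc {G : SimpleGraph (ZMod n)} {b : ZMod n}
    (h : ∀ p ∈ lineEdges G b, ∀ q ∈ lineEdges G b, p.1 < q.1 → q.1 < p.2 → q.2 ≤ p.2) :
    IsNoncrossing G := by
  have key : ∀ i j k l : ℕ, (i, j) ∈ lineEdges G b → (k, l) ∈ lineEdges G b → i ≠ k → i ≠ l →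
      j ≠ k → j ≠ l → Disjoint (chord (b + (i : ZMod n)) (b + (j : ZMod n)))
        (chord (b + (k : ZMod n)) (b + (l : ZMod n))) := by
    intro i j k l hp hq h1 h2 h3 h4
    have e1 := h _ hp _ hq
    have e2 := h _ hq _ hp
    rw [mem_lineEdges] at hp hq
    simp only at e1 e2
    have wrap (x : ℕ) : b + (x : ZMod n) = ((b.val + x + n : ℤ) : ZMod n) := by
      rw [offset_eq_intCast]
      push_cast
      simp
    rcases lt_or_gt_of_ne h1 with hik | hik
    · rcases lt_or_gt_of_ne h3 with hjk | hjk
      · simp only [offset_eq_intCast]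
        exact disjoint_chord (by omega) (by omega) (by omega) (by omega)
      · rw [chord_symm (b + (i : ZMod n)), wrap i]
        simp only [offset_eq_intCast]
        exact (disjoint_chord (by omega) (by omega) (by omega) (by omega)).symm
    · rcases lt_or_gt_of_ne h2 with hil | hil
      · rw [chord_symm (b + (k : ZMod n)), wrap k]
        simp only [offset_eq_intCast]
        exact disjoint_chord (by omega) (by omega) (by omega) (by omega)
      · simp only [offset_eq_intCast]
        exact (disjoint_chord (by omega) (by omega) (by omega) (by omega)).symm
  intro x y z w hxy hzw h1 h2 h3 h4
  obtain ⟨i, hi, rfl⟩ := exists_offset b x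
  obtain ⟨j, hj, rfl⟩ := exists_offset b y
  obtain ⟨k, hk, rfl⟩ := exists_offset b z
  obtain ⟨l, hl, rfl⟩ := exists_offset b w
  have i1 : i ≠ k := by rintro rfl; exact h1 rfl
  have i2 : i ≠ l := by rintro rfl; exact h2 rfl
  have i3 : j ≠ k := by rintro rfl; exact h3 rfl
  have i4 : j ≠ l := by rintro rfl; exact h4 rfl
  rw [adj_offset_iff hi hj] at hxy
  rw [adj_offset_iff hk hl] at hzw
  rcases hxy with hxy | hxy <;> rcases hzw with hzw | hzw
  · exact key _ _ _ _ hxy hzw i1 i2 i3 i4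
  · rw [chord_symm (b + (k : ZMod n))]
    exact key _ _ _ _ hxy hzw i2 i1 i4 i3
  · rw [chord_symm (b + (i : ZMod n))]
    exact key _ _ _ _ hxy hzw i3 i4 i1 i2
  · rw [chord_symm (b + (i : ZMod n)), chord_symm (b + (k : ZMod n))]
    exact key _ _ _ _ hxy hzw i4 i3 i2 i1

/-- In an acyclic non-crossing graph, every edge `(i, j)` is the smallest edge over some unit
interval: otherwise the largest edges strictly below `(i, j)` form a second path from `i` to `j`. -/
theorem lineEdges_gap {G : SimpleGraph (ZMod n)} (hG : IsNoncrossing G) (hA : G.IsAcyclic)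
    (b : ZMod n) : ∀ p ∈ lineEdges G b, ∃ g, p.1 ≤ g ∧ g < p.2 ∧
      ∀ q ∈ lineEdges G b, q.1 ≤ g → g < q.2 → q.1 ≤ p.1 ∧ p.2 ≤ q.2 := by
  classical
  have hnc := hG.lineEdges_nc b
  rintro ⟨i, j⟩ hp
  by_contra hcon
  push Not at hcon
  simp only at hcon
  have hp' := mem_lineEdges.1 hp
  have hbr := SimpleGraph.isAcyclic_iff_forall_adj_isBridge.1 hA hp'.2.2
  rw [SimpleGraph.isBridge_iff] at hbr
  set G' := G.deleteEdges {s(b + (i : ZMod n), b + (j : ZMod n))} with hG'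
  have hE' : lineEdges G' b = (lineEdges G b).erase (i, j) :=
    lineEdges_deleteEdges hp'.1 hp'.2.1
  -- Vertices reached from `i` that lie under no smaller edge.
  let S : Finset ℕ := (Finset.Icc i j).filter fun v =>
    G'.Reachable (b + i) (b + v) ∧ ∀ q ∈ lineEdges G' b, i ≤ q.1 → q.2 ≤ j → ¬ (q.1 < v ∧ v < q.2)
  have hS : S.Nonempty := by
    refine ⟨i, ?_⟩
    simp only [S, Finset.mem_filter, Finset.mem_Icc]
    exact ⟨⟨le_rfl, hp'.1.le⟩, .rfl, fun q _ h1 _ h2 => by omega⟩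
  obtain ⟨w, hwS, hwmax⟩ := S.exists_max_image id hS
  simp only [S, Finset.mem_filter, Finset.mem_Icc, id] at hwS hwmax
  obtain ⟨⟨hw1, hw2⟩, hwr, hwv⟩ := hwS
  rcases hw2.eq_or_lt with rfl | hwj
  · exact hbr hwr
  -- the longest edge starting at `w` below `(i, j)`
  let T : Finset ℕ := (Finset.range (j + 1)).filter fun d => (w, d) ∈ lineEdges G' b
  have hT : T.Nonempty := by
    obtain ⟨⟨c, d⟩, hq, h1, h2, h3⟩ := hcon w hw1 hwj
    simp only at h1 h2 h3
    have hne : (c, d) ≠ (i, j) := by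
      intro h
      simp only [Prod.mk.injEq] at h
      omega
    have hq' : (c, d) ∈ lineEdges G' b := by
      rw [hE', Finset.mem_erase]
      exact ⟨hne, hq⟩
    have e1 := hnc _ hp _ hq
    have e2 := hnc _ hq _ hp
    simp only at e1 e2
    have hci : i ≤ c := by omega
    have hdj : d ≤ j := by omega
    have hcw : c = w := by
      by_contra hcw
      exact hwv _ hq' hci hdj ⟨by simp only; omega, h2⟩
    subst hcw
    exact ⟨d, by simp only [T, Finset.mem_filter, Finset.mem_range]; exact ⟨by omega, hq'⟩⟩
  obtain ⟨d, hdT, hdmax⟩ := T.exists_max_image id hT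
  simp only [T, Finset.mem_filter, Finset.mem_range, id] at hdT hdmax
  obtain ⟨hdj, hd⟩ := hdT
  have hd' := mem_lineEdges.1 hd
  have hdG : (w, d) ∈ lineEdges G b := by
    rw [hE'] at hd
    exact Finset.mem_of_mem_erase hd
  have := hwmax d ⟨⟨by omega, by omega⟩, hwr.trans hd'.2.2.reachable, ?_⟩
  · omega
  · rintro ⟨x, y⟩ hq h1 h2 ⟨h3, h4⟩
    simp only at h1 h2 h3 h4
    have hqG : (x, y) ∈ lineEdges G b := by
      rw [hE'] at hq
      exact Finset.mem_of_mem_erase hq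
    have e1 := hnc _ hdG _ hqG
    simp only at e1
    rcases lt_trichotomy x w with hxw | rfl | hxw
    · exact hwv _ hq h1 h2 ⟨hxw, by simp only; omega⟩
    · have := hdmax y ⟨by omega, hq⟩
      omega
    · omega

/-- Cutting the circle at `b` turns a non-crossing forest into a line forest. -/
theorem isLineForest_lineEdges {G : SimpleGraph (ZMod n)} (hG : IsNoncrossing G)
    (hA : G.IsAcyclic) (b : ZMod n) : IsLineForest (n - 1) (lineEdges G b) where
  lt := by
    rintro ⟨i, j⟩ hp
    exact (mem_lineEdges.1 hp).1
  le := by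
    rintro ⟨i, j⟩ hp
    have := (mem_lineEdges.1 hp).2.1
    simp only
    omega
  nc := hG.lineEdges_nc b
  gap := lineEdges_gap hG hA b

/-- A graph whose edges form a line forest is acyclic: the longest edge is a bridge, because no
other edge lies over the unit interval that it is the smallest edge over. -/
theorem acyclic_of_isLineForest {G : SimpleGraph (ZMod n)} {b : ZMod n}
    (h : IsLineForest (n - 1) (lineEdges G b)) :
    G.IsAcyclic ∧ Nat.card G.ConnectedComponent + (lineEdges G b).card = n := by
  classical
  induction hk : (lineEdges G b).card generalizing G with
  | zero =>
    rw [Finset.card_eq_zero] at hk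
    have hbot : G = ⊥ := by
      apply lineEdges_injective b
      simp only
      rw [hk, eq_comm, Finset.eq_empty_iff_forall_notMem]
      rintro ⟨i, j⟩ hp
      simpa using (mem_lineEdges.1 hp).2.2
    subst hbot
    refine ⟨fun v c hc => ?_, ?_⟩
    · cases c with
      | nil => exact hc.not_nil SimpleGraph.Walk.Nil.nil
      | cons h _ => exact absurd h (by simp)
    · have hinj :
          Function.Bijective (SimpleGraph.connectedComponentMk (⊥ : SimpleGraph (ZMod n))) := by
        refine ⟨fun x y hxy => ?_, fun c => ?_⟩
        · simpa using hxy
        · induction c using SimpleGraph.ConnectedComponent.ind with | _ x => exact ⟨x, rfl⟩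
      rw [← Nat.card_congr (Equiv.ofBijective _ hinj), Nat.card_zmod, add_zero]
  | succ k ih =>
    have hne : (lineEdges G b).Nonempty := by
      rw [← Finset.card_pos]; omega
    obtain ⟨⟨i, j⟩, hp, hmax⟩ := (lineEdges G b).exists_max_image (fun p => p.2 - p.1) hne
    have hp' := mem_lineEdges.1 hp
    have hE' := lineEdges_deleteEdges (G := G) (b := b) hp'.1 hp'.2.1
    have hcard := Finset.card_erase_of_mem hp
    rw [← hE', hk, Nat.add_sub_cancel] at hcard
    have hbr : ¬ (G.deleteEdges {s(b + (i : ZMod n), b + (j : ZMod n))}).Reachable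
        (b + i) (b + j) := by
      intro hr
      obtain ⟨g, hg1, hg2, hg3⟩ := h.gap _ hp
      simp only at hg1 hg2 hg3
      have := hr.apply_eq (f := fun x => (x - b).val ≤ g) ?_
      · simp only [add_sub_cancel_left] at this
        rw [ZMod.val_natCast_of_lt (by omega), ZMod.val_natCast_of_lt (by omega)] at this
        simp only [eq_iff_iff] at this
        omega
      · have key : ∀ k l : ℕ, (k, l) ∈ (lineEdges G b).erase (i, j) → (k ≤ g ↔ l ≤ g) := by
          intro k l hkl
          rw [Finset.mem_erase] at hkl
          have h1 := hmax _ hkl.2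
          have h2 := hg3 _ hkl.2
          have h3 := h.lt _ hkl.2
          simp only at h1 h2 h3
          by_contra hcon
          have h4 := h2 (by omega) (by omega)
          exact hkl.1 (Prod.ext (by simp only; omega) (by simp only; omega))
        intro x y hxy
        obtain ⟨k, hk, rfl⟩ := exists_offset b x
        obtain ⟨l, hl, rfl⟩ := exists_offset b y
        simp only [add_sub_cancel_left]
        rw [ZMod.val_natCast_of_lt hk, ZMod.val_natCast_of_lt hl, eq_iff_iff]
        rw [adj_offset_iff hk hl, hE'] at hxy
        rcases hxy with hxy | hxy
        exacts [key _ _ hxy, (key _ _ hxy).symm]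
    have ih' := ih (G := G.deleteEdges {s(b + (i : ZMod n), b + (j : ZMod n))}) (by
      rw [hE']
      exact h.subset (Finset.erase_subset _ _) fun p hp => h.le p (Finset.mem_of_mem_erase hp))
      hcard
    rw [SimpleGraph.card_connectedComponent_deleteEdges hp'.2.2 hbr] at ih'
    refine ⟨?_, by omega⟩
    have hsup : G.deleteEdges {s(b + (i : ZMod n), b + (j : ZMod n))} ⊔
        SimpleGraph.edge (b + (i : ZMod n)) (b + j) = G := by
      ext x y
      rw [SimpleGraph.sup_adj, SimpleGraph.deleteEdges_adj, SimpleGraph.edge_adj,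
        Set.mem_singleton_iff, Sym2.eq_iff]
      constructor
      · rintro (h1 | ⟨⟨rfl, rfl⟩ | ⟨rfl, rfl⟩, -⟩)
        exacts [h1.1, hp'.2.2, hp'.2.2.symm]
      · intro h1
        by_cases h2 : x = b + i ∧ y = b + j ∨ x = b + j ∧ y = b + i
        · exact Or.inr ⟨h2, h1.ne⟩
        · exact Or.inl ⟨h1, h2⟩
    rw [← hsup]
    exact ih'.1.sup_edge_of_not_reachable hbr

/-- Non-crossing forests on the circle are the same as line forests. -/
theorem forest_iff_isLineForest {G : SimpleGraph (ZMod n)} (b : ZMod n) {k : ℕ} (hkn : k ≤ n) :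
    (IsNoncrossing G ∧ G.IsAcyclic ∧ Nat.card G.ConnectedComponent = k) ↔
      IsLineForest (n - 1) (lineEdges G b) ∧ (lineEdges G b).card = n - k := by
  constructor
  · rintro ⟨h1, h2, h3⟩
    have h4 := isLineForest_lineEdges h1 h2 b
    have h5 := (acyclic_of_isLineForest h4).2
    exact ⟨h4, by omega⟩
  · rintro ⟨h1, h2⟩
    have h3 := acyclic_of_isLineForest h1
    exact ⟨isNoncrossing_of_lineEdges_nc h1.nc, h3.1, by omega⟩

end Cut

/-! ### Forests invariant under a rotation -/

section Invariant

variable {n : ℕ}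

/-- The graph is invariant under the rotation by `m` steps. -/
def ShiftInvariant (m : ℕ) (G : SimpleGraph (ZMod n)) : Prop :=
  ∀ x y : ZMod n, G.Adj (x + m) (y + m) ↔ G.Adj x y

/-- The graph has an edge joining a vertex to its image under the rotation by `m` steps. -/
def HasStepEdge (m : ℕ) (G : SimpleGraph (ZMod n)) : Prop := ∃ x : ZMod n, G.Adj x (x + m)

theorem ShiftInvariant.adj_add_mul {m : ℕ} {G : SimpleGraph (ZMod n)} (h : ShiftInvariant m G)
    (k l t : ℤ) : G.Adj ((k + t * m : ℤ) : ZMod n) ((l + t * m : ℤ) : ZMod n) ↔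
      G.Adj (k : ZMod n) (l : ZMod n) := by
  induction t using Int.induction_on with
  | zero => simp
  | succ t ih =>
    rw [← ih, ← h ((k + t * m : ℤ) : ZMod n)]
    push_cast
    ring_nf
  | pred t ih =>
    rw [← ih, ← h]
    push_cast
    ring_nf

theorem adj_add_n_right {G : SimpleGraph (ZMod n)} (k l : ℤ) :
    G.Adj (k : ZMod n) ((l + n : ℤ) : ZMod n) ↔ G.Adj (k : ZMod n) (l : ZMod n) := by
  simp

theorem mem_lineEdges_sub {G : SimpleGraph (ZMod n)} {c i j : ℤ} (hi : c ≤ i) (hij : i < j)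
    (hj : j < c + n) : ((i - c).toNat, (j - c).toNat) ∈ lineEdges G (c : ZMod n) ↔
      G.Adj (i : ZMod n) (j : ZMod n) := by
  rw [mem_lineEdges]
  have e (x : ℤ) (hx : c ≤ x) : (c : ZMod n) + ((x - c).toNat : ℕ) = (x : ZMod n) := by
    rw [← Int.cast_natCast (R := ZMod n), Int.toNat_of_nonneg (by omega)]
    push_cast
    ring
  rw [e i hi, e j (by omega)]
  constructor
  · exact fun h => h.2.2
  · exact fun h => ⟨by omega, by omega, h⟩

variable {m : ℕ}

/-- The unit interval `[g, g + 1]` lies under an edge shorter than `m`. -/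
def ShortCovered (m : ℕ) (G : SimpleGraph (ZMod n)) (g : ℤ) : Prop :=
  ∃ k l : ℤ, k ≤ g ∧ g < l ∧ l - k < m ∧ G.Adj (k : ZMod n) (l : ZMod n)

theorem ShiftInvariant.shortCovered_iff {G : SimpleGraph (ZMod n)} (hI : ShiftInvariant m G)
    (g t : ℤ) : ShortCovered m G (g + t * m) ↔ ShortCovered m G g := by
  have key (g t : ℤ) (h : ShortCovered m G g) : ShortCovered m G (g + t * m) := by
    obtain ⟨k, l, h1, h2, h3, h4⟩ := h
    exact ⟨k + t * m, l + t * m, by omega, by omega, by omega, (hI.adj_add_mul k l t).2 h4⟩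
  refine ⟨fun h => ?_, key g t⟩
  have := key _ (-t) h
  rwa [show g + t * m + -t * m = g by ring] at this

/-- The union of all rotations by multiples of `m` of the edges in `E`, read off from `b` on. -/
def periodicGraph (m : ℕ) (b : ℤ) (E : Finset (ℕ × ℕ)) : SimpleGraph (ZMod n) where
  Adj x y := x ≠ y ∧ ∃ p ∈ E, ∃ t : ℤ,
    (x = ((b + p.1 + t * m : ℤ) : ZMod n) ∧ y = ((b + p.2 + t * m : ℤ) : ZMod n)) ∨
    (y = ((b + p.1 + t * m : ℤ) : ZMod n) ∧ x = ((b + p.2 + t * m : ℤ) : ZMod n))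
  symm := ⟨fun _ _ ⟨h, p, hp, t, ht⟩ => ⟨h.symm, p, hp, t, ht.symm⟩⟩
  loopless := ⟨fun _ h => h.1 rfl⟩

theorem periodicGraph_shiftInvariant (m : ℕ) (b : ℤ) (E : Finset (ℕ × ℕ)) :
    ShiftInvariant m (periodicGraph m b E : SimpleGraph (ZMod n)) := by
  have key (x y : ZMod n) (s : ℤ) (h : (periodicGraph m b E : SimpleGraph (ZMod n)).Adj x y) :
      (periodicGraph m b E : SimpleGraph (ZMod n)).Adj (x + (s * m : ℤ)) (y + (s * m : ℤ)) := by
    obtain ⟨h1, p, hp, t, ht⟩ := h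
    refine ⟨fun h => h1 (add_right_cancel h), p, hp, t + s, ?_⟩
    rcases ht with ⟨rfl, rfl⟩ | ⟨rfl, rfl⟩
    · exact Or.inl ⟨by push_cast; ring, by push_cast; ring⟩
    · exact Or.inr ⟨by push_cast; ring, by push_cast; ring⟩
  intro x y
  constructor
  · intro h
    have := key _ _ (-1) h
    simpa using this
  · intro h
    have := key _ _ 1 h
    simpa using this

variable [NeZero n]

theorem IsNoncrossing.not_interleaved {G : SimpleGraph (ZMod n)} (hG : IsNoncrossing G)
    {i j k l : ℤ} (h1 : i < k) (h2 : k < j) (h3 : j < l) (h4 : l < i + n)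
    (hij : G.Adj (i : ZMod n) (j : ZMod n)) (hkl : G.Adj (k : ZMod n) (l : ZMod n)) : False := by
  have ne {x y : ℤ} (hx : x < y) (hy : y < x + n) : (x : ZMod n) ≠ (y : ZMod n) := by
    intro h
    rw [ZMod.intCast_eq_intCast_iff_dvd_sub] at h
    have := Int.le_of_dvd (by omega) h
    omega
  exact not_disjoint_chord h1 h2 h3 h4 (hG _ _ _ _ hij hkl (ne h1 (by omega))
    (ne (by omega) (by omega)) (ne h2 (by omega)).symm (ne h3 (by omega)))

/-- The gap property of line forests, on the universal cover of the circle. -/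
theorem exists_gap {G : SimpleGraph (ZMod n)} (hG : IsNoncrossing G) (hA : G.IsAcyclic)
    {c i j : ℤ} (hi : c ≤ i) (hij : i < j) (hj : j < c + n)
    (h : G.Adj (i : ZMod n) (j : ZMod n)) :
    ∃ g, i ≤ g ∧ g < j ∧ ∀ k l : ℤ, c ≤ k → l < c + n → k ≤ g → g < l →
      G.Adj (k : ZMod n) (l : ZMod n) → k ≤ i ∧ j ≤ l := by
  obtain ⟨g, h1, h2, h3⟩ := lineEdges_gap hG hA (c : ZMod n) _ ((mem_lineEdges_sub hi hij hj).2 h)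
  simp only at h1 h2 h3
  refine ⟨c + g, by omega, by omega, fun k l hk hl hkg hgl hkl => ?_⟩
  have := h3 _ ((mem_lineEdges_sub hk (by omega) hl).2 hkl) (by simp only; omega)
    (by simp only; omega)
  simp only at this
  omega

variable {d : ℕ}

/-- In an invariant non-crossing graph, no edge is longer than the rotation: it would cross its
own image. -/
theorem ShiftInvariant.length_le {G : SimpleGraph (ZMod n)} (hn : n = d * m) (hd : 2 ≤ d)
    (hG : IsNoncrossing G) (hI : ShiftInvariant m G) {i j : ℤ}
    (hlen : 2 * (j - i) ≤ n) (h : G.Adj (i : ZMod n) (j : ZMod n)) : j - i ≤ m := by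
  have h2m : 2 * m ≤ n := by rw [hn]; exact Nat.mul_le_mul_right m hd
  by_contra hcon
  have h' := (hI.adj_add_mul i j 1).2 h
  rw [one_mul] at h'
  have hm : 0 < m := Nat.pos_of_ne_zero (by rintro rfl; exact NeZero.ne n (by simpa using hn))
  exact hG.not_interleaved (by omega) (by omega) (by omega) (by omega) h h'

/-- For a rotation of order at least three, edges joining a vertex to its image would form a
cycle. -/
theorem ShiftInvariant.not_hasStepEdge {G : SimpleGraph (ZMod n)} (hn : n = d * m) (hd : 3 ≤ d)
    (hG : IsNoncrossing G) (hA : G.IsAcyclic) (hI : ShiftInvariant m G) : ¬ HasStepEdge m G := by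
  rintro ⟨x, hx⟩
  have hm : 0 < m := Nat.pos_of_ne_zero (by rintro rfl; exact NeZero.ne n (by simpa using hn))
  obtain ⟨i, rfl⟩ := ZMod.intCast_surjective x
  have step (t : ℤ) : G.Adj ((i + t * m : ℤ) : ZMod n) ((i + t * m + m : ℤ) : ZMod n) := by
    have := (hI.adj_add_mul i (i + m) t).2 (by push_cast; exact hx)
    rwa [show i + m + t * m = i + t * m + m by ring] at this
  obtain ⟨D, rfl⟩ : ∃ D, d = D + 3 := ⟨d - 3, by omega⟩
  have hlast : G.Adj (i : ZMod n) ((i + (D + 2) * m : ℤ) : ZMod n) := by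
    have := step (D + 2)
    rw [show i + ((D : ℤ) + 2) * m + m = i + n by rw [hn]; push_cast; ring] at this
    exact ((adj_add_n_right _ _).1 this).symm
  have hnZ : (n : ℤ) = (D + 3) * m := by rw [hn]; push_cast; ring
  have hmZ : (0 : ℤ) < m := by exact_mod_cast hm
  obtain ⟨g, h1, h2, h3⟩ := exists_gap hG hA (c := i) le_rfl
    (by nlinarith [Int.natCast_nonneg D]) (by rw [hnZ]; nlinarith) hlast
  have e1 := Int.emod_nonneg (g - i) hmZ.ne'
  have e2 := Int.emod_lt_of_pos (g - i) hmZ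
  have e3 := Int.mul_ediv_add_emod (g - i) m
  set t := (g - i) / m
  have ht0 : 0 ≤ t := Int.ediv_nonneg (by omega) hmZ.le
  have ht1 : t < D + 2 := by
    by_contra hcon
    have : (D + 2) * (m : ℤ) ≤ t * m := mul_le_mul_of_nonneg_right (by omega) hmZ.le
    have : (m : ℤ) * t = t * m := mul_comm _ _
    omega
  have ht1' : (t + 1) * (m : ℤ) ≤ (D + 2) * m := mul_le_mul_of_nonneg_right (by omega) hmZ.le
  have ht0' : 0 ≤ t * (m : ℤ) := mul_nonneg ht0 hmZ.le
  have e4 : (m : ℤ) * t = t * m := mul_comm _ _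
  have e5 : (t + 1) * (m : ℤ) = t * m + m := by ring
  have e6 : ((D : ℤ) + 2) * m = (D + 1) * m + m := by ring
  have e7 : ((D : ℤ) + 3) * m = (D + 2) * m + m := by ring
  have e8 : 0 < ((D : ℤ) + 1) * m := by positivity
  have := h3 _ _ (by omega) (by omega) (by omega) (by omega) (step t)
  omega

/-- Some unit interval lies under no short edge. Otherwise the longest short edges would form a
closed polygon around the centre. -/
theorem exists_not_shortCovered {G : SimpleGraph (ZMod n)} (h2m : 2 * m ≤ n)
    (hG : IsNoncrossing G) (hA : G.IsAcyclic) : ∃ g, ¬ ShortCovered m G g := by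
  classical
  by_contra! hcov
  -- a short edge `(x, y)` of maximal length
  let L : Finset ℕ := (Finset.range m).filter fun s =>
    0 < s ∧ ∃ x : ℤ, G.Adj (x : ZMod n) ((x + s : ℤ) : ZMod n)
  have hL : L.Nonempty := by
    obtain ⟨k, l, h1, h2, h3, h4⟩ := hcov 0
    refine ⟨(l - k).toNat, ?_⟩
    simp only [L, Finset.mem_filter, Finset.mem_range]
    refine ⟨by omega, by omega, k, ?_⟩
    rwa [Int.toNat_of_nonneg (by omega), show k + (l - k) = l by ring]
  obtain ⟨s, hs, hmax⟩ := L.exists_max_image id hL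
  simp only [L, Finset.mem_filter, Finset.mem_range, id] at hs hmax
  obtain ⟨hsm, hs0, x, hx⟩ := hs
  -- no short edge passes over its starting point `x`
  have hvis : ∀ k l : ℤ, k < x → x < l → l - k < m → ¬ G.Adj (k : ZMod n) (l : ZMod n) := by
    intro k l h1 h2 h3 h4
    rcases lt_or_ge l (x + s) with h5 | h5
    · exact hG.not_interleaved h1 h2 h5 (by omega) h4 hx
    · have := hmax (l - k).toNat ⟨by omega, by omega, k, by
        rwa [Int.toNat_of_nonneg (by omega), show k + (l - k) = l by ring]⟩
      omega
  have hvis' : ∀ k l : ℤ, k < x + n → x + n < l → l - k < m →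
      ¬ G.Adj (k : ZMod n) (l : ZMod n) := by
    intro k l h1 h2 h3 h4
    refine hvis (k - n) (l - n) (by omega) (by omega) (by omega) ?_
    simpa using h4
  -- the longest short edge `(x + n - u, x + n)` ending at `x + n`
  let U : Finset ℕ := (Finset.range m).filter fun u =>
    0 < u ∧ G.Adj ((x + n - u : ℤ) : ZMod n) ((x + n : ℤ) : ZMod n)
  have hU : U.Nonempty := by
    obtain ⟨k, l, h1, h2, h3, h4⟩ := hcov (x + n - 1)
    have hl : l = x + n := by
      by_contra hne
      exact hvis' k l (by omega) (by omega) h3 h4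
    subst hl
    refine ⟨(x + n - k).toNat, ?_⟩
    simp only [U, Finset.mem_filter, Finset.mem_range]
    refine ⟨by omega, by omega, ?_⟩
    rwa [Int.toNat_of_nonneg (by omega), show x + n - (x + n - k) = k by ring]
  obtain ⟨u, hu, humax⟩ := U.exists_max_image id hU
  simp only [U, Finset.mem_filter, Finset.mem_range, id] at hu humax
  obtain ⟨hum, hu0, hu⟩ := hu
  have hxu := ((adj_add_n_right _ _).1 hu).symm
  obtain ⟨g, h1, h2, h3⟩ := exists_gap hG hA (c := x) le_rfl (by omega) (by omega) hxu
  obtain ⟨k, l, h4, h5, h6, h7⟩ := hcov g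
  have hk : x ≤ k := by
    by_contra hcon
    exact hvis k l (by omega) (by omega) h6 h7
  have hl : l ≤ x + n := by
    by_contra hcon
    exact hvis' k l (by omega) (by omega) h6 h7
  have hlu : l ≤ x + n - u := by
    by_contra hcon
    rcases hl.lt_or_eq with hl | rfl
    · exact hG.not_interleaved (i := k) (k := x + n - u) (j := l) (l := x + n)
        (by omega) (by omega) hl (by omega) h7 hu
    · have := humax (x + n - k).toNat ⟨by omega, by omega, by
        rwa [Int.toNat_of_nonneg (by omega), show x + n - (x + n - k) = k by ring]⟩
      omega
  have := h3 k l hk (by omega) h4 h5 h7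
  omega

/-- Every edge has a lift to the integers of length at most half the circle. -/
theorem exists_lift {G : SimpleGraph (ZMod n)} {x y : ZMod n} (h : G.Adj x y) :
    ∃ i j : ℤ, i < j ∧ 2 * (j - i) ≤ n ∧
      ((x = (i : ZMod n) ∧ y = (j : ZMod n)) ∨ (x = (j : ZMod n) ∧ y = (i : ZMod n))) := by
  have hlift (z : ZMod n) : z = ((z.val : ℤ) : ZMod n) := by simp
  have hx := ZMod.val_lt x
  have hy := ZMod.val_lt y
  have hne : x.val ≠ y.val := fun h' => h.ne (ZMod.val_injective n h')
  have hplus (z : ZMod n) : z = ((z.val + n : ℤ) : ZMod n) := by simp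
  rcases lt_or_gt_of_ne hne with hlt | hlt
  · rcases le_or_gt (2 * ((y.val : ℤ) - x.val)) n with h1 | h1
    · exact ⟨x.val, y.val, by omega, h1, Or.inl ⟨hlift x, hlift y⟩⟩
    · exact ⟨y.val, x.val + n, by omega, by omega, Or.inr ⟨hplus x, hlift y⟩⟩
  · rcases le_or_gt (2 * ((x.val : ℤ) - y.val)) n with h1 | h1
    · exact ⟨y.val, x.val, by omega, h1, Or.inr ⟨hlift x, hlift y⟩⟩
    · exact ⟨x.val, y.val + n, by omega, by omega, Or.inl ⟨hlift x, hplus y⟩⟩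

/-- The edges of `periodicGraph` of length at most `m` are the translates of the edges in `E`. -/
theorem periodicGraph_adj_iff (hn : n = d * m) (hd : 2 ≤ d) {b : ℤ} {E : Finset (ℕ × ℕ)}
    (hE : ∀ p ∈ E, p.1 < p.2 ∧ p.2 ≤ m) {k l : ℤ} (hkl : k < l) (hlen : l - k ≤ m) :
    (periodicGraph m b E : SimpleGraph (ZMod n)).Adj (k : ZMod n) (l : ZMod n) ↔
      ∃ p ∈ E, ∃ t : ℤ, k = b + p.1 + t * m ∧ l = b + p.2 + t * m := by
  have hm : 0 < m := Nat.pos_of_ne_zero (by rintro rfl; exact NeZero.ne n (by simpa using hn))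
  have h2m : 2 * m ≤ n := by rw [hn]; exact Nat.mul_le_mul_right m hd
  have hnZ : (n : ℤ) = d * m := by rw [hn]; push_cast; ring
  constructor
  · rintro ⟨-, ⟨i, j⟩, hp, t, ⟨h1, h2⟩ | ⟨h1, h2⟩⟩
    · have hij := hE _ hp
      simp only at h1 h2 hij
      rw [eq_comm, ZMod.intCast_eq_intCast_iff_dvd_sub] at h1 h2
      obtain ⟨u, hu⟩ := h1
      obtain ⟨v, hv⟩ := h2
      have huv : v = u := by
        have h3 : (n : ℤ) * (v - u) = (l - k) - (j - i) := by rw [mul_sub, ← hu, ← hv]; ring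
        by_contra hne
        rcases lt_or_gt_of_ne hne with h | h
        · have : (n : ℤ) * (v - u) ≤ n * (-1) :=
            mul_le_mul_of_nonneg_left (by omega) (by omega)
          omega
        · have : (n : ℤ) * 1 ≤ n * (v - u) :=
            mul_le_mul_of_nonneg_left (by omega) (by omega)
          omega
      subst huv
      refine ⟨_, hp, t + d * v, ?_, ?_⟩
      · simp only
        linear_combination hu + v * hnZ
      · simp only
        linear_combination hv + v * hnZ
    · have hij := hE _ hp
      simp only at h1 h2 hij
      rw [eq_comm, ZMod.intCast_eq_intCast_iff_dvd_sub] at h1 h2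
      obtain ⟨v, hv⟩ := h1
      obtain ⟨u, hu⟩ := h2
      have h3 : (n : ℤ) * (v - u) = (l - k) + (j - i) := by rw [mul_sub, ← hu, ← hv]; ring
      have huv : v - u = 1 := by
        by_contra hne
        rcases lt_or_gt_of_ne hne with h | h
        · have : (n : ℤ) * (v - u) ≤ n * 0 :=
            mul_le_mul_of_nonneg_left (by omega) (by omega)
          omega
        · have : (n : ℤ) * 2 ≤ n * (v - u) :=
            mul_le_mul_of_nonneg_left (by omega) (by omega)
          omega
      rw [huv, mul_one] at h3
      have hi : i = 0 := by omega
      have hj : j = m := by omega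
      subst hi hj
      refine ⟨_, hp, t + 1 + d * u, ?_, ?_⟩
      · simp only
        push_cast
        linear_combination hu + u * hnZ
      · simp only
        have : l = k + j := by omega
        rw [this]
        linear_combination hu + u * hnZ
  · rintro ⟨p, hp, t, rfl, rfl⟩
    have := hE p hp
    refine ⟨fun h => ?_, p, hp, t, Or.inl ⟨rfl, rfl⟩⟩
    rw [ZMod.intCast_eq_intCast_iff_dvd_sub] at h
    have := Int.le_of_dvd (by omega) h
    omega

end Invariant

/-! ### Counting invariant forests without an edge through the centre -/

section Repeat

/-- The union of the first `d` translates of `E` by multiples of `m`. -/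
def repeatEdges (d m : ℕ) (E : Finset (ℕ × ℕ)) : Finset (ℕ × ℕ) :=
  (Finset.range d).biUnion fun t => shiftEdges (t * m) E

theorem mem_repeatEdges {d m : ℕ} {E : Finset (ℕ × ℕ)} {a b : ℕ} :
    (a, b) ∈ repeatEdges d m E ↔
      ∃ t < d, ∃ p ∈ E, a = p.1 + t * m ∧ b = p.2 + t * m := by
  simp only [repeatEdges, Finset.mem_biUnion, Finset.mem_range, mem_shiftEdges]
  constructor
  · rintro ⟨t, ht, c, e, hce, rfl, rfl⟩
    exact ⟨t, ht, (c, e), hce, rfl, rfl⟩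
  · rintro ⟨t, ht, ⟨c, e⟩, hce, rfl, rfl⟩
    exact ⟨t, ht, c, e, hce, rfl, rfl⟩

theorem repeatEdges_succ (d m : ℕ) (E : Finset (ℕ × ℕ)) :
    repeatEdges (d + 1) m E = repeatEdges d m E ∪ shiftEdges (d * m) E := by
  rw [repeatEdges, Finset.range_add_one, Finset.biUnion_insert, Finset.union_comm]
  rfl

theorem isLineForest_repeatEdges {d m : ℕ} (hm : 0 < m) {E : Finset (ℕ × ℕ)}
    (h : IsLineForest (m - 1) E) : IsLineForest (d * m - 1) (repeatEdges d m E) ∧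
      (repeatEdges d m E).card = d * E.card := by
  induction d with
  | zero => exact ⟨by simpa [repeatEdges] using IsLineForest.empty _, by simp [repeatEdges]⟩
  | succ d ih =>
    have hs := h.shift (d * m)
    have hge : ∀ p ∈ shiftEdges (d * m) E, d * m ≤ p.1 := by
      rintro ⟨a, b⟩ hp
      obtain ⟨c, e, -, rfl, rfl⟩ := mem_shiftEdges.1 hp
      simp
    rw [repeatEdges_succ]
    constructor
    · rw [show (d + 1) * m - 1 = m - 1 + d * m by rw [add_mul, one_mul]; omega]
      exact ih.1.union hs (fun p hp => (Nat.sub_le _ _).trans (hge p hp)) (by omega)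
    · rw [Finset.card_union_of_disjoint, ih.2, card_shiftEdges]
      · ring
      · rw [Finset.disjoint_left]
        intro p hp hp'
        have := ih.1.le p hp
        have := ih.1.lt p hp
        have := hge p hp'
        omega

end Repeat

section Central

variable {n d m : ℕ}

theorem step_pos [NeZero n] (hn : n = d * m) : 0 < m :=
  Nat.pos_of_ne_zero (by rintro rfl; exact NeZero.ne n (by simpa using hn))

theorem two_mul_step_le (hn : n = d * m) (hd : 2 ≤ d) : 2 * m ≤ n := by
  rw [hn]; exact Nat.mul_le_mul_right m hd

theorem periodicGraph_le {G : SimpleGraph (ZMod n)} (hI : ShiftInvariant m G) {b : ℤ}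
    {E : Finset (ℕ × ℕ)}
    (hE : ∀ p ∈ E, G.Adj ((b + p.1 : ℤ) : ZMod n) ((b + p.2 : ℤ) : ZMod n)) {x y : ZMod n}
    (h : (periodicGraph m b E : SimpleGraph (ZMod n)).Adj x y) : G.Adj x y := by
  obtain ⟨-, p, hp, t, ⟨rfl, rfl⟩ | ⟨rfl, rfl⟩⟩ := h
  · exact (hI.adj_add_mul _ _ t).2 (hE p hp)
  · exact ((hI.adj_add_mul _ _ t).2 (hE p hp)).symm

/-- All edges of `periodicGraph` have length at most `m`. -/
theorem periodicGraph_adj_cases (hn : n = d * m) (hd : 2 ≤ d) {b : ℤ} {E : Finset (ℕ × ℕ)}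
    (hE : ∀ p ∈ E, p.1 < p.2 ∧ p.2 ≤ m) {k l : ℤ} (hkl : k < l) (hln : l < k + n)
    (h : (periodicGraph m b E : SimpleGraph (ZMod n)).Adj (k : ZMod n) (l : ZMod n)) :
    l - k ≤ m ∨ k + n - l ≤ m := by
  have h2m := two_mul_step_le hn hd
  obtain ⟨-, ⟨i, j⟩, hp, t, h'⟩ := h
  have hij := hE _ hp
  simp only at hij h'
  have hw : ∃ w : ℤ, (n : ℤ) * w = (l - k) - (j - i) ∨ (n : ℤ) * w = (l - k) + (j - i) := by
    rcases h' with ⟨h1, h2⟩ | ⟨h1, h2⟩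
    · rw [eq_comm, ZMod.intCast_eq_intCast_iff_dvd_sub] at h1 h2
      obtain ⟨u, hu⟩ := h1
      obtain ⟨v, hv⟩ := h2
      exact ⟨v - u, Or.inl (by rw [mul_sub, ← hu, ← hv]; ring)⟩
    · rw [eq_comm, ZMod.intCast_eq_intCast_iff_dvd_sub] at h1 h2
      obtain ⟨v, hv⟩ := h1
      obtain ⟨u, hu⟩ := h2
      exact ⟨v - u, Or.inr (by rw [mul_sub, ← hu, ← hv]; ring)⟩
  obtain ⟨w, hw⟩ := hw
  rcases lt_trichotomy w 0 with h0 | rfl | h0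
  · have : (n : ℤ) * w ≤ n * (-1) := mul_le_mul_of_nonneg_left (by omega) (by omega)
    omega
  · omega
  · have : (n : ℤ) * 1 ≤ n * w := mul_le_mul_of_nonneg_left (by omega) (by omega)
    omega

variable [NeZero n]

theorem lineEdges_periodicGraph (hn : n = d * m) (hd : 2 ≤ d) {b : ℤ} {E : Finset (ℕ × ℕ)}
    (hE : ∀ p ∈ E, p.1 < p.2 ∧ p.2 < m) :
    lineEdges (periodicGraph m b E : SimpleGraph (ZMod n)) (b : ZMod n) = repeatEdges d m E := by
  have hE' : ∀ p ∈ E, p.1 < p.2 ∧ p.2 ≤ m := fun p hp => ⟨(hE p hp).1, (hE p hp).2.le⟩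
  have hm := step_pos hn
  have h2m := two_mul_step_le hn hd
  have hnZ : (n : ℤ) = d * m := by rw [hn]; push_cast; ring
  have hmZ : (0 : ℤ) < m := by exact_mod_cast hm
  ext ⟨i, j⟩
  rw [mem_lineEdges, mem_repeatEdges]
  have e (x : ℕ) : (b : ZMod n) + x = ((b + x : ℤ) : ZMod n) := by push_cast; ring
  rw [e, e]
  constructor
  · rintro ⟨hij, hj, h⟩
    rcases periodicGraph_adj_cases hn hd hE' (by omega) (by omega) h with h1 | h1
    · obtain ⟨p, hp, t, h2, h3⟩ := (periodicGraph_adj_iff hn hd hE' (by omega) h1).1 h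
      have := hE p hp
      have ht0 : 0 ≤ t := by
        by_contra hcon
        have : t * (m : ℤ) ≤ (-1) * m := mul_le_mul_of_nonneg_right (by omega) hmZ.le
        omega
      have htd : t < d := by
        by_contra hcon
        have : (d : ℤ) * m ≤ t * m := mul_le_mul_of_nonneg_right (by omega) hmZ.le
        omega
      obtain ⟨t, rfl⟩ := Int.eq_ofNat_of_zero_le ht0
      refine ⟨t, by omega, p, hp, ?_, ?_⟩
      · zify; omega
      · zify; omega
    · have h' := ((adj_add_n_right (G := periodicGraph m b E) (b + j : ℤ) (b + i : ℤ)).2 h.symm)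
      obtain ⟨p, hp, t, h2, h3⟩ :=
        (periodicGraph_adj_iff hn hd hE' (by omega) (by omega)).1 h'
      have := hE p hp
      have htd : t < d := by
        by_contra hcon
        have : (d : ℤ) * m ≤ t * m := mul_le_mul_of_nonneg_right (by omega) hmZ.le
        omega
      have : t * (m : ℤ) ≤ (d - 1) * m := mul_le_mul_of_nonneg_right (by omega) hmZ.le
      have : ((d : ℤ) - 1) * m = d * m - m := by ring
      omega
  · rintro ⟨t, ht, p, hp, rfl, rfl⟩
    have := hE p hp
    have h1 : (t + 1) * m ≤ d * m := Nat.mul_le_mul_right m ht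
    rw [add_mul, one_mul] at h1
    refine ⟨by omega, by omega, ?_⟩
    rw [periodicGraph_adj_iff hn hd hE' (by omega) (by omega)]
    exact ⟨p, hp, t, by push_cast; ring, by push_cast; ring⟩

theorem shortCovered_periodicGraph (hn : n = d * m) (hd : 2 ≤ d) {b : ℤ} {E : Finset (ℕ × ℕ)}
    (hE : ∀ p ∈ E, p.1 < p.2 ∧ p.2 < m) {g : ℤ} :
    ShortCovered m (periodicGraph m b E : SimpleGraph (ZMod n)) g ↔
      ∃ p ∈ E, ∃ t : ℤ, b + p.1 + t * m ≤ g ∧ g < b + p.2 + t * m := by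
  have hE' : ∀ p ∈ E, p.1 < p.2 ∧ p.2 ≤ m := fun p hp => ⟨(hE p hp).1, (hE p hp).2.le⟩
  constructor
  · rintro ⟨k, l, h1, h2, h3, h4⟩
    obtain ⟨p, hp, t, rfl, rfl⟩ :=
      (periodicGraph_adj_iff hn hd hE' (by omega) (by omega)).1 h4
    exact ⟨p, hp, t, h1, h2⟩
  · rintro ⟨p, hp, t, h1, h2⟩
    have := hE p hp
    exact ⟨_, _, h1, h2, by omega,
      (periodicGraph_adj_iff hn hd hE' (by omega) (by omega)).2 ⟨p, hp, t, rfl, rfl⟩⟩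

/-- The interval just before the base vertex lies under no short edge. -/
theorem not_shortCovered_periodicGraph (hn : n = d * m) (hd : 2 ≤ d) {b : ℤ}
    {E : Finset (ℕ × ℕ)} (hE : ∀ p ∈ E, p.1 < p.2 ∧ p.2 < m) :
    ¬ ShortCovered m (periodicGraph m b E : SimpleGraph (ZMod n)) (b - 1) := by
  rw [shortCovered_periodicGraph hn hd hE]
  rintro ⟨p, hp, t, h1, h2⟩
  have := hE p hp
  have hm := step_pos hn
  have hmZ : (0 : ℤ) ≤ m := by omega
  rcases lt_or_ge t 0 with ht | ht
  · have : t * (m : ℤ) ≤ (-1) * m := mul_le_mul_of_nonneg_right (by omega) hmZ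
    omega
  · have : 0 ≤ t * (m : ℤ) := mul_nonneg ht hmZ
    omega

theorem shortCovered_periodicGraph_of_covered (hn : n = d * m) (hd : 2 ≤ d) {b : ℤ}
    {E : Finset (ℕ × ℕ)} (hE : ∀ p ∈ E, p.1 < p.2 ∧ p.2 < m) {i : ℕ} (hi : Covered E i) :
    ShortCovered m (periodicGraph m b E : SimpleGraph (ZMod n)) (b + i) := by
  rw [shortCovered_periodicGraph hn hd hE]
  obtain ⟨p, hp, h1, h2⟩ := hi
  exact ⟨p, hp, 0, by omega, by omega⟩

theorem mem_iff_periodicGraph_adj (hn : n = d * m) (hd : 2 ≤ d) {b : ℤ}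
    {E : Finset (ℕ × ℕ)} (hE : ∀ p ∈ E, p.1 < p.2 ∧ p.2 ≤ m) {i j : ℕ} (hij : i < j)
    (hj : j ≤ m) : (i, j) ∈ E ↔ (periodicGraph m b E : SimpleGraph (ZMod n)).Adj
      ((b + i : ℤ) : ZMod n) ((b + j : ℤ) : ZMod n) := by
  rw [periodicGraph_adj_iff hn hd hE (by omega) (by omega)]
  have hm := step_pos hn
  have hmZ : (0 : ℤ) ≤ m := by omega
  constructor
  · exact fun h => ⟨_, h, 0, by simp, by simp⟩
  · rintro ⟨⟨i', j'⟩, hp, t, h1, h2⟩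
    have := hE _ hp
    simp only at this h1 h2
    have ht : t = 0 := by
      by_contra hne
      rcases lt_or_gt_of_ne hne with ht | ht
      · have : t * (m : ℤ) ≤ (-1) * m := mul_le_mul_of_nonneg_right (by omega) hmZ
        omega
      · have : 1 * (m : ℤ) ≤ t * m := mul_le_mul_of_nonneg_right (by omega) hmZ
        omega
    subst ht
    rw [zero_mul] at h1 h2
    obtain rfl : i = i' := by omega
    obtain rfl : j = j' := by omega
    exact hp

/-- An invariant graph without an edge of length `m` is generated by the edges on `m` consecutive
vertices, if these start after an interval which lies under no short edge. -/
theorem eq_periodicGraph {G : SimpleGraph (ZMod n)} (hn : n = d * m) (hd : 2 ≤ d)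
    (hG : IsNoncrossing G) (hI : ShiftInvariant m G) (hS : ¬ HasStepEdge m G) {c : ℤ}
    (hc : ¬ ShortCovered m G (c - 1)) :
    G = periodicGraph m c ((lineEdges G (c : ZMod n)).filter fun p => p.2 < m) := by
  have hm := step_pos hn
  have hmZ : (0 : ℤ) < m := by omega
  have h2m := two_mul_step_le hn hd
  ext x y
  constructor
  · intro h
    obtain ⟨i, j, hij, hlen, hxy⟩ := exists_lift h
    have hadj : G.Adj (i : ZMod n) (j : ZMod n) := by
      rcases hxy with ⟨rfl, rfl⟩ | ⟨rfl, rfl⟩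
      exacts [h, h.symm]
    have hle := hI.length_le hn hd hG hlen hadj
    have hlt : j - i < m := by
      refine lt_of_le_of_ne hle fun h' => hS ⟨(i : ZMod n), ?_⟩
      rw [show j = i + m by omega] at hadj
      simpa using hadj
    have e1 := Int.emod_nonneg (i - c) hmZ.ne'
    have e2 := Int.emod_lt_of_pos (i - c) hmZ
    have e3 := Int.mul_ediv_add_emod (i - c) m
    set t := (i - c) / m
    rw [mul_comm] at e3
    have hadj' := (hI.adj_add_mul i j (-t)).2 hadj
    rw [neg_mul] at hadj'
    have hj : j + -(t * m) < c + m := by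
      by_contra hcon
      have := (hI.shortCovered_iff (c - 1) 1).1 ⟨_, _, by omega, by omega, by omega, hadj'⟩
      exact hc this
    have hmem := (mem_lineEdges_sub (c := c) (by omega) (by omega) (by omega)).2 hadj'
    refine ⟨h.ne, _, Finset.mem_filter.2 ⟨hmem, by simp only; omega⟩, t, ?_⟩
    simp only
    rw [Int.toNat_of_nonneg (by omega), Int.toNat_of_nonneg (by omega),
      show c + (i + -(t * m) - c) + t * m = i by ring,
      show c + (j + -(t * m) - c) + t * m = j by ring]
    rcases hxy with hxy | hxy
    exacts [Or.inl hxy, Or.inr hxy.symm]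
  · refine periodicGraph_le hI ?_
    rintro ⟨i, j⟩ hp
    have := (mem_lineEdges.1 (Finset.mem_filter.1 hp).1).2.2
    simpa using this

/-- The parameters of an invariant forest without an edge of length `m`: the distance `h` from `0`
back to the next interval under no short edge, and the forest on the `m` vertices from there on. -/
abbrev CentralData (m e : ℕ) : Type :=
  {q : ℕ × Finset (ℕ × ℕ) // q.1 < m ∧ IsLineForest (m - 1) q.2 ∧ FullyCovered q.1 q.2 ∧
    q.2.card = e}

theorem card_centralData (hm : 0 < m) (e : ℕ) :
    (Nat.card (CentralData m e) : ℤ) = (prefixPoly (m - 1)).coeff e := by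
  classical
  have h1 : Nat.card (CentralData m e) = (((Finset.range m ×ˢ lineForests (m - 1)).filter
      fun q => FullyCovered q.1 q.2 ∧ q.2.card = e)).card := by
    refine Nat.subtype_card _ fun q => ?_
    simp only [Finset.mem_filter, Finset.mem_product, Finset.mem_range, mem_lineForests]
    tauto
  rw [h1, Finset.card_filter, Finset.sum_product_right, prefixPoly, Polynomial.finsetSum_coeff,
    Nat.cast_sum]
  refine Finset.sum_congr rfl fun E _ => ?_
  rw [← Polynomial.C_eq_natCast, Polynomial.coeff_C_mul, Polynomial.coeff_X_pow, coveredPrefixes,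
    Nat.sub_add_cancel hm, Finset.card_filter]
  by_cases hE : E.card = e
  · subst hE
    simp
  · simp [hE, Ne.symm hE]

/-- The non-crossing forests with `k` components that are invariant under the rotation by `m`
steps. -/
def IsInvariantForest (m k : ℕ) (G : SimpleGraph (ZMod n)) : Prop :=
  (IsNoncrossing G ∧ G.IsAcyclic ∧ Nat.card G.ConnectedComponent = k) ∧ ShiftInvariant m G

/-- Without an edge through the centre, an invariant forest consists of `d` rotated copies of a
forest on `m` consecutive vertices. -/
theorem exists_centralData (hn : n = d * m) (hd : 2 ≤ d) {k : ℕ} (hkn : k ≤ n)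
    {G : SimpleGraph (ZMod n)} (hG : IsInvariantForest m k G) (hS : ¬ HasStepEdge m G) :
    ∃ (h : ℕ) (E : Finset (ℕ × ℕ)), h < m ∧ IsLineForest (m - 1) E ∧ FullyCovered h E ∧
      d * E.card = n - k ∧ G = periodicGraph m (-h) E := by
  classical
  have hm := step_pos hn
  have hmZ : (0 : ℤ) < m := by omega
  have h2m := two_mul_step_le hn hd
  obtain ⟨⟨hNC, hA, hk⟩, hI⟩ := hG
  have hex : ∃ h : ℕ, ¬ ShortCovered m G (-h - 1) := by
    obtain ⟨g, hg⟩ := exists_not_shortCovered h2m hNC hA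
    have e1 := Int.emod_nonneg (-1 - g) hmZ.ne'
    have e3 := Int.mul_ediv_add_emod (-1 - g) m
    refine ⟨((-1 - g) % m).toNat, ?_⟩
    rw [Int.toNat_of_nonneg e1, show -((-1 - g) % m) - 1 = g + (-1 - g) / m * m by
      linear_combination -e3]
    rwa [hI.shortCovered_iff]
  set h := Nat.find hex with hh
  have hspec : ¬ ShortCovered m G (-h - 1) := Nat.find_spec hex
  have hmin : ∀ j < h, ShortCovered m G (-j - 1) := fun j hj => not_not.1 (Nat.find_min hex hj)
  have hhm : h < m := by
    by_contra hcon
    have := hmin (h - m) (by omega)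
    rw [Nat.cast_sub (by omega)] at this
    rw [show -((h : ℤ) - m) - 1 = -h - 1 + 1 * m by ring, hI.shortCovered_iff] at this
    exact hspec this
  have heq := eq_periodicGraph hn hd hNC hI hS hspec
  set E := (lineEdges G ((-h : ℤ) : ZMod n)).filter fun p => p.2 < m with hE
  have hLF := isLineForest_lineEdges hNC hA ((-h : ℤ) : ZMod n)
  have hEF : IsLineForest (m - 1) E := hLF.subset (Finset.filter_subset _ _) fun p hp => by
    have := (Finset.mem_filter.1 hp).2
    omega
  have hElt : ∀ p ∈ E, p.1 < p.2 ∧ p.2 < m := fun p hp =>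
    ⟨hEF.lt p hp, (Finset.mem_filter.1 hp).2⟩
  refine ⟨h, E, hhm, hEF, fun i hi => ?_, ?_, heq⟩
  · have hc := hmin (h - 1 - i) (by omega)
    rw [show (-((h - 1 - i : ℕ) : ℤ) - 1) = -h + i by omega, heq,
      shortCovered_periodicGraph hn hd hElt] at hc
    obtain ⟨p, hp, t, h1, h2⟩ := hc
    have := hElt p hp
    have ht : t = 0 := by
      by_contra hne
      rcases lt_or_gt_of_ne hne with ht | ht
      · have : t * (m : ℤ) ≤ (-1) * m := mul_le_mul_of_nonneg_right (by omega) hmZ.le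
        omega
      · have : 1 * (m : ℤ) ≤ t * m := mul_le_mul_of_nonneg_right (by omega) hmZ.le
        omega
    subst ht
    exact ⟨p, hp, by omega, by omega⟩
  · have h1 := ((forest_iff_isLineForest ((-h : ℤ) : ZMod n) hkn).1 ⟨hNC, hA, hk⟩).2
    rw [← h1, ← (isLineForest_repeatEdges (d := d) hm hEF).2,
      ← lineEdges_periodicGraph (n := n) hn hd (b := -h) hElt, ← heq]

/-- The parameters are unique, since `-h` is the first vertex, going backwards from `0`, such that
the interval before it lies under no short edge. -/
theorem card_invariant_central (hn : n = d * m) (hd : 2 ≤ d) {k e : ℕ} (hkn : k ≤ n)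
    (he : n - k = d * e) :
    Nat.card {G : SimpleGraph (ZMod n) // IsInvariantForest m k G ∧ ¬ HasStepEdge m G} =
      Nat.card (CentralData m e) := by
  have hm := step_pos hn
  have hmZ : (0 : ℤ) < m := by omega
  have hlt (q : CentralData m e) : ∀ p ∈ q.1.2, p.1 < p.2 ∧ p.2 < m := fun p hp => by
    have := q.2.2.1.le p hp
    exact ⟨q.2.2.1.lt p hp, by omega⟩
  have hle (q : CentralData m e) : ∀ p ∈ q.1.2, p.1 < p.2 ∧ p.2 ≤ m := fun p hp =>
    ⟨(hlt q p hp).1, (hlt q p hp).2.le⟩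
  let f : CentralData m e →
      {G : SimpleGraph (ZMod n) // IsInvariantForest m k G ∧ ¬ HasStepEdge m G} := fun q =>
    ⟨periodicGraph m (-q.1.1) q.1.2, by
      refine ⟨⟨(forest_iff_isLineForest ((-q.1.1 : ℤ) : ZMod n) hkn).2 ?_,
        periodicGraph_shiftInvariant _ _ _⟩, ?_⟩
      · rw [lineEdges_periodicGraph hn hd (hlt q), he]
        have := isLineForest_repeatEdges (d := d) hm q.2.2.1
        rwa [q.2.2.2.2, ← hn] at this
      · rintro ⟨x, hx⟩
        obtain ⟨i, rfl⟩ := ZMod.intCast_surjective x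
        rw [← Int.cast_natCast m, ← Int.cast_add,
          periodicGraph_adj_iff hn hd (hle q) (by omega) (by omega)] at hx
        obtain ⟨p, hp, t, h1, h2⟩ := hx
        have := hlt q p hp
        omega⟩
  refine (Nat.card_congr (Equiv.ofBijective f ⟨?_, ?_⟩)).symm
  · have key (q q' : CentralData m e) (hq : f q = f q') : q'.1.1 ≤ q.1.1 := by
      have hq' := congrArg Subtype.val hq
      simp only [f] at hq'
      by_contra! hlt'
      refine not_shortCovered_periodicGraph (b := -q.1.1) hn hd (hlt q) ?_
      rw [hq', show (-(q.1.1 : ℤ) - 1) = -q'.1.1 + (q'.1.1 - 1 - q.1.1 : ℕ) by omega]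
      exact shortCovered_periodicGraph_of_covered hn hd (hlt q')
        (q'.2.2.2.1 _ (by omega))
    intro q q' hq
    have h1 : q.1.1 = q'.1.1 := le_antisymm (key q' q hq.symm) (key q q' hq)
    have hq' := congrArg Subtype.val hq
    simp only [f] at hq'
    refine Subtype.ext (Prod.ext h1 ?_)
    have sub (q q' : CentralData m e) (h1 : q.1.1 = q'.1.1)
        (hq : (periodicGraph m (-q.1.1) q.1.2 : SimpleGraph (ZMod n)) =
          periodicGraph m (-q'.1.1) q'.1.2) : ∀ p ∈ q.1.2, p ∈ q'.1.2 := by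
      rintro ⟨i, j⟩ hp
      have := hlt q _ hp
      rw [mem_iff_periodicGraph_adj (n := n) (b := -q.1.1) hn hd (hle q) this.1 this.2.le,
        hq, h1] at hp
      rwa [mem_iff_periodicGraph_adj (n := n) (b := -q'.1.1) hn hd (hle q') this.1 this.2.le]
    exact Finset.Subset.antisymm (sub q q' h1 hq') (sub q' q h1.symm hq'.symm)
  · rintro ⟨G, hG, hS⟩
    obtain ⟨h, E, h1, h2, h3, h4, h5⟩ := exists_centralData hn hd hkn hG hS
    refine ⟨⟨(h, E), h1, h2, h3, ?_⟩, Subtype.ext h5.symm⟩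
    rw [he] at h4
    exact Nat.eq_of_mul_eq_mul_left (by omega) h4

end Central

/-! ### Counting invariant forests with an edge through the centre -/

theorem IsLineForest.card_union {s : ℕ} {E E' : Finset (ℕ × ℕ)} (h : IsLineForest s E)
    (hs : ∀ p ∈ E', s ≤ p.1) : (E ∪ E').card = E.card + E'.card := by
  refine Finset.card_union_of_disjoint (Finset.disjoint_left.2 fun p hp hp' => ?_)
  have := h.le p hp
  have := h.lt p hp
  have := hs p hp'
  omega

theorem card_unshiftEdges {s : ℕ} {E : Finset (ℕ × ℕ)} (h : ∀ p ∈ E, s ≤ p.1 ∧ s ≤ p.2) :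
    (unshiftEdges s E).card = E.card := by
  rw [← card_shiftEdges s, shiftEdges_unshiftEdges h]

theorem le_of_mem_shiftEdges {s : ℕ} {E : Finset (ℕ × ℕ)} {p : ℕ × ℕ} (h : p ∈ shiftEdges s E) :
    s ≤ p.1 := by
  obtain ⟨a, b⟩ := p
  obtain ⟨c, e, -, rfl, rfl⟩ := mem_shiftEdges.1 h
  simp

section Rethread

variable {m g : ℕ} {E : Finset (ℕ × ℕ)}

/-- Two copies of the arched forest `E` sharing their edge `(0, m)`, with the circle cut open just
after the interval `[g, g + 1]` of the first copy. -/
def rethreadEdges (m g : ℕ) (E : Finset (ℕ × ℕ)) : Finset (ℕ × ℕ) :=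
  (unshiftEdges (g + 1) (E.filter fun p => g < p.1) ∪ shiftEdges (m - (g + 1)) E) ∪
    shiftEdges (2 * m - (g + 1)) (E.filter fun p => p.2 ≤ g)

theorem mem_rethreadEdges (hlt : ∀ p ∈ E, p.1 < p.2) (hg : g < m) {i j : ℕ} :
    (i, j) ∈ rethreadEdges m g E ↔ ∃ p ∈ E, (g < p.1 ∧ i + (g + 1) = p.1 ∧ j + (g + 1) = p.2) ∨
      (i + (g + 1) = p.1 + m ∧ j + (g + 1) = p.2 + m) ∨
      (p.2 ≤ g ∧ i + (g + 1) = p.1 + 2 * m ∧ j + (g + 1) = p.2 + 2 * m) := by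
  simp only [rethreadEdges, Finset.mem_union, mem_unshiftEdges, mem_shiftEdges, Finset.mem_filter]
  constructor
  · rintro ((⟨a, b, ⟨h1, h2⟩, rfl, rfl⟩ | ⟨a, b, h1, rfl, rfl⟩) | ⟨a, b, ⟨h1, h2⟩, rfl, rfl⟩)
    · refine ⟨(a, b), h1, ?_⟩
      have := hlt _ h1
      simp only at h2 this ⊢
      omega
    · exact ⟨(a, b), h1, by simp only; omega⟩
    · exact ⟨(a, b), h1, by simp only at h2 ⊢; omega⟩
  · rintro ⟨⟨a, b⟩, h1, h2⟩
    simp only at h2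
    rcases h2 with h2 | h2 | h2
    · exact Or.inl (Or.inl ⟨a, b, ⟨h1, h2.1⟩, by omega, by omega⟩)
    · exact Or.inl (Or.inr ⟨a, b, h1, by omega, by omega⟩)
    · exact Or.inr ⟨a, b, ⟨h1, h2.1⟩, by omega, by omega⟩

/-- The interval `[g, g + 1]` is chosen directly below the edge `(0, m)`, so that cutting there
cuts no other edge. -/
theorem isLineForest_rethreadEdges (h : IsLineForest m E) (hm : (0, m) ∈ E) (hg : g < m)
    (hgap : ∀ q ∈ E, q.1 ≤ g → g < q.2 → q = (0, m)) :
    IsLineForest (2 * m - 1) (rethreadEdges m g E) ∧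
      (rethreadEdges m g E).card + 1 = 2 * E.card := by
  have h1 : IsLineForest (m - (g + 1)) (unshiftEdges (g + 1) (E.filter fun p => g < p.1)) := by
    apply IsLineForest.unshift
    · exact h.subset (Finset.filter_subset _ _) fun p hp => by
        have := h.le p (Finset.mem_filter.1 hp).1
        omega
    · intro p hp
      have := (Finset.mem_filter.1 hp).2
      omega
  have h2 : IsLineForest (2 * m - (g + 1)) (shiftEdges (m - (g + 1)) E) := by
    have := h.shift (m - (g + 1))
    rwa [show m + (m - (g + 1)) = 2 * m - (g + 1) by omega] at this
  have h12 := h1.union h2 (fun p hp => le_of_mem_shiftEdges hp) (by omega)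
  have h3 : IsLineForest (2 * m - 1)
      (shiftEdges (2 * m - (g + 1)) (E.filter fun p => p.2 ≤ g)) := by
    have := (h.subset (M := g) (E' := E.filter fun p => p.2 ≤ g) (Finset.filter_subset _ _)
      (by simp)).shift (2 * m - (g + 1))
    rwa [show g + (2 * m - (g + 1)) = 2 * m - 1 by omega] at this
  refine ⟨h12.union h3 (fun p hp => le_of_mem_shiftEdges hp) (by omega), ?_⟩
  have hsplit :
      E.card = (E.filter fun p => g < p.1).card + (E.filter fun p => p.2 ≤ g).card + 1 := by
    rw [← Finset.card_erase_add_one hm, ← Finset.card_union_of_disjoint, ← Finset.filter_or]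
    · congr 2
      ext ⟨a, b⟩
      simp only [Finset.mem_erase, Finset.mem_filter]
      constructor
      · rintro ⟨h4, h5⟩
        refine ⟨h5, ?_⟩
        by_contra hcon
        exact h4 (hgap _ h5 (by simp only; omega) (by simp only; omega))
      · rintro ⟨h5, h6⟩
        refine ⟨?_, h5⟩
        rintro h7
        simp only [Prod.mk.injEq] at h7
        omega
    · rw [Finset.disjoint_left]
      intro p hp hp'
      have := h.lt p (Finset.mem_filter.1 hp).1
      have := (Finset.mem_filter.1 hp).2
      have := (Finset.mem_filter.1 hp').2
      omega
  rw [rethreadEdges, h12.card_union fun p hp => le_of_mem_shiftEdges hp,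
    h1.card_union fun p hp => le_of_mem_shiftEdges hp, card_shiftEdges, card_shiftEdges,
    card_unshiftEdges]
  · omega
  · intro p hp
    have := h.lt p (Finset.mem_filter.1 hp).1
    have := (Finset.mem_filter.1 hp).2
    omega

end Rethread

section Diameter

variable {n : ℕ} [NeZero n] {m : ℕ}

theorem lineEdges_periodicGraph_arched (hn : n = 2 * m) {a : ℤ} {g : ℕ} {E : Finset (ℕ × ℕ)}
    (h : IsLineForest m E) (hg : g < m)
    (hgap : ∀ q ∈ E, q.1 ≤ g → g < q.2 → q = (0, m)) :
    lineEdges (periodicGraph m a E : SimpleGraph (ZMod n)) ((a + g + 1 : ℤ) : ZMod n) =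
      rethreadEdges m g E := by
  have hE : ∀ p ∈ E, p.1 < p.2 ∧ p.2 ≤ m := fun p hp => ⟨h.lt p hp, h.le p hp⟩
  have hmZ : (0 : ℤ) < m := by omega
  ext ⟨i, j⟩
  rw [mem_lineEdges, mem_rethreadEdges h.lt hg]
  have e (x : ℕ) : ((a + g + 1 : ℤ) : ZMod n) + x = ((a + g + 1 + x : ℤ) : ZMod n) := by
    push_cast; ring
  rw [e, e]
  constructor
  · rintro ⟨hij, hj, hadj⟩
    rcases periodicGraph_adj_cases hn le_rfl hE (by omega) (by omega) hadj with h1 | h1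
    · obtain ⟨p, hp, t, h2, h3⟩ := (periodicGraph_adj_iff hn le_rfl hE (by omega) h1).1 hadj
      have := hE p hp
      refine ⟨p, hp, ?_⟩
      have ht0 : 0 ≤ t := by
        by_contra hcon
        have : t * (m : ℤ) ≤ (-1) * m := mul_le_mul_of_nonneg_right (by omega) hmZ.le
        omega
      have ht3 : t < 3 := by
        by_contra hcon
        have : 3 * (m : ℤ) ≤ t * m := mul_le_mul_of_nonneg_right (by omega) hmZ.le
        omega
      interval_cases t <;> omega
    · by_cases hlt : (n : ℤ) - (j - i) < m
      · have h' := (adj_add_n_right (G := periodicGraph m a E) (a + g + 1 + j : ℤ)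
          (a + g + 1 + i : ℤ)).2 hadj.symm
        obtain ⟨p, hp, t, h2, h3⟩ :=
          (periodicGraph_adj_iff hn le_rfl hE (by omega) (by omega)).1 h'
        have := hE p hp
        have ht : t = 2 := by
          by_contra hne
          rcases lt_or_gt_of_ne hne with ht | ht
          · have : t * (m : ℤ) ≤ 1 * m := mul_le_mul_of_nonneg_right (by omega) hmZ.le
            omega
          · have : 3 * (m : ℤ) ≤ t * m := mul_le_mul_of_nonneg_right (by omega) hmZ.le
            omega
        subst ht
        have := hgap p hp (by omega) (by omega)
        rw [this] at h2 h3
        simp only at h2 h3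
        omega
      · obtain ⟨p, hp, t, h2, h3⟩ :=
          (periodicGraph_adj_iff hn le_rfl hE (by omega) (by omega)).1 hadj
        have := hE p hp
        refine ⟨p, hp, ?_⟩
        have ht0 : 0 ≤ t := by
          by_contra hcon
          have : t * (m : ℤ) ≤ (-1) * m := mul_le_mul_of_nonneg_right (by omega) hmZ.le
          omega
        have ht3 : t < 3 := by
          by_contra hcon
          have : 3 * (m : ℤ) ≤ t * m := mul_le_mul_of_nonneg_right (by omega) hmZ.le
          omega
        interval_cases t <;> omega
  · rintro ⟨p, hp, h1⟩
    have := hE p hp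
    refine ⟨by omega, by omega, ?_⟩
    rw [periodicGraph_adj_iff hn le_rfl hE (by omega) (by omega)]
    rcases h1 with h1 | h1 | h1
    · exact ⟨p, hp, 0, by omega, by omega⟩
    · exact ⟨p, hp, 1, by omega, by omega⟩
    · exact ⟨p, hp, 2, by omega, by omega⟩

/-- The parameters of an invariant forest with a central edge: one end `a` of that edge and the
forest on the vertices `a, …, a + m`. -/
abbrev DiameterData (m e : ℕ) : Type :=
  {q : ℕ × Finset (ℕ × ℕ) // q.1 < m ∧ IsLineForest m q.2 ∧ (0, m) ∈ q.2 ∧ q.2.card = e}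

theorem card_diameterData (m e : ℕ) :
    (Nat.card (DiameterData m e) : ℤ) = m * (archedPoly m).coeff e := by
  classical
  have h1 : Nat.card (DiameterData m e) = (Finset.range m ×ˢ
      (archedForests m).filter fun E => E.card = e).card := by
    refine Nat.subtype_card _ fun q => ?_
    simp only [Finset.mem_filter, Finset.mem_product, Finset.mem_range, mem_archedForests]
    tauto
  rw [h1, Finset.card_product, Finset.card_range, Finset.card_filter, archedPoly,
    Polynomial.finsetSum_coeff, Nat.cast_mul, Nat.cast_sum]
  congr 1
  refine Finset.sum_congr rfl fun E _ => ?_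
  rw [Polynomial.coeff_X_pow]
  simp [eq_comm]

theorem isInvariantForest_periodicGraph_arched (hn : n = 2 * m) {k : ℕ} (hkn : k ≤ n) (a : ℤ)
    {E : Finset (ℕ × ℕ)} (h : IsLineForest m E) (h0 : (0, m) ∈ E)
    (hcard : 2 * E.card = n - k + 1) :
    IsInvariantForest m k (periodicGraph m a E : SimpleGraph (ZMod n)) := by
  obtain ⟨g, -, hg, hgap⟩ := h.gap _ h0
  have hgap' : ∀ q ∈ E, q.1 ≤ g → g < q.2 → q = (0, m) := by
    intro q hq h1 h2
    have h3 := hgap q hq h1 h2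
    have h4 := h.le q hq
    exact Prod.ext (by simpa using h3.1) (le_antisymm h4 h3.2)
  have h5 := isLineForest_rethreadEdges h h0 hg hgap'
  refine ⟨(forest_iff_isLineForest ((a + g + 1 : ℤ) : ZMod n) hkn).2 ?_,
    periodicGraph_shiftInvariant _ _ _⟩
  rw [lineEdges_periodicGraph_arched hn h hg hgap']
  exact ⟨by rw [hn]; exact h5.1, by omega⟩

/-- An edge through the centre is a diameter, and the two halves of an invariant forest are rotated
copies of an arched forest having the diameter as its longest edge. -/
theorem exists_diameterData (hn : n = 2 * m) {k : ℕ} (hkn : k ≤ n)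
    {G : SimpleGraph (ZMod n)} (hG : IsInvariantForest m k G) (hS : HasStepEdge m G) :
    ∃ (a : ℕ) (E : Finset (ℕ × ℕ)), a < m ∧ IsLineForest m E ∧ (0, m) ∈ E ∧
      2 * E.card = n - k + 1 ∧ G = periodicGraph m a E := by
  classical
  have hm := step_pos hn
  have hmZ : (0 : ℤ) < m := by omega
  obtain ⟨⟨hNC, hA, hk⟩, hI⟩ := hG
  obtain ⟨x, hx⟩ := hS
  obtain ⟨i, rfl⟩ := ZMod.intCast_surjective x
  have e1 := Int.emod_nonneg i hmZ.ne'
  have e2 := Int.emod_lt_of_pos i hmZ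
  have e3 := Int.mul_ediv_add_emod i m
  rw [mul_comm] at e3
  obtain ⟨a, ha⟩ := Int.eq_ofNat_of_zero_le e1
  rw [ha] at e2 e3
  have hdiam : G.Adj ((a : ℤ) : ZMod n) ((a + m : ℤ) : ZMod n) := by
    have := (hI.adj_add_mul a (a + m) (i / m)).1 (by
      rw [show (a : ℤ) + i / m * m = i by omega, show (a : ℤ) + m + i / m * m = i + m by omega]
      simpa using hx)
    exact this
  have hdiam2 : G.Adj ((a + m : ℤ) : ZMod n) ((a + m + m : ℤ) : ZMod n) := by
    have := (hI.adj_add_mul a (a + m) 1).2 hdiam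
    simpa using this
  have hLF := isLineForest_lineEdges hNC hA ((a : ℤ) : ZMod n)
  set E := (lineEdges G ((a : ℤ) : ZMod n)).filter fun p => p.2 ≤ m with hE
  have hEF : IsLineForest m E := hLF.subset (Finset.filter_subset _ _) fun p hp =>
    (Finset.mem_filter.1 hp).2
  have h0 : (0, m) ∈ E := by
    have := (mem_lineEdges_sub (c := a) le_rfl (by omega) (by omega)).2 hdiam
    rw [hE, Finset.mem_filter]
    simpa using this
  have heq : G = periodicGraph m a E := by
    ext x y
    constructor
    · intro h
      obtain ⟨i, j, hij, hlen, hxy⟩ := exists_lift h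
      have hadj : G.Adj (i : ZMod n) (j : ZMod n) := by
        rcases hxy with ⟨rfl, rfl⟩ | ⟨rfl, rfl⟩
        exacts [h, h.symm]
      have hle := hI.length_le hn le_rfl hNC hlen hadj
      have f1 := Int.emod_nonneg (i - a) hmZ.ne'
      have f2 := Int.emod_lt_of_pos (i - a) hmZ
      have f3 := Int.mul_ediv_add_emod (i - a) m
      set t := (i - a) / m
      rw [mul_comm] at f3
      have hadj' := (hI.adj_add_mul i j (-t)).2 hadj
      rw [neg_mul] at hadj'
      have hj : j + -(t * m) ≤ a + m := by
        by_contra hcon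
        exact hNC.not_interleaved (i := i + -(t * m)) (k := a + m) (j := j + -(t * m))
          (l := a + m + m) (by omega) (by omega) (by omega) (by omega) hadj' hdiam2
      have hmem := (mem_lineEdges_sub (c := a) (by omega) (by omega) (by omega)).2 hadj'
      refine ⟨h.ne, _, Finset.mem_filter.2 ⟨hmem, by simp only; omega⟩, t, ?_⟩
      simp only
      rw [Int.toNat_of_nonneg (by omega), Int.toNat_of_nonneg (by omega),
        show a + (i + -(t * m) - a) + t * m = i by ring,
        show a + (j + -(t * m) - a) + t * m = j by ring]
      rcases hxy with hxy | hxy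
      exacts [Or.inl hxy, Or.inr hxy.symm]
    · refine periodicGraph_le hI ?_
      rintro ⟨i, j⟩ hp
      have := (mem_lineEdges.1 (Finset.mem_filter.1 hp).1).2.2
      simpa using this
  refine ⟨a, E, by omega, hEF, h0, ?_, heq⟩
  obtain ⟨g, -, hg, hgap⟩ := hEF.gap _ h0
  have hgap' : ∀ q ∈ E, q.1 ≤ g → g < q.2 → q = (0, m) := by
    intro q hq h1 h2
    have h3 := hgap q hq h1 h2
    have h4 := hEF.le q hq
    exact Prod.ext (by simpa using h3.1) (le_antisymm h4 h3.2)
  have h1 := ((forest_iff_isLineForest ((a + g + 1 : ℤ) : ZMod n) hkn).1 ⟨hNC, hA, hk⟩).2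
  rw [heq, lineEdges_periodicGraph_arched hn hEF hg hgap'] at h1
  rw [← h1, ← (isLineForest_rethreadEdges hEF h0 hg hgap').2]

/-- The parameters are unique, since two diameters would cross. -/
theorem card_invariant_diameter (hn : n = 2 * m) {k e : ℕ} (hkn : k ≤ n)
    (he : 2 * e = n - k + 1) :
    Nat.card {G : SimpleGraph (ZMod n) // IsInvariantForest m k G ∧ HasStepEdge m G} =
      Nat.card (DiameterData m e) := by
  have hm := step_pos hn
  have hle (q : DiameterData m e) : ∀ p ∈ q.1.2, p.1 < p.2 ∧ p.2 ≤ m := fun p hp =>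
    ⟨q.2.2.1.lt p hp, q.2.2.1.le p hp⟩
  have hdiam (q : DiameterData m e) : (periodicGraph m q.1.1 q.1.2 : SimpleGraph (ZMod n)).Adj
      ((q.1.1 : ℤ) : ZMod n) ((q.1.1 + m : ℤ) : ZMod n) := by
    have := (mem_iff_periodicGraph_adj (n := n) (b := q.1.1) hn le_rfl (hle q) hm le_rfl).1
      q.2.2.2.1
    simpa using this
  let f : DiameterData m e →
      {G : SimpleGraph (ZMod n) // IsInvariantForest m k G ∧ HasStepEdge m G} := fun q =>
    ⟨periodicGraph m q.1.1 q.1.2, isInvariantForest_periodicGraph_arched hn hkn _ q.2.2.1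
      q.2.2.2.1 (by rw [q.2.2.2.2, he]), ⟨_, by simpa using hdiam q⟩⟩
  refine (Nat.card_congr (Equiv.ofBijective f ⟨?_, ?_⟩)).symm
  · have key (q q' : DiameterData m e) (hq : f q = f q') : q'.1.1 ≤ q.1.1 := by
      have hq' := congrArg Subtype.val hq
      simp only [f] at hq'
      by_contra! hlt'
      have h1 := hdiam q
      have h2 := hdiam q'
      have h3 := q'.2.1
      rw [← hq'] at h2
      exact (f q).2.1.1.1.not_interleaved (by omega) (by omega) (by omega) (by omega) h1 h2
    intro q q' hq
    have h1 : q.1.1 = q'.1.1 := le_antisymm (key q' q hq.symm) (key q q' hq)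
    have hq' := congrArg Subtype.val hq
    simp only [f] at hq'
    refine Subtype.ext (Prod.ext h1 ?_)
    have sub (q q' : DiameterData m e) (h1 : q.1.1 = q'.1.1)
        (hq : (periodicGraph m q.1.1 q.1.2 : SimpleGraph (ZMod n)) =
          periodicGraph m q'.1.1 q'.1.2) : ∀ p ∈ q.1.2, p ∈ q'.1.2 := by
      rintro ⟨i, j⟩ hp
      have := hle q _ hp
      rw [mem_iff_periodicGraph_adj (n := n) (b := q.1.1) hn le_rfl (hle q) this.1 this.2,
        hq, h1] at hp
      rwa [mem_iff_periodicGraph_adj (n := n) (b := q'.1.1) hn le_rfl (hle q') this.1 this.2]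
    exact Finset.Subset.antisymm (sub q q' h1 hq') (sub q' q h1.symm hq'.symm)
  · rintro ⟨G, hG, hS⟩
    obtain ⟨a, E, h1, h2, h3, h4, h5⟩ := exists_diameterData hn hkn hG hS
    exact ⟨⟨(a, E), h1, h2, h3, by simp only; omega⟩, Subtype.ext h5.symm⟩

end Diameter

/-! ### The number of fixed points of a rotation -/

section Fixed

variable {n : ℕ}

theorem RotationGroup.apply_eq (c : RotationGroup n) (x : ZMod n) : c.1 x = x + c.1 0 := by
  obtain ⟨c, z, rfl⟩ := c
  change (vertexRotation n ^ z) x = x + (vertexRotation n ^ z) 0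
  rw [vertexRotation_zpow_apply, vertexRotation_zpow_apply, zero_add]

theorem RotationGroup.orderOf_eq (c : RotationGroup n) : orderOf c = addOrderOf (c.1 0) := by
  have hpow (j : ℕ) (x : ZMod n) : (c ^ j).1 x = x + j • c.1 0 := by
    induction j generalizing x with
    | zero => simp
    | succ j ih =>
      rw [pow_succ]
      change (c ^ j).1 (c.1 x) = _
      rw [ih, c.apply_eq, succ_nsmul]
      ring
  refine Nat.dvd_antisymm (orderOf_dvd_of_pow_eq_one ?_) (addOrderOf_dvd_of_nsmul_eq_zero ?_)
  · ext x
    rw [hpow, addOrderOf_nsmul_eq_zero, add_zero]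
    rfl
  · have := hpow (orderOf c) 0
    rw [pow_orderOf_eq_one, zero_add] at this
    exact this.symm

variable [NeZero n]

theorem smul_eq_iff {k : ℕ} (c : RotationGroup n) (F : NoncrossingForest n k) :
    c • F = F ↔ ∀ x y, F.1.Adj (x + c.1 0) (y + c.1 0) ↔ F.1.Adj x y := by
  have hmap (x y : ZMod n) : (F.1.map c.1).Adj (x + c.1 0) (y + c.1 0) ↔ F.1.Adj x y := by
    rw [← c.apply_eq, ← c.apply_eq]
    exact (SimpleGraph.Iso.map c.1 F.1).map_adj_iff
  have hval : (c • F).1 = F.1.map c.1 := rfl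
  constructor
  · intro h x y
    rw [← hmap x y, ← hval, h]
  · intro h
    refine Subtype.ext ?_
    rw [hval]
    ext x y
    have h1 := hmap (x - c.1 0) (y - c.1 0)
    have h2 := h (x - c.1 0) (y - c.1 0)
    rw [sub_add_cancel, sub_add_cancel] at h1 h2
    rw [h1, h2]

theorem adj_add_zsmul_iff {n : ℕ} {G : SimpleGraph (ZMod n)} {s : ZMod n}
    (h : ∀ x y, G.Adj (x + s) (y + s) ↔ G.Adj x y) (t : ℤ) :
    ∀ x y, G.Adj (x + t * s) (y + t * s) ↔ G.Adj x y := by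
  induction t using Int.induction_on with
  | zero => simp
  | succ t ih =>
    intro x y
    rw [← ih x y, ← h (x + ((t : ℤ) : ZMod n) * s)]
    push_cast
    simp only [add_mul, one_mul, add_assoc]
  | pred t ih =>
    intro x y
    rw [← ih x y, ← h (x + _) (y + _)]
    push_cast
    simp only [sub_mul, one_mul, add_assoc, sub_add_cancel]

/-- A rotation of order `d` generates the same group as the rotation by `n / d` steps. -/
theorem smul_eq_iff_shiftInvariant {k d m : ℕ} (hn : n = d * m) (c : RotationGroup n)
    (hd : orderOf c = d) (F : NoncrossingForest n k) : c • F = F ↔ ShiftInvariant m F.1 := by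
  have hgcd : n.gcd (c.1 0).val = m := by
    have h1 := c.orderOf_eq
    rw [hd, ← ZMod.natCast_zmod_val (c.1 0), ZMod.addOrderOf_coe _ (NeZero.ne n)] at h1
    have h2 := Nat.div_mul_cancel (Nat.gcd_dvd_left n (c.1 0).val)
    rw [← h1] at h2
    have hd0 : 0 < d := Nat.pos_of_ne_zero (by rintro rfl; exact NeZero.ne n (by simpa using hn))
    exact Nat.eq_of_mul_eq_mul_left hd0 (h2.trans hn)
  rw [smul_eq_iff]
  constructor
  · intro h x y
    have h1 : (m : ZMod n) = (n.gcdB (c.1 0).val : ℤ) * c.1 0 := by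
      have h2 := congrArg (Int.cast (R := ZMod n)) (Nat.gcd_eq_gcd_ab n (c.1 0).val)
      rw [hgcd] at h2
      push_cast at h2
      rw [ZMod.natCast_self, zero_mul, zero_add, ZMod.natCast_zmod_val] at h2
      rw [h2, mul_comm]
    rw [h1]
    exact adj_add_zsmul_iff h _ x y
  · intro h
    obtain ⟨s, hs⟩ := Nat.gcd_dvd_right n (c.1 0).val
    rw [hgcd] at hs
    have h1 : c.1 0 = ((s : ℤ) : ZMod n) * (m : ZMod n) := by
      rw [← ZMod.natCast_zmod_val (c.1 0), hs]
      push_cast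
      ring
    rw [h1]
    exact adj_add_zsmul_iff h s

/-- The number of fixed points of a rotation depends on its order only. -/
theorem card_fixed_eq {k d m : ℕ} (hn : n = d * m) (c : RotationGroup n) (hd : orderOf c = d) :
    Nat.card {F : NoncrossingForest n k // c • F = F} =
      Nat.card {G : SimpleGraph (ZMod n) // IsInvariantForest m k G} := by
  refine Nat.card_congr
    { toFun := fun F => ⟨F.1.1, F.1.2, (smul_eq_iff_shiftInvariant hn c hd F.1).1 F.2⟩
      invFun := fun G => ⟨⟨G.1, G.2.1⟩, (smul_eq_iff_shiftInvariant hn c hd _).2 G.2.2⟩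
      left_inv := fun _ => rfl
      right_inv := fun _ => rfl }

theorem card_invariant_self {k : ℕ} (hkn : k ≤ n) :
    (Nat.card {G : SimpleGraph (ZMod n) // IsInvariantForest n k G} : ℤ) =
      (forestPoly (n - 1)).coeff (n - k) := by
  classical
  have hI (G : SimpleGraph (ZMod n)) : ShiftInvariant n G := fun x y => by simp
  let f : {G : SimpleGraph (ZMod n) // IsInvariantForest n k G} →
      {E : Finset (ℕ × ℕ) // IsLineForest (n - 1) E ∧ E.card = n - k} := fun G =>
    ⟨lineEdges G.1 0, (forest_iff_isLineForest 0 hkn).1 G.2.1⟩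
  have hf : Function.Bijective f := by
    constructor
    · intro G G' h
      exact Subtype.ext (lineEdges_injective 0 (congrArg Subtype.val h))
    · rintro ⟨E, hE⟩
      have h1 : lineEdges (circleGraph (0 : ZMod n) E) 0 = E :=
        lineEdges_circleGraph 0 hE.1.lt fun p hp => by
          have := hE.1.le p hp
          have := NeZero.pos n
          omega
      exact ⟨⟨circleGraph 0 E, (forest_iff_isLineForest 0 hkn).2 (by rwa [h1]), hI _⟩,
        Subtype.ext h1⟩
  rw [Nat.card_congr (Equiv.ofBijective f hf)]
  have h1 : Nat.card {E : Finset (ℕ × ℕ) // IsLineForest (n - 1) E ∧ E.card = n - k} =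
      ((lineForests (n - 1)).filter fun E => E.card = n - k).card := by
    refine Nat.subtype_card _ fun q => ?_
    simp only [Finset.mem_filter, mem_lineForests]
  rw [h1, Finset.card_filter, forestPoly, Polynomial.finsetSum_coeff, Nat.cast_sum]
  refine Finset.sum_congr rfl fun E _ => ?_
  rw [Polynomial.coeff_X_pow]
  simp [eq_comm]

theorem card_subtype_eq_left {α : Type*} {p q : α → Prop} (h : ∀ a, p a → q a) :
    Nat.card {a // p a} = Nat.card {a // p a ∧ q a} :=
  Nat.card_congr (Equiv.subtypeEquivRight fun a => ⟨fun ha => ⟨ha, h a ha⟩, fun ha => ha.1⟩)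

variable {k d m : ℕ}

theorem card_invariant_of_dvd (hn : n = d * m) (hd : 2 ≤ d) (hkn : k ≤ n) {e : ℕ}
    (he : n - k = d * e) :
    (Nat.card {G : SimpleGraph (ZMod n) // IsInvariantForest m k G} : ℤ) =
      (m - 1).choose e * ((m - 1 + 2 * e).choose e - intChoose (m - 1 + 2 * e) ((e : ℤ) - 1)) := by
  have hS (G : SimpleGraph (ZMod n)) (hG : IsInvariantForest m k G) : ¬ HasStepEdge m G := by
    rcases hd.eq_or_lt with rfl | hd
    · intro hS
      obtain ⟨a, E, -, -, -, h, -⟩ := exists_diameterData hn hkn hG hS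
      omega
    · exact hG.2.not_hasStepEdge hn hd hG.1.1 hG.1.2.1
  rw [card_subtype_eq_left hS, card_invariant_central hn hd hkn he, card_centralData (step_pos hn),
    coeff_prefixPoly]

theorem card_invariant_two_of_odd (hn : n = 2 * m) (hkn : k ≤ n) {e : ℕ}
    (he : n - k = 2 * e + 1) :
    (Nat.card {G : SimpleGraph (ZMod n) // IsInvariantForest m k G} : ℤ) =
      m.choose (e + 1) * (m + 2 * e).choose e := by
  have hm := step_pos hn
  have hS (G : SimpleGraph (ZMod n)) (hG : IsInvariantForest m k G) : HasStepEdge m G := by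
    by_contra hS
    obtain ⟨a, E, -, -, -, h, -⟩ := exists_centralData hn le_rfl hkn hG hS
    omega
  obtain ⟨N, rfl⟩ := Nat.exists_eq_add_of_le' hm
  rw [card_subtype_eq_left hS, card_invariant_diameter hn hkn (e := e + 1) (by omega),
    card_diameterData]
  have := succ_mul_coeff_archedPoly N e
  push_cast at *
  exact this

theorem card_invariant_of_not_dvd (hn : n = d * m) (hd : 3 ≤ d) (hkn : k ≤ n)
    (he : ¬ d ∣ n - k) :
    Nat.card {G : SimpleGraph (ZMod n) // IsInvariantForest m k G} = 0 := by
  have : IsEmpty {G : SimpleGraph (ZMod n) // IsInvariantForest m k G} := by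
    refine ⟨fun ⟨G, hG⟩ => ?_⟩
    obtain ⟨a, E, -, -, -, h, -⟩ := exists_centralData hn (by omega) hkn hG
      (hG.2.not_hasStepEdge hn hd hG.1.1 hG.1.2.1)
    exact he ⟨_, h.symm⟩
  exact Nat.card_of_isEmpty

end Fixed

/-! ### Gaussian binomial coefficients -/

section Gaussian

open Polynomial

/-- The `q`-integer `[m]` as a polynomial. -/
noncomputable def qNat (m : ℕ) : ℤ[X] := ∑ i ∈ Finset.range m, X ^ i

/-- The `q`-factorial `[m]!` as a polynomial. -/
noncomputable def qNatFactorial (m : ℕ) : ℤ[X] := ∏ i ∈ Finset.range m, qNat (i + 1)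

/-- The Gaussian binomial coefficient, defined by the `q`-Pascal recursion. -/
noncomputable def gaussBinom : ℕ → ℕ → ℤ[X]
  | _, 0 => 1
  | 0, _ + 1 => 0
  | n + 1, k + 1 => gaussBinom n k + X ^ (k + 1) * gaussBinom n (k + 1)

/-- The Gaussian binomial coefficient with lower index `k - 1`, which is zero for `k = 0`. -/
noncomputable def gaussBinomPred (n : ℕ) : ℕ → ℤ[X]
  | 0 => 0
  | k + 1 => gaussBinom n k

theorem gaussBinom_zero_right (n : ℕ) : gaussBinom n 0 = 1 := by
  cases n <;> rw [gaussBinom]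

theorem gaussBinom_zero_succ (k : ℕ) : gaussBinom 0 (k + 1) = 0 := by
  rw [gaussBinom]

theorem gaussBinom_succ_succ (n k : ℕ) :
    gaussBinom (n + 1) (k + 1) = gaussBinom n k + X ^ (k + 1) * gaussBinom n (k + 1) := by
  rw [gaussBinom]

theorem gaussBinom_eq_zero {n k : ℕ} (h : n < k) : gaussBinom n k = 0 := by
  induction n generalizing k with
  | zero =>
    obtain ⟨k, rfl⟩ := Nat.exists_eq_succ_of_ne_zero h.ne'
    exact gaussBinom_zero_succ k
  | succ n ih =>
    obtain ⟨k, rfl⟩ := Nat.exists_eq_succ_of_ne_zero (Nat.ne_zero_of_lt h)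
    rw [Nat.succ_eq_add_one, gaussBinom_succ_succ, ih (by omega), ih (by omega), mul_zero, add_zero]

theorem gaussBinom_self (n : ℕ) : gaussBinom n n = 1 := by
  induction n with
  | zero => exact gaussBinom_zero_right 0
  | succ n ih =>
    rw [gaussBinom_succ_succ, ih, gaussBinom_eq_zero n.lt_succ_self, mul_zero, add_zero]

theorem qNat_add (a b : ℕ) : qNat (a + b) = qNat a + X ^ a * qNat b := by
  simp only [qNat, Finset.sum_range_add, Finset.mul_sum, pow_add]

theorem qNat_zero : qNat 0 = 0 := by simp [qNat]

theorem qNat_one : qNat 1 = 1 := by simp [qNat]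

theorem qNat_eval_one (m : ℕ) : (qNat m).eval 1 = m := by
  simp [qNat, eval_finsetSum]

theorem qNat_ne_zero {m : ℕ} (h : m ≠ 0) : qNat m ≠ 0 := by
  intro h0
  have := qNat_eval_one m
  rw [h0, eval_zero] at this
  exact h (by exact_mod_cast this.symm)

theorem qNatFactorial_succ (m : ℕ) :
    qNatFactorial (m + 1) = qNatFactorial m * qNat (m + 1) := by
  rw [qNatFactorial, Finset.prod_range_succ, ← qNatFactorial]

theorem qNatFactorial_ne_zero (m : ℕ) : qNatFactorial m ≠ 0 :=
  Finset.prod_ne_zero_iff.2 fun _ _ => qNat_ne_zero (Nat.succ_ne_zero _)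

theorem gaussBinom_mul_factorial (k j : ℕ) :
    gaussBinom (k + j) k * (qNatFactorial k * qNatFactorial j) = qNatFactorial (k + j) := by
  have key (N : ℕ) : ∀ k j, k + j = N →
      gaussBinom (k + j) k * (qNatFactorial k * qNatFactorial j) = qNatFactorial (k + j) := by
    induction N with
    | zero =>
      intro k j h
      obtain ⟨rfl, rfl⟩ : k = 0 ∧ j = 0 := by omega
      simp [gaussBinom_zero_right, qNatFactorial]
    | succ N ih =>
      intro k j h
      rcases k with _ | k
      · simp [gaussBinom_zero_right, qNatFactorial]
      rcases j with _ | j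
      · simp [gaussBinom_self, qNatFactorial]
      have h1 := ih k (j + 1) (by omega)
      have h2 := ih (k + 1) j (by omega)
      have h3 : k + 1 + j = k + (j + 1) := by omega
      rw [h3] at h2
      have h4 : k + 1 + (j + 1) = k + (j + 1) + 1 := by omega
      have h5 : qNat (k + (j + 1) + 1) = qNat (k + 1) + X ^ (k + 1) * qNat (j + 1) := by
        rw [← qNat_add, h4]
      rw [h4, gaussBinom_succ_succ, qNatFactorial_succ (k + (j + 1)), h5]
      rw [qNatFactorial_succ] at h1 h2
      rw [qNatFactorial_succ, qNatFactorial_succ]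
      linear_combination qNat (k + 1) * h1 + X ^ (k + 1) * qNat (j + 1) * h2
  exact key _ k j rfl

theorem gaussBinom_symm (k j : ℕ) : gaussBinom (k + j) k = gaussBinom (k + j) j := by
  refine mul_right_cancel₀ (mul_ne_zero (qNatFactorial_ne_zero k) (qNatFactorial_ne_zero j)) ?_
  rw [gaussBinom_mul_factorial, mul_comm (qNatFactorial k), add_comm k j, gaussBinom_mul_factorial]

theorem qNat_mul_gaussBinom_succ (n k : ℕ) :
    qNat (k + 1) * gaussBinom (n + 1) (k + 1) = qNat (n + 1) * gaussBinom n k := by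
  rcases le_or_gt k n with h | h
  · obtain ⟨j, rfl⟩ := Nat.exists_eq_add_of_le h
    refine mul_right_cancel₀ (mul_ne_zero (qNatFactorial_ne_zero k) (qNatFactorial_ne_zero j)) ?_
    have h1 := gaussBinom_mul_factorial k j
    have h2 := gaussBinom_mul_factorial (k + 1) j
    rw [show k + 1 + j = k + j + 1 by omega, qNatFactorial_succ, qNatFactorial_succ] at h2
    linear_combination h2 - qNat (k + j + 1) * h1
  · rw [gaussBinom_eq_zero h, gaussBinom_eq_zero (by omega), mul_zero, mul_zero]

theorem gaussBinomPred_mul_qNat (n k : ℕ) :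
    gaussBinomPred (n + 2 * k) k * qNat (n + 1 + k) = qNat k * gaussBinom (n + 2 * k) k := by
  rcases k with _ | k
  · rw [gaussBinomPred, qNat_zero, zero_mul, zero_mul]
  rw [gaussBinomPred]
  refine mul_right_cancel₀ (mul_ne_zero (qNatFactorial_ne_zero k)
    (qNatFactorial_ne_zero (n + 1 + k))) ?_
  have h1 := gaussBinom_mul_factorial k (n + 1 + k + 1)
  have h2 := gaussBinom_mul_factorial (k + 1) (n + 1 + k)
  rw [qNatFactorial_succ] at h1 h2
  rw [show n + 2 * (k + 1) = k + (n + 1 + k + 1) by omega]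
  rw [show k + 1 + (n + 1 + k) = k + (n + 1 + k + 1) by omega] at h2
  rw [show n + 1 + (k + 1) = n + 1 + k + 1 by omega]
  linear_combination h1 - h2

theorem gaussBinom_eval_one (n k : ℕ) : (gaussBinom n k).eval 1 = n.choose k := by
  induction n generalizing k with
  | zero =>
    rcases k with _ | k
    · simp [gaussBinom_zero_right]
    · simp [gaussBinom_zero_succ]
  | succ n ih =>
    rcases k with _ | k
    · simp [gaussBinom_zero_right]
    · simp [gaussBinom_succ_succ, ih, Nat.choose_succ_succ]

theorem gaussBinomPred_eval_one (n k : ℕ) :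
    (gaussBinomPred n k).eval 1 = intChoose n ((k : ℤ) - 1) := by
  rcases k with _ | k
  · rw [gaussBinomPred, eval_zero, Nat.cast_zero, intChoose_of_neg n (by norm_num)]
  · rw [gaussBinomPred, gaussBinom_eval_one, ← intChoose_natCast]
    push_cast
    rw [add_sub_cancel_right]

/-- The sieving polynomial for the forests with `e` edges on `N + 1` vertices, in a form without
division. The form is chosen so that it specializes term by term to the numbers of fixed points. -/
noncomputable def forestQPoly (N e : ℕ) : ℤ[X] :=
  gaussBinom N e * (gaussBinom (N + 2 * e) e - X ^ (N + 1) * gaussBinomPred (N + 2 * e) e) -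
    X * gaussBinom (N + 1) (e + 1) * gaussBinomPred (N + 2 * e) e

/-- The defining product formula for the sieving polynomial. It combines the identities
`[N + 1 + e] = [N + 1] + q ^ (N + 1) [e]` and `[e + 1] = 1 + q [e]`. -/
theorem forestQPoly_mul_qNat (N e : ℕ) :
    forestQPoly N e * qNat (N + 1 + e) =
      gaussBinom (N + 1) (e + 1) * gaussBinom (N + 2 * e) e := by
  have h1 := gaussBinomPred_mul_qNat N e
  have h2 := qNat_mul_gaussBinom_succ N e
  have h3 := qNat_add (N + 1) e
  have h4 := qNat_add 1 e
  rw [pow_one, qNat_one, add_comm 1 e] at h4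
  rw [h4] at h2
  rw [forestQPoly]
  linear_combination (-X ^ (N + 1) * gaussBinom N e - X * gaussBinom (N + 1) (e + 1)) * h1 +
    gaussBinom N e * gaussBinom (N + 2 * e) e * h3 - gaussBinom (N + 2 * e) e * h2

/-- At `q = 1` the sieving polynomial counts all forests. -/
theorem forestQPoly_eval_one (N e : ℕ) : (forestQPoly N e).eval 1 = (forestPoly N).coeff e := by
  rw [coeff_forestPoly, forestQPoly]
  simp only [eval_sub, eval_mul, eval_pow, eval_X, one_pow, one_mul, gaussBinom_eval_one,
    gaussBinomPred_eval_one, Nat.choose_succ_succ, intChoose_natCast]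
  push_cast
  ring

/-! ### Gaussian binomial coefficients at roots of unity -/

section RootsOfUnity

variable {ω : ℂ} {d : ℕ}

theorem sub_one_mul_aeval_qNat (ω : ℂ) (m : ℕ) : (ω - 1) * aeval ω (qNat m) = ω ^ m - 1 := by
  simp only [qNat, map_sum, map_pow, aeval_X]
  exact mul_geom_sum ω m

theorem aeval_qNat_ne_zero (hω : IsPrimitiveRoot ω d) {m : ℕ} (h : ¬ d ∣ m) :
    aeval ω (qNat m) ≠ 0 := by
  intro h0
  have := sub_one_mul_aeval_qNat ω m
  rw [h0, mul_zero] at this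
  exact h ((hω.pow_eq_one_iff_dvd m).1 (sub_eq_zero.1 this.symm))

theorem aeval_qNat_self (hω : IsPrimitiveRoot ω d) (hd : 2 ≤ d) : aeval ω (qNat d) = 0 := by
  have := sub_one_mul_aeval_qNat ω d
  rw [hω.pow_eq_one, sub_self, mul_eq_zero] at this
  exact this.resolve_left (sub_ne_zero.2 (hω.ne_one hd))

theorem aeval_gaussBinom_self_left (hω : IsPrimitiveRoot ω d) {k : ℕ} (hk : k + 1 < d) :
    aeval ω (gaussBinom d (k + 1)) = 0 := by
  obtain ⟨d, rfl⟩ := Nat.exists_eq_add_of_le' (show 1 ≤ d by omega)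
  have := congrArg (aeval ω) (qNat_mul_gaussBinom_succ d k)
  rw [map_mul, map_mul, aeval_qNat_self hω (by omega), zero_mul, mul_eq_zero] at this
  exact this.resolve_left (aeval_qNat_ne_zero hω (Nat.not_dvd_of_pos_of_lt k.succ_pos hk))

/-- Together with `aeval_gaussBinom_add_add`, the `q`-Lucas theorem for a single step of length
`d`, by induction on `n` from the vanishing of the inner entries of row `d`. -/
theorem aeval_gaussBinom_add_left (hω : IsPrimitiveRoot ω d) (n : ℕ) {k : ℕ} (hk : k < d) :
    aeval ω (gaussBinom (n + d) k) = aeval ω (gaussBinom n k) := by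
  induction n generalizing k with
  | zero =>
    rcases k with _ | k
    · rw [gaussBinom_zero_right, gaussBinom_zero_right]
    · rw [zero_add, gaussBinom_zero_succ, aeval_gaussBinom_self_left hω hk, map_zero]
  | succ n ih =>
    rcases k with _ | k
    · rw [gaussBinom_zero_right, gaussBinom_zero_right]
    · rw [add_right_comm, gaussBinom_succ_succ, gaussBinom_succ_succ, map_add, map_add, map_mul,
        map_mul, ih hk, ih (by omega)]

theorem aeval_gaussBinom_add_add (hω : IsPrimitiveRoot ω d) (hd : d ≠ 0) (n k : ℕ) :
    aeval ω (gaussBinom (n + d) (k + d)) =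
      aeval ω (gaussBinom n k) + aeval ω (gaussBinom n (k + d)) := by
  induction n generalizing k with
  | zero =>
    rw [gaussBinom_eq_zero (show 0 < k + d by omega), map_zero, add_zero, zero_add]
    rcases k with _ | k
    · rw [zero_add, gaussBinom_self, gaussBinom_zero_right]
    · rw [gaussBinom_eq_zero (by omega), gaussBinom_zero_succ]
  | succ n ih =>
    rcases k with _ | k
    · obtain ⟨c, rfl⟩ := Nat.exists_eq_succ_of_ne_zero hd
      have h1 := ih 0
      have h2 := aeval_gaussBinom_add_left hω n c.lt_succ_self
      simp only [Nat.succ_eq_add_one, zero_add] at h1 h2 hω ⊢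
      rw [add_right_comm, gaussBinom_succ_succ, gaussBinom_succ_succ]
      simp only [map_add, map_mul, map_pow, aeval_X, hω.pow_eq_one, h1, h2, gaussBinom_zero_right]
      ring
    · rw [add_right_comm, add_right_comm k 1 d, gaussBinom_succ_succ, gaussBinom_succ_succ,
        gaussBinom_succ_succ, add_right_comm k d 1]
      simp only [map_add, map_mul, map_pow, aeval_X, ih]
      rw [add_right_comm k 1 d, pow_add _ (k + d), pow_add _ k d, hω.pow_eq_one, pow_add _ k 1]
      ring

/-- The `q`-Lucas theorem. -/
theorem aeval_gaussBinom_lucas (hω : IsPrimitiveRoot ω d) (a b : ℕ) {r s : ℕ} (hr : r < d)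
    (hs : s < d) : aeval ω (gaussBinom (d * a + r) (d * b + s)) =
      a.choose b * aeval ω (gaussBinom r s) := by
  induction a generalizing b with
  | zero =>
    rcases b with _ | b
    · simp
    · have h : d ≤ d * (b + 1) := Nat.le_mul_of_pos_right d b.succ_pos
      rw [mul_zero, zero_add, gaussBinom_eq_zero (by omega)]
      simp
  | succ a ih =>
    rw [mul_add_one, add_right_comm]
    rcases b with _ | b
    · rw [mul_zero, zero_add, aeval_gaussBinom_add_left hω _ hs]
      simpa using ih 0
    · rw [mul_add_one, add_right_comm (d * b), aeval_gaussBinom_add_add hω (by omega),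
        add_right_comm (d * b) s d, ← mul_add_one, ih, ih, Nat.choose_succ_succ']
      push_cast
      ring

/-- If `d` divides the number of edges, the last summand of `forestQPoly` vanishes, since in its
first Gaussian factor the upper and lower indices have the residues `0` and `1` modulo `d`. -/
theorem aeval_forestQPoly_of_dvd (hω : IsPrimitiveRoot ω d) (hd : 2 ≤ d) (m e : ℕ) :
    aeval ω (forestQPoly (d * m + (d - 1)) (d * e)) =
      ((m.choose e * ((m + 2 * e).choose e - intChoose (m + 2 * e) ((e : ℤ) - 1)) : ℤ) : ℂ) := by
  have hpow : ω ^ (d * m + (d - 1) + 1) = 1 := by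
    rw [show d * m + (d - 1) + 1 = d * (m + 1) by rw [mul_add_one]; omega, pow_mul, hω.pow_eq_one,
      one_pow]
  have h1 : aeval ω (gaussBinom (d * m + (d - 1)) (d * e)) = m.choose e := by
    have := aeval_gaussBinom_lucas hω m e (r := d - 1) (s := 0) (by omega) (by omega)
    rwa [gaussBinom_zero_right, map_one, mul_one] at this
  have h2 : aeval ω (gaussBinom (d * m + (d - 1) + 2 * (d * e)) (d * e)) =
      (m + 2 * e).choose e := by
    have := aeval_gaussBinom_lucas hω (m + 2 * e) e (r := d - 1) (s := 0) (by omega) (by omega)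
    rw [gaussBinom_zero_right, map_one, mul_one, add_zero] at this
    rw [← this]
    ring_nf
  have h3 : aeval ω (gaussBinomPred (d * m + (d - 1) + 2 * (d * e)) (d * e)) =
      intChoose (m + 2 * e) ((e : ℤ) - 1) := by
    rcases e with _ | e
    · rw [mul_zero, gaussBinomPred, map_zero, Nat.cast_zero, intChoose_of_neg _ (by norm_num),
        Int.cast_zero]
    · have := aeval_gaussBinom_lucas hω (m + 2 * (e + 1)) e (r := d - 1) (s := d - 1)
        (by omega) (by omega)
      rw [gaussBinom_self, map_one, mul_one] at this
      rw [show d * (e + 1) = d * e + (d - 1) + 1 by rw [mul_add_one]; omega, gaussBinomPred,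
        show d * m + (d - 1) + 2 * (d * e + (d - 1) + 1) = d * (m + 2 * (e + 1)) + (d - 1) by
          rw [show d * e + (d - 1) + 1 = d * (e + 1) by rw [mul_add_one]; omega]; ring, this]
      rw [Nat.cast_succ, add_sub_cancel_right, intChoose_natCast]
      norm_cast
  have h4 : aeval ω (gaussBinom (d * m + (d - 1) + 1) (d * e + 1)) = 0 := by
    have := aeval_gaussBinom_lucas hω (m + 1) e (r := 0) (s := 1) (by omega) (by omega)
    rw [gaussBinom_zero_succ, map_zero, mul_zero, add_zero] at this
    rw [← this, mul_add_one, add_assoc, Nat.sub_add_cancel (by omega)]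
  rw [forestQPoly]
  simp only [map_sub, map_mul, map_pow, aeval_X, hpow, h1, h2, h3, h4]
  push_cast
  ring

/-- Here the division by `[N + 1 + e]` is harmless, since this `q`-integer takes the value `1`
at `-1`. -/
theorem aeval_forestQPoly_two_of_odd (hω : IsPrimitiveRoot ω 2) (m e : ℕ) :
    aeval ω (forestQPoly (2 * m + 1) (2 * e + 1)) =
      (((m + 1).choose (e + 1) * (m + 1 + 2 * e).choose e : ℤ) : ℂ) := by
  have h := congrArg (aeval ω) (forestQPoly_mul_qNat (2 * m + 1) (2 * e + 1))
  have h1 := aeval_gaussBinom_lucas hω (m + 1) (e + 1) (r := 0) (s := 0) two_pos two_pos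
  have h2 := aeval_gaussBinom_lucas hω (m + 1 + 2 * e) e (r := 1) (s := 1) one_lt_two one_lt_two
  have h3 := sub_one_mul_aeval_qNat ω (2 * m + 1 + 1 + (2 * e + 1))
  have h4 : ω ^ (2 * m + 1 + 1 + (2 * e + 1)) = ω := by
    rw [show 2 * m + 1 + 1 + (2 * e + 1) = 2 * (m + e + 1) + 1 by ring, pow_succ, pow_mul,
      hω.pow_eq_one, one_pow, one_mul]
  have h5 : aeval ω (qNat (2 * m + 1 + 1 + (2 * e + 1))) = 1 := by
    rw [h4] at h3
    exact mul_left_cancel₀ (sub_ne_zero.2 (hω.ne_one one_lt_two)) (h3.trans (mul_one _).symm)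
  rw [map_mul, map_mul, h5, mul_one] at h
  rw [h, show 2 * m + 1 + 1 = 2 * (m + 1) + 0 by ring,
    show 2 * e + 1 + 1 = 2 * (e + 1) + 0 by ring, h1,
    show 2 * m + 1 + 2 * (2 * e + 1) = 2 * (m + 1 + 2 * e) + 1 by ring, h2,
    gaussBinom_self, gaussBinom_self, map_one]
  push_cast
  ring

theorem aeval_forestQPoly_of_not_dvd (hω : IsPrimitiveRoot ω d) (hd : 3 ≤ d) (m : ℕ) {e : ℕ}
    (he : ¬ d ∣ e) : aeval ω (forestQPoly (d * m + (d - 1)) e) = 0 := by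
  have h := congrArg (aeval ω) (forestQPoly_mul_qNat (d * m + (d - 1)) e)
  have hn : d * m + (d - 1) + 1 = d * (m + 1) + 0 := by rw [mul_add_one]; omega
  have h1 : ¬ d ∣ d * m + (d - 1) + 1 + e := by
    rwa [hn, add_zero, Nat.dvd_add_right (dvd_mul_right d (m + 1))]
  rw [map_mul, map_mul] at h
  refine (mul_eq_zero.1 (h.trans ?_)).resolve_right (aeval_qNat_ne_zero hω h1)
  have hlt := Nat.mod_lt e (show 0 < d by omega)
  have hdiv := Nat.div_add_mod e d
  rcases Nat.lt_or_ge (e % d + 1) d with hs | hs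
  · refine mul_eq_zero_of_left ?_ _
    rw [hn, ← hdiv, add_assoc, aeval_gaussBinom_lucas hω _ _ (by omega) hs, gaussBinom_zero_succ,
      map_zero, mul_zero]
  · -- Here `e` is `-1` modulo `d`, and `N + 2 e` has the residue `d - 3`.
    refine mul_eq_zero_of_right _ ?_
    have h2 : e = d * (e / d) + (d - 1) := by omega
    have h3 : d * m + (d - 1) + 2 * e = d * (m + 2 * (e / d) + 2) + (d - 3) := by
      rw [mul_add, mul_add, mul_left_comm]
      omega
    rw [h3]
    nth_rewrite 2 [h2]
    rw [aeval_gaussBinom_lucas hω _ _ (by omega) (by omega), gaussBinom_eq_zero (by omega),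
      map_zero, mul_zero]

end RootsOfUnity

/-! ### The sieving polynomial as a rational function -/

/-- The inclusion of `ℤ[q]` into `ℚ(q)`. -/
noncomputable def intRatFunc : ℤ[X] →+* RatFunc ℚ :=
  (algebraMap ℚ[X] (RatFunc ℚ)).comp (mapRingHom (Int.castRingHom ℚ))

theorem intRatFunc_injective : Function.Injective intRatFunc :=
  (RatFunc.algebraMap_injective ℚ).comp (map_injective _ Int.cast_injective)

theorem intRatFunc_map (P : ℕ[X]) : intRatFunc (P.map (Nat.castRingHom ℤ)) = toRatFunc P := by
  rw [intRatFunc, toRatFunc, RingHom.comp_apply, coe_mapRingHom, map_map]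
  congr 2

theorem intRatFunc_qNat (m : ℕ) : intRatFunc (qNat m) = qInt m := by
  simp [intRatFunc, qNat, qInt]

theorem intRatFunc_qNatFactorial (m : ℕ) : intRatFunc (qNatFactorial m) = qFactorial m := by
  simp [qNatFactorial, qFactorial, intRatFunc_qNat]

theorem intRatFunc_gaussBinom (k j : ℕ) : intRatFunc (gaussBinom (k + j) k) = qBinom (k + j) k := by
  have h0 (m : ℕ) : qFactorial m ≠ 0 := by
    rw [← intRatFunc_qNatFactorial]
    exact (map_ne_zero_iff _ intRatFunc_injective).2 (qNatFactorial_ne_zero m)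
  rw [qBinom, if_pos (Nat.le_add_right k j), Nat.add_sub_cancel_left,
    eq_div_iff (mul_ne_zero (h0 k) (h0 j))]
  simp only [← intRatFunc_qNatFactorial, ← map_mul, gaussBinom_mul_factorial]

theorem intRatFunc_forestQPoly {n k : ℕ} (hk : 1 ≤ k) (hkn : k ≤ n) :
    intRatFunc (forestQPoly (n - 1) (n - k)) = forestRatFunc n k := by
  obtain ⟨e, rfl⟩ := Nat.exists_eq_add_of_le hkn
  obtain ⟨j, rfl⟩ := Nat.exists_eq_add_of_le' hk
  have h := congrArg intRatFunc (forestQPoly_mul_qNat (j + e) e)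
  have h0 : intRatFunc (qNat (j + e + 1 + e)) ≠ 0 :=
    (map_ne_zero_iff _ intRatFunc_injective).2 (qNat_ne_zero (by omega))
  rw [forestRatFunc, show j + 1 + e - 1 = j + e by omega, show j + 1 + e - (j + 1) = e by omega,
    show 2 * (j + 1 + e) - (j + 1) = j + e + 1 + e by omega, show j + 1 - 1 = j by omega,
    show 3 * (j + 1 + e) - 2 * (j + 1) - 1 = e + (j + 2 * e) by omega,
    show j + 1 + e = j + (e + 1) by omega, ← intRatFunc_gaussBinom, ← intRatFunc_gaussBinom,
    ← intRatFunc_qNat, one_div, mul_assoc, eq_comm, inv_mul_eq_iff_eq_mul₀ h0,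
    mul_comm _ (intRatFunc (forestQPoly _ _)), ← map_mul, ← map_mul, forestQPoly_mul_qNat,
    gaussBinom_symm]
  congr 3
  omega

end Gaussian

/-! ### Particles hopping along a chain -/

section Particles

variable {P : Type*} [DecidableEq P]

/-- The operator on functions of the configurations `S : P → Bool` of occupied sites which moves a
particle from the site `a` to the free site `b`. -/
noncomputable def hop (a b : P) : ((P → Bool) → ℝ) →ₗ[ℝ] ((P → Bool) → ℝ) where
  toFun v S := if S a = false ∧ S b = true then v (S ∘ Equiv.swap a b) else 0
  map_add' u v := by
    ext S
    by_cases h : S a = false ∧ S b = true <;> simp [h]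
  map_smul' c v := by
    ext S
    by_cases h : S a = false ∧ S b = true <;> simp [h]

theorem hop_apply (a b : P) (v : (P → Bool) → ℝ) (S : P → Bool) :
    hop a b v S = if S a = false ∧ S b = true then v (S ∘ Equiv.swap a b) else 0 := rfl

/-- Hops in opposite directions along two different steps `a → b` and `a' → b'` of a chain commute;
if the steps share a site, both composites vanish. -/
theorem hop_comm {a b a' b' : P} (ha : a ≠ a') (hb : b ≠ b') (v : (P → Bool) → ℝ) :
    hop b a (hop a' b' v) = hop a' b' (hop b a v) := by
  ext S
  simp only [hop_apply, Function.comp_apply]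
  by_cases h1 : b = a'
  · subst h1
    simp only [Equiv.swap_apply_left]
    cases S a <;> cases S b <;> cases S b' <;> simp
  by_cases h2 : a = b'
  · subst h2
    simp only [Equiv.swap_apply_right]
    cases S a <;> cases S b <;> cases S a' <;> simp
  simp only [Equiv.swap_apply_of_ne_of_ne (Ne.symm h1) (Ne.symm ha),
    Equiv.swap_apply_of_ne_of_ne (Ne.symm hb) (Ne.symm h2),
    Equiv.swap_apply_of_ne_of_ne h1 hb, Equiv.swap_apply_of_ne_of_ne ha h2]
  have h3 : (S ∘ Equiv.swap b a) ∘ Equiv.swap a' b' = (S ∘ Equiv.swap a' b') ∘ Equiv.swap b a := by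
    have hc : Equiv.swap b a * Equiv.swap a' b' = Equiv.swap a' b' * Equiv.swap b a :=
      Equiv.Perm.Disjoint.commute fun x => by
        by_cases hx : x = b ∨ x = a
        · right
          rcases hx with rfl | rfl
          · exact Equiv.swap_apply_of_ne_of_ne h1 hb
          · exact Equiv.swap_apply_of_ne_of_ne ha h2
        · rw [not_or] at hx
          exact Or.inl (Equiv.swap_apply_of_ne_of_ne hx.1 hx.2)
    ext x
    have := congrArg (fun e : Equiv.Perm P => S (e x)) hc
    simpa using congrArg (· = true) this
  rw [h3]
  split_ifs <;> rfl

variable [Fintype P]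

theorem sum_comp_swap (a b : P) (f : (P → Bool) → ℝ) :
    ∑ S : P → Bool, f (S ∘ Equiv.swap a b) = ∑ S, f S :=
  Fintype.sum_equiv ((Equiv.swap a b).arrowCongr (Equiv.refl Bool)) _ _ fun S => by
    congr 1

theorem hop_dotProduct (a b : P) (u v : (P → Bool) → ℝ) :
    hop a b u ⬝ᵥ v = u ⬝ᵥ hop b a v := by
  rw [dotProduct, dotProduct, ← sum_comp_swap a b]
  refine Finset.sum_congr rfl fun S _ => ?_
  rw [hop_apply, hop_apply, Function.comp_apply, Function.comp_apply, Equiv.swap_apply_left,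
    Equiv.swap_apply_right, Equiv.swap_comm b a]
  have h : (S ∘ Equiv.swap a b) ∘ Equiv.swap a b = S := by
    ext x
    simp
  rw [h, ite_mul, zero_mul, mul_ite, mul_zero]

theorem hop_dotProduct_hop (a b : P) (v : (P → Bool) → ℝ) :
    hop a b v ⬝ᵥ hop a b v = hop b a v ⬝ᵥ hop b a v +
      ∑ S, (((S a).toNat : ℝ) - (S b).toNat) * v S ^ 2 := by
  have h (a b : P) : hop a b v ⬝ᵥ hop a b v =
      ∑ S, (if S b = false ∧ S a = true then 1 else 0) * v S ^ 2 := by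
    rw [dotProduct, ← sum_comp_swap a b]
    refine Finset.sum_congr rfl fun S _ => ?_
    have h : (S ∘ Equiv.swap a b) ∘ Equiv.swap a b = S := by
      ext x
      simp
    simp only [hop_apply, Function.comp_apply, Equiv.swap_apply_left, Equiv.swap_apply_right, h]
    split_ifs <;> ring
  rw [h a b, h b a, ← Finset.sum_add_distrib]
  refine Finset.sum_congr rfl fun S _ => ?_
  cases S a <;> cases S b <;> simp

/-- The commutator of the weighted raising operator with its adjoint is diagonal: the off-diagonal
terms cancel, since hops along different steps of the chain commute. -/
theorem sum_hop_dotProduct_self {ι : Type*} [Fintype ι] {a b : ι → P} (ha : a.Injective)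
    (hb : b.Injective) (c : ι → ℝ) (v : (P → Bool) → ℝ) :
    (∑ i, c i • hop (a i) (b i) v) ⬝ᵥ (∑ i, c i • hop (a i) (b i) v) =
      (∑ i, c i • hop (b i) (a i) v) ⬝ᵥ (∑ i, c i • hop (b i) (a i) v) +
        ∑ S, (∑ i, c i ^ 2 * (((S (a i)).toNat : ℝ) - (S (b i)).toNat)) * v S ^ 2 := by
  classical
  have key (i j : ι) : hop (a i) (b i) v ⬝ᵥ hop (a j) (b j) v =
      hop (b i) (a i) v ⬝ᵥ hop (b j) (a j) v +
        if i = j then ∑ S, (((S (a i)).toNat : ℝ) - (S (b i)).toNat) * v S ^ 2 else 0 := by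
    split_ifs with h
    · subst h
      exact hop_dotProduct_hop _ _ _
    · rw [add_zero, dotProduct_comm (hop (b i) (a i) v), hop_dotProduct, hop_dotProduct (b j),
        hop_comm (ha.ne h) (hb.ne h)]
  simp only [sum_dotProduct, dotProduct_sum, smul_dotProduct, dotProduct_smul, key, smul_eq_mul,
    mul_add, Finset.sum_add_distrib]
  congr 1
  simp only [mul_ite, mul_zero, Finset.sum_ite_eq', Finset.mem_univ, if_true,
    Finset.sum_mul]
  rw [Finset.sum_comm]
  simp only [Finset.mul_sum]
  refine Finset.sum_congr rfl fun i _ => Finset.sum_congr rfl fun S _ => ?_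
  ring

/-- If the raising operator maps functions supported on `A` to functions supported on `B` and its
commutator with the adjoint is positive on `A`, then it is injective on functions supported on
`A`. -/
theorem card_le_card_of_hop {ι : Type*} [Fintype ι] {a b : ι → P} (ha : a.Injective)
    (hb : b.Injective) (c : ι → ℝ) {A B : Finset (P → Bool)}
    (hAB : ∀ S ∈ A, ∀ i, S (a i) = true → S (b i) = false → S ∘ Equiv.swap (a i) (b i) ∈ B)
    (hpos : ∀ S ∈ A, 0 < ∑ i, c i ^ 2 * (((S (a i)).toNat : ℝ) - (S (b i)).toNat)) :
    A.card ≤ B.card := by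
  classical
  let E : ((P → Bool) → ℝ) →ₗ[ℝ] ((P → Bool) → ℝ) := ∑ i, c i • hop (a i) (b i)
  let ext : (A → ℝ) →ₗ[ℝ] ((P → Bool) → ℝ) :=
    { toFun := fun v S => if h : S ∈ A then v ⟨S, h⟩ else 0
      map_add' := fun u v => by ext S; by_cases h : S ∈ A <;> simp [h]
      map_smul' := fun t v => by ext S; by_cases h : S ∈ A <;> simp [h] }
  have hE (v : (P → Bool) → ℝ) : E v = ∑ i, c i • hop (a i) (b i) v := by
    simp [E, LinearMap.sum_apply]
  have hext (v : A → ℝ) {S : P → Bool} (hS : S ∉ A) : ext v S = 0 := dif_neg hS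
  -- If the restriction of `E v` to `B` vanishes, so does `E v`, and then the commutator relation
  -- writes `0` as a sum of nonnegative terms, among them positive multiples of the `v S ^ 2`.
  have hinj : Function.Injective (LinearMap.funLeft ℝ ℝ ((↑) : B → P → Bool) ∘ₗ E ∘ₗ ext) := by
    rw [← LinearMap.ker_eq_bot, LinearMap.ker_eq_bot']
    intro v hv
    have h0 : E (ext v) = 0 := by
      ext S
      by_cases hS : S ∈ B
      · exact congrFun hv ⟨S, hS⟩
      rw [hE, Finset.sum_apply]
      refine Finset.sum_eq_zero fun i _ => ?_
      rw [Pi.smul_apply, hop_apply]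
      split_ifs with h
      · rw [hext, smul_zero]
        intro hA
        refine hS ?_
        have := hAB _ hA i (by simp [h.2]) (by simp [h.1])
        convert this using 1
        ext x
        simp
      · exact smul_zero _
    have h1 := sum_hop_dotProduct_self ha hb c (ext v)
    rw [← hE, h0, zero_dotProduct] at h1
    have h2 (S : P → Bool) :
        0 ≤ (∑ i, c i ^ 2 * (((S (a i)).toNat : ℝ) - (S (b i)).toNat)) * ext v S ^ 2 := by
      by_cases hS : S ∈ A
      · exact mul_nonneg (hpos S hS).le (sq_nonneg _)
      · rw [hext v hS]
        simp
    have h3 := Finset.sum_nonneg fun S (_ : S ∈ Finset.univ) => h2 S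
    have h4 : 0 ≤ (∑ i, c i • hop (b i) (a i) (ext v)) ⬝ᵥ (∑ i, c i • hop (b i) (a i) (ext v)) :=
      Finset.sum_nonneg fun S _ => mul_self_nonneg _
    have h5 := (Finset.sum_eq_zero_iff_of_nonneg fun S _ => h2 S).1 (le_antisymm (by linarith) h3)
    ext ⟨S, hS⟩
    have h6 := (mul_eq_zero.1 (h5 S (Finset.mem_univ S))).resolve_left (hpos S hS).ne'
    have h7 : ext v S = v ⟨S, hS⟩ := dif_pos hS
    rw [← h7]
    exact pow_eq_zero_iff two_ne_zero |>.1 h6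
  simpa using card_le_of_injective ℝ _ hinj

end Particles

/-! ### Unimodality of products of two Gaussian binomial coefficients -/

section Unimodality

open Polynomial

/-- The number of particles of a configuration on a chain. -/
def occupation {n : ℕ} (T : Fin n → Bool) : ℕ := ∑ p, (T p).toNat

/-- The sum of the positions of the particles of a configuration on a chain. -/
def positionSum {n : ℕ} (T : Fin n → Bool) : ℕ := ∑ p : Fin n, p * (T p).toNat

theorem occupation_cons {n : ℕ} (b : Bool) (T : Fin n → Bool) :
    occupation (Fin.cons b T : Fin (n + 1) → Bool) = b.toNat + occupation T := by
  simp [occupation, Fin.sum_univ_succ]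

theorem positionSum_cons {n : ℕ} (b : Bool) (T : Fin n → Bool) :
    positionSum (Fin.cons b T : Fin (n + 1) → Bool) = positionSum T + occupation T := by
  simp [occupation, positionSum, Fin.sum_univ_succ, add_mul, Finset.sum_add_distrib]

/-- The Gaussian binomial coefficient counts `k`-element subsets of `{0, …, n - 1}` by their sum. -/
theorem sum_pow_positionSum (n k : ℕ) :
    ∑ T : Fin n → Bool, (if occupation T = k then X ^ positionSum T else 0 : ℤ[X]) =
      X ^ k.choose 2 * gaussBinom n k := by
  induction n generalizing k with
  | zero =>
    rw [Fintype.sum_unique]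
    rcases k with _ | k
    · simp [occupation, positionSum, gaussBinom_zero_right]
    · simp [occupation, gaussBinom_zero_succ]
  | succ n ih =>
    rw [← (Fin.consEquiv fun _ : Fin (n + 1) => Bool).sum_comp, Fintype.sum_prod_type,
      Fintype.sum_bool]
    have hc (b : Bool) (T : Fin n → Bool) :
        (Fin.consEquiv fun _ : Fin (n + 1) => Bool) (b, T) = Fin.cons b T := rfl
    simp only [hc, occupation_cons, positionSum_cons, Bool.toNat_true,
      Bool.toNat_false, zero_add]
    have h (j : ℕ) : ∑ T : Fin n → Bool,
        (if occupation T = j then X ^ (positionSum T + occupation T) else 0 : ℤ[X]) =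
          X ^ j * (X ^ j.choose 2 * gaussBinom n j) := by
      rw [← ih, Finset.mul_sum]
      refine Finset.sum_congr rfl fun T _ => ?_
      split_ifs with hT
      · rw [hT, pow_add, mul_comm]
      · rw [mul_zero]
    rw [h]
    rcases k with _ | k
    · simp [gaussBinom_zero_right, add_comm 1]
    · simp only [add_comm 1, add_left_inj]
      rw [h, gaussBinom_succ_succ, Nat.choose_succ_succ' k 1, Nat.choose_one_right]
      ring

/-- The configurations on two chains with `k₁` and `k₂` particles and a given sum of positions,
normalized so that `r = 0` is the least possible sum. -/
def twoChainLevel (n₁ n₂ k₁ k₂ r : ℕ) : Finset (Fin n₁ ⊕ Fin n₂ → Bool) :=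
  {S | (occupation (S ∘ Sum.inl) = k₁ ∧ occupation (S ∘ Sum.inr) = k₂) ∧
    positionSum (S ∘ Sum.inl) + positionSum (S ∘ Sum.inr) = r + (k₁.choose 2 + k₂.choose 2)}

theorem coeff_gaussBinom_mul (n₁ n₂ k₁ k₂ r : ℕ) :
    (gaussBinom n₁ k₁ * gaussBinom n₂ k₂).coeff r = (twoChainLevel n₁ n₂ k₁ k₂ r).card := by
  have h : X ^ (k₁.choose 2 + k₂.choose 2) * (gaussBinom n₁ k₁ * gaussBinom n₂ k₂) =
      ∑ S : Fin n₁ ⊕ Fin n₂ → Bool,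
        (if occupation (S ∘ Sum.inl) = k₁ ∧ occupation (S ∘ Sum.inr) = k₂ then
          X ^ (positionSum (S ∘ Sum.inl) + positionSum (S ∘ Sum.inr)) else 0 : ℤ[X]) := by
    rw [pow_add, mul_mul_mul_comm, ← sum_pow_positionSum, ← sum_pow_positionSum,
      Finset.sum_mul_sum, ← (Equiv.sumArrowEquivProdArrow _ _ _).symm.sum_comp,
      Fintype.sum_prod_type]
    refine Finset.sum_congr rfl fun T₁ _ => Finset.sum_congr rfl fun T₂ _ => ?_
    have h1 : (Equiv.sumArrowEquivProdArrow (Fin n₁) (Fin n₂) Bool).symm (T₁, T₂) ∘ Sum.inl = T₁ :=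
      rfl
    have h2 : (Equiv.sumArrowEquivProdArrow (Fin n₁) (Fin n₂) Bool).symm (T₁, T₂) ∘ Sum.inr = T₂ :=
      rfl
    rw [h1, h2, ite_zero_mul_ite_zero, pow_add]
  have h1 := congrArg (fun p => p.coeff (r + (k₁.choose 2 + k₂.choose 2))) h
  simp only [coeff_X_pow_mul, finsetSum_coeff] at h1
  rw [h1, twoChainLevel, Finset.card_filter]
  push_cast
  refine Finset.sum_congr rfl fun S _ => ?_
  by_cases h2 : occupation (S ∘ Sum.inl) = k₁ ∧ occupation (S ∘ Sum.inr) = k₂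
  · simp [h2, coeff_X_pow, eq_comm]
  · simp [h2]

theorem occupation_comp_swap {n : ℕ} (T : Fin n → Bool) (a b : Fin n) :
    occupation (T ∘ Equiv.swap a b) = occupation T :=
  Equiv.sum_comp (Equiv.swap a b) fun p => (T p).toNat

theorem positionSum_comp_swap {n : ℕ} (T : Fin (n + 1) → Bool) (i : Fin n)
    (h1 : T i.castSucc = true) (h2 : T i.succ = false) :
    positionSum (T ∘ Equiv.swap i.castSucc i.succ) = positionSum T + 1 := by
  have h : positionSum (T ∘ Equiv.swap i.castSucc i.succ) =
      ∑ p, (Equiv.swap i.castSucc i.succ p : ℕ) * (T p).toNat := by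
    rw [positionSum, ← Equiv.sum_comp (Equiv.swap i.castSucc i.succ)]
    simp
  have h' : positionSum T + 1 =
      ∑ p, (p * (T p).toNat + if p = i.castSucc then 1 else 0) := by
    simp [positionSum, Finset.sum_add_distrib]
  rw [h, h']
  refine Finset.sum_congr rfl fun p _ => ?_
  by_cases hp : p = i.castSucc
  · subst hp
    simp [h1]
  by_cases hp' : p = i.succ
  · subst hp'
    simp [h2, hp]
  · rw [Equiv.swap_apply_of_ne_of_ne hp hp', if_neg hp, add_zero]

/-- The weights `(i + 1) (n - i)` are those of the irreducible representation of `sl₂` of dimension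
`n + 1`. -/
theorem sum_weight_mul {n : ℕ} (T : Fin (n + 1) → Bool) :
    ∑ i : Fin n, ((i + 1 : ℝ) * (n - i)) * (((T i.castSucc).toNat : ℝ) - (T i.succ).toNat) =
      n * occupation T - 2 * positionSum T := by
  have h1 : ∑ i : Fin n, ((i + 1 : ℝ) * (n - i)) * ((T i.castSucc).toNat : ℝ) =
      ∑ p : Fin (n + 1), ((p + 1 : ℝ) * (n - p)) * (T p).toNat := by
    simp [Fin.sum_univ_castSucc]
  have h2 : ∑ i : Fin n, ((i + 1 : ℝ) * (n - i)) * ((T i.succ).toNat : ℝ) =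
      ∑ p : Fin (n + 1), (p * (n - p + 1 : ℝ)) * (T p).toNat := by
    rw [Fin.sum_univ_succ]
    simp [sub_add_eq_sub_sub]
  simp only [mul_sub, Finset.sum_sub_distrib]
  simp only [← mul_sub]
  rw [h1, h2, occupation, positionSum]
  push_cast
  rw [Finset.mul_sum, Finset.mul_sum, ← Finset.sum_sub_distrib, ← Finset.sum_sub_distrib]
  refine Finset.sum_congr rfl fun p _ => ?_
  ring

/-- The coefficients of a product of two Gaussian binomial coefficients increase up to the
middle. -/
theorem coeff_gaussBinom_mul_le_succ {n₁ n₂ k₁ k₂ r : ℕ}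
    (hr : (2 * r : ℤ) < k₁ * (n₁ + 1 - k₁) + k₂ * (n₂ + 1 - k₂)) :
    (gaussBinom (n₁ + 1) k₁ * gaussBinom (n₂ + 1) k₂).coeff r ≤
      (gaussBinom (n₁ + 1) k₁ * gaussBinom (n₂ + 1) k₂).coeff (r + 1) := by
  rw [coeff_gaussBinom_mul, coeff_gaussBinom_mul, Nat.cast_le]
  have hw {n : ℕ} (i : Fin n) : (0 : ℝ) ≤ (i + 1) * (n - i) := by
    have : (i : ℝ) ≤ n := by exact_mod_cast i.2.le
    exact mul_nonneg (by positivity) (by linarith)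
  refine card_le_card_of_hop (ι := Fin n₁ ⊕ Fin n₂) (a := Sum.map Fin.castSucc Fin.castSucc)
    (b := Sum.map Fin.succ Fin.succ)
    (Sum.map_injective.2 ⟨Fin.castSucc_injective _, Fin.castSucc_injective _⟩)
    (Sum.map_injective.2 ⟨Fin.succ_injective _, Fin.succ_injective _⟩)
    -- Square roots, so that the squares of the coefficients are the `sl₂` weights.
    (Sum.elim (fun i => √((i + 1) * (n₁ - i))) (fun i => √((i + 1) * (n₂ - i)))) ?_ ?_
  · intro S hS i h1 h2
    simp only [twoChainLevel, Finset.mem_filter, Finset.mem_univ, true_and] at hS ⊢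
    rcases i with i | i
    · have hl : (S ∘ Equiv.swap (Sum.inl i.castSucc) (Sum.inl i.succ)) ∘ Sum.inl =
          (S ∘ Sum.inl) ∘ Equiv.swap i.castSucc i.succ := by
        ext p
        simp [Sum.inl_injective.map_swap]
      have hR : (S ∘ Equiv.swap (Sum.inl i.castSucc) (Sum.inl i.succ)) ∘ Sum.inr = S ∘ Sum.inr := by
        ext p
        simp [Equiv.swap_apply_of_ne_of_ne]
      simp only [Sum.map_inl] at h1 h2 ⊢
      rw [hl, hR, occupation_comp_swap, positionSum_comp_swap _ _ h1 h2]
      exact ⟨hS.1, by omega⟩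
    · have hl : (S ∘ Equiv.swap (Sum.inr i.castSucc) (Sum.inr i.succ)) ∘ Sum.inr =
          (S ∘ Sum.inr) ∘ Equiv.swap i.castSucc i.succ := by
        ext p
        simp [Sum.inr_injective.map_swap]
      have hR : (S ∘ Equiv.swap (Sum.inr i.castSucc) (Sum.inr i.succ)) ∘ Sum.inl = S ∘ Sum.inl := by
        ext p
        simp [Equiv.swap_apply_of_ne_of_ne]
      simp only [Sum.map_inr] at h1 h2 ⊢
      rw [hl, hR, occupation_comp_swap, positionSum_comp_swap _ _ h1 h2]
      exact ⟨hS.1, by omega⟩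
  · intro S hS
    simp only [twoChainLevel, Finset.mem_filter, Finset.mem_univ, true_and] at hS
    rw [Fintype.sum_sum_type]
    simp only [Sum.elim_inl, Sum.elim_inr, Sum.map_inl, Sum.map_inr, Real.sq_sqrt (hw _)]
    have e1 := sum_weight_mul (S ∘ Sum.inl)
    have e2 := sum_weight_mul (S ∘ Sum.inr)
    simp only [Function.comp_apply] at e1 e2
    rw [e1, e2, hS.1.1, hS.1.2]
    have e3 := congrArg (Nat.cast (R := ℝ)) hS.2
    push_cast [Nat.cast_choose_two] at e3
    have e4 : (2 * r : ℝ) < k₁ * (n₁ + 1 - k₁) + k₂ * (n₂ + 1 - k₂) := by exact_mod_cast hr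
    nlinarith

end Unimodality

/-! ### Nonnegativity of the sieving polynomial -/

section Nonnegativity

open Polynomial

/-- A polynomial of degree at most `d` is palindromic if its coefficients of `q ^ i` and of
`q ^ (d - i)` agree. -/
def IsPalindromic (d : ℕ) (P : ℤ[X]) : Prop := P.natDegree ≤ d ∧ reflect d P = P

theorem IsPalindromic.mul {d d' : ℕ} {P Q : ℤ[X]} (hP : IsPalindromic d P)
    (hQ : IsPalindromic d' Q) : IsPalindromic (d + d') (P * Q) :=
  ⟨natDegree_mul_le.trans (add_le_add hP.1 hQ.1), by rw [reflect_mul _ _ hP.1 hQ.1, hP.2, hQ.2]⟩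

theorem IsPalindromic.natDegree_eq {d : ℕ} {P : ℤ[X]} (hP : IsPalindromic d P)
    (h0 : P.coeff 0 ≠ 0) : P.natDegree = d := by
  refine le_antisymm hP.1 (le_natDegree_of_ne_zero ?_)
  rwa [← hP.2, coeff_reflect, revAt_le le_rfl, Nat.sub_self]

theorem IsPalindromic.of_mul {d d' : ℕ} {P Q : ℤ[X]} (h : IsPalindromic (d + d') (P * Q))
    (hQ : IsPalindromic d' Q) (h0 : Q.coeff 0 ≠ 0) : IsPalindromic d P := by
  have hQ0 : Q ≠ 0 := by
    rintro rfl
    exact h0 (coeff_zero 0)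
  rcases eq_or_ne P 0 with rfl | hP
  · exact ⟨by simp, reflect_zero⟩
  have hd : P.natDegree ≤ d := by
    have := h.1
    rw [natDegree_mul hP hQ0, hQ.natDegree_eq h0] at this
    omega
  refine ⟨hd, mul_right_cancel₀ hQ0 ?_⟩
  have := h.2
  rwa [reflect_mul _ _ hd hQ.1, hQ.2] at this

theorem IsPalindromic.coeff_eq {d : ℕ} {P : ℤ[X]} (hP : IsPalindromic d P) {r : ℕ} (hr : r ≤ d) :
    P.coeff r = P.coeff (d - r) := by
  conv_lhs => rw [← hP.2, coeff_reflect, revAt_le hr]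

theorem coeff_qNat (m i : ℕ) : (qNat m).coeff i = if i < m then 1 else 0 := by
  simp [qNat, coeff_X_pow]

theorem isPalindromic_qNat (m : ℕ) : IsPalindromic m (qNat (m + 1)) := by
  constructor
  · refine natDegree_le_iff_coeff_eq_zero.2 fun i hi => ?_
    rw [coeff_qNat, if_neg (by omega)]
  · ext i
    rw [coeff_reflect, coeff_qNat, coeff_qNat]
    rcases le_or_gt i m with h | h
    · rw [revAt_le h, if_pos (by omega), if_pos (by omega)]
    · rw [revAt_eq_self_of_lt h]

theorem coeff_zero_qNatFactorial (m : ℕ) : (qNatFactorial m).coeff 0 = 1 := by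
  induction m with
  | zero => simp [qNatFactorial]
  | succ m ih => rw [qNatFactorial_succ, mul_coeff_zero, ih, coeff_qNat, if_pos m.succ_pos, one_mul]

theorem isPalindromic_qNatFactorial (m : ℕ) : IsPalindromic (m.choose 2) (qNatFactorial m) := by
  induction m with
  | zero => exact ⟨by simp [qNatFactorial], by simp [qNatFactorial]⟩
  | succ m ih =>
    rw [qNatFactorial_succ, Nat.choose_succ_succ' m 1, Nat.choose_one_right, add_comm]
    exact ih.mul (isPalindromic_qNat m)

theorem isPalindromic_gaussBinom (k j : ℕ) : IsPalindromic (k * j) (gaussBinom (k + j) k) := by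
  have h0 : (qNatFactorial k * qNatFactorial j).coeff 0 ≠ 0 := by
    rw [mul_coeff_zero, coeff_zero_qNatFactorial, coeff_zero_qNatFactorial]
    norm_num
  refine IsPalindromic.of_mul (Q := qNatFactorial k * qNatFactorial j) ?_
    ((isPalindromic_qNatFactorial k).mul (isPalindromic_qNatFactorial j)) h0
  rw [gaussBinom_mul_factorial]
  have h : (k + j).choose 2 = k * j + (k.choose 2 + j.choose 2) := by
    rw [← Nat.cast_inj (R := ℚ)]
    push_cast [Nat.cast_choose_two]
    ring
  rw [← h]
  exact isPalindromic_qNatFactorial _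

theorem isPalindromic_forestQPoly {N e : ℕ} (h : e ≤ N + 1) :
    IsPalindromic (2 * e * N) (forestQPoly (N + 1) e) := by
  obtain ⟨j, hj⟩ := Nat.exists_eq_add_of_le h
  refine IsPalindromic.of_mul (Q := qNat (N + 1 + e + 1)) (d' := N + 1 + e) ?_
    (isPalindromic_qNat _) (by rw [coeff_qNat, if_pos (by omega)]; exact one_ne_zero)
  rw [show N + 1 + e + 1 = N + 1 + 1 + e by omega, forestQPoly_mul_qNat]
  have h1 := (isPalindromic_gaussBinom (e + 1) j).mul (isPalindromic_gaussBinom e (N + 1 + e))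
  rw [show e + 1 + j = N + 1 + 1 by omega, show e + (N + 1 + e) = N + 1 + 2 * e by ring] at h1
  convert h1 using 1
  zify at hj ⊢
  rw [show (N : ℤ) = e + j - 1 by linarith]
  ring

/-- In the lower half of its degree, a coefficient of the sieving polynomial exceeds an earlier one
by the difference of two consecutive coefficients of a product of Gaussian binomials. -/
theorem coeff_forestQPoly_nonneg_of_le {N e r : ℕ} (hr : r ≤ e * N) :
    0 ≤ (forestQPoly (N + 1) e).coeff r := by
  induction r using Nat.strong_induction_on with
  | _ r ih =>
    set G := gaussBinom (N + 1 + 1) (e + 1) * gaussBinom (N + 1 + 2 * e) e with hG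
    have h1 : (1 - X) * qNat (N + 1 + 1 + e) = 1 - X ^ (N + 1 + 1 + e) := mul_neg_geom_sum X _
    have h2 : forestQPoly (N + 1) e = X ^ (N + 1 + 1 + e) * forestQPoly (N + 1) e + G - X * G := by
      rw [hG, ← forestQPoly_mul_qNat]
      linear_combination (-forestQPoly (N + 1) e) * h1
    have h3 := congrArg (fun p => p.coeff r) h2
    simp only [coeff_sub, coeff_add, coeff_X_pow_mul'] at h3
    rw [h3]
    have h4 : 0 ≤ if N + 1 + 1 + e ≤ r then (forestQPoly (N + 1) e).coeff (r - (N + 1 + 1 + e))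
        else 0 := by
      split_ifs with h
      · exact ih _ (by omega) (by omega)
      · exact le_rfl
    -- The remaining difference of consecutive coefficients of `G` lies in its increasing half.
    rcases r with _ | r
    · rw [mul_coeff_zero X, coeff_X_zero, zero_mul, sub_zero]
      refine add_nonneg h4 ?_
      rw [hG, coeff_gaussBinom_mul]
      exact Int.natCast_nonneg _
    · have h5 : G.coeff r ≤ G.coeff (r + 1) := by
        rw [hG, add_right_comm N 1 (2 * e)]
        refine coeff_gaussBinom_mul_le_succ ?_
        zify at hr
        push_cast
        linarith
      rw [coeff_X_mul]
      linarith

/-- The upper half of the coefficients follows from the lower half by palindromicity. -/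
theorem coeff_forestQPoly_nonneg (N e r : ℕ) : 0 ≤ (forestQPoly N e).coeff r := by
  rcases lt_or_ge N e with he | he
  · have h := forestQPoly_mul_qNat N e
    rw [gaussBinom_eq_zero (show N + 1 < e + 1 by omega), zero_mul, mul_eq_zero] at h
    rw [h.resolve_right (qNat_ne_zero (by omega)), coeff_zero]
  rcases N with _ | N
  · obtain rfl : e = 0 := by omega
    simp only [forestQPoly, gaussBinomPred, gaussBinom_zero_right, mul_zero, sub_zero, mul_one,
      coeff_one]
    split_ifs <;> norm_num
  rcases le_or_gt r (e * N) with hr | hr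
  · exact coeff_forestQPoly_nonneg_of_le hr
  have hP := isPalindromic_forestQPoly he
  rcases le_or_gt r (2 * e * N) with hr' | hr'
  · rw [hP.coeff_eq hr']
    exact coeff_forestQPoly_nonneg_of_le (by rw [mul_assoc] at hr' ⊢; omega)
  · rw [coeff_eq_zero_of_natDegree_lt (hP.1.trans_lt hr')]

theorem exists_map_eq_forestQPoly (N e : ℕ) :
    ∃ P : ℕ[X], P.map (Nat.castRingHom ℤ) = forestQPoly N e := by
  have h : forestQPoly N e ∈ lifts (Nat.castRingHom ℤ) := by
    refine (lifts_iff_coeff_lifts _).2 fun r => ?_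
    exact ⟨_, Int.toNat_of_nonneg (coeff_forestQPoly_nonneg N e r)⟩
  exact (mem_lifts _).1 h

end Nonnegativity

theorem theorem1p3 (n k : ℕ) [NeZero n] (hk : 1 ≤ k) (hkn : k ≤ n) :
    ∃ P : Polynomial ℕ, toRatFunc P = forestRatFunc n k ∧
      ExhibitsCSP (NoncrossingForest n k) (RotationGroup n) P := by
  obtain ⟨P, hP⟩ := exists_map_eq_forestQPoly (n - 1) (n - k)
  refine ⟨P, by rw [← intRatFunc_map, hP, intRatFunc_forestQPoly hk hkn], fun c ω hω => ?_⟩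
  have heval : P.eval₂ (Nat.castRingHom ℂ) ω =
      Polynomial.aeval ω (forestQPoly (n - 1) (n - k)) := by
    rw [← hP, Polynomial.aeval_def, Polynomial.eval₂_map]
    congr 1
  obtain ⟨m, hn⟩ : orderOf c ∣ n := by
    simpa only [card_rotationGroup] using orderOf_dvd_natCard c
  generalize hd : orderOf c = d at hω hn
  rw [heval, card_fixed_eq hn c hd]
  have hm : m ≠ 0 := by
    rintro rfl
    exact NeZero.ne n hn
  obtain ⟨m, rfl⟩ := Nat.exists_eq_succ_of_ne_zero hm
  have hd0 : d ≠ 0 := by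
    rintro rfl
    exact NeZero.ne n (by rw [hn, zero_mul])
  obtain rfl | hd2 : d = 1 ∨ 2 ≤ d := by omega
  · rw [IsPrimitiveRoot.one_right_iff] at hω
    subst hω
    rw [one_mul] at hn
    rw [← hn]
    have h := card_invariant_self hkn
    rw [← forestQPoly_eval_one] at h
    have h' := congrArg (Int.cast (R := ℂ)) h
    rw [Int.cast_natCast] at h'
    rw [h', Polynomial.aeval_def, Polynomial.eval₂_at_one]
    rfl
  have hN : n - 1 = d * m + (d - 1) := by
    rw [hn, Nat.mul_succ]
    omega
  by_cases he : d ∣ n - k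
  · obtain ⟨e, he⟩ := he
    rw [hN, he, aeval_forestQPoly_of_dvd hω hd2, ← Int.cast_natCast (R := ℂ),
      card_invariant_of_dvd hn hd2 hkn he]
    simp
  obtain rfl | hd3 : d = 2 ∨ 3 ≤ d := by omega
  · obtain ⟨e, he'⟩ : ∃ e, n - k = 2 * e + 1 := ⟨(n - k) / 2, by omega⟩
    rw [hN, he', aeval_forestQPoly_two_of_odd hω, ← Int.cast_natCast (R := ℂ),
      card_invariant_two_of_odd hn hkn he']
  · rw [hN, aeval_forestQPoly_of_not_dvd hω hd3 m he, card_invariant_of_not_dvd hn hd3 hkn he,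
      Nat.cast_zero]
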